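/- Let $G$ be a connected real Lie group with Lie algebra $\mathfrak g$, $H\subset G$ a closed subgroup with Lie algebra $\mathfrak h$, and suppose given a reductive decomposition $\mathfrak g=\mathfrak h\oplus\mathfrak m$, $\mathrm{Ad}_H(\mathfrak m)=\mathfrak m$; write $u_{\mathfrak m}$ for the component of $u\in\mathfrak g$ in $\mathfrak m$. Let $p:G\to G/H$ be the projection, $\bar e=p(e)$, and let $\lambda_g:G/H\to G/H$ be the translation by $g\in G$. Identify $\mathfrak m$ with $T_{\bar e}(G/H)$ by $u\mapsto T_ep(u)$, and $\mathfrak m^*$ with $T^*_{\bar e}(G/H)$ accordingly. Let $\pi$ be a $G$-invariant Poisson tensor on $G/H$, with $\alpha^\#$ defined by $\langle\beta,\alpha^\#\rangle=\pi(\alpha,\beta)$. Let $r\in\wedge^2\mathfrak m$ be its value at $\bar e$, with $\langle\xi,\eta^\#\rangle=r(\eta,\xi)$ for $\eta,\xi\in\mathfrak m^*$. For $u\in\mathfrak m$ let $l_u:\mathfrak m\to\mathfrak m$, $l_u(v)=[u,v]_{\mathfrak m}$, and put $[\eta,\xi]_r=\eta\circ l_{\xi^\#}-\xi\circ l_{\eta^\#}$.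 A contravariant connection on $(G/H,\pi)$ is an $\mathbb R$-bilinear map $D:\Omega^1(G/H)\times\Omega^1(G/H)\to\Omega^1(G/H)$ with $D_{f\alpha}\beta=fD_\alpha\beta$ and $D_\alpha(f\beta)=(\alpha^\#\cdot f)\beta+fD_\alpha\beta$ for smooth $f$. It is $G$-invariant if $\lambda_g^*(D_\alpha\beta)=D_{\lambda_g^*\alpha}(\lambda_g^*\beta)$ for all $g\in G$. It is torsionless if $D_\alpha\beta-D_\beta\alpha=[\alpha,\beta]_\pi:=\mathcal L_{\alpha^\#}\beta-\mathcal L_{\beta^\#}\alpha-d(\pi(\alpha,\beta))$ for all $\alpha,\beta$. It is Poisson if $D\pi=0$, where $D\pi(\alpha,\beta,\gamma)=\alpha^\#\cdot\pi(\beta,\gamma)-\pi(D_\alpha\beta,\gamma)-\pi(\beta,D_\alpha\gamma)$. It is Fedosov if it is torsionless and Poisson. For $\beta\in\Omega^1(G/H)$ let $F^\beta:G\to\mathfrak m^*$, $F^\beta(g)=(T_{\bar e}\lambda_g)^*\beta_{p(g)}$. A bilinear map $\mathfrak b:\mathfrak m^*\times\mathfrak m^*\to\mathfrak m^*$ is called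 associated with $D$ if $$(D_\alpha\beta)(\bar e)=\mathfrak b(\alpha_{\bar e},\beta_{\bar e})+(dF^\beta)_e\big(\alpha_{\bar e}^\#\big)\qquad\text{for all }\alpha,\beta\in\Omega^1(G/H),$$ where $\alpha_{\bar e}^\#\in\mathfrak m\subset\mathfrak g=T_eG$. **Theorem.** 1. Every $G$-invariant contravariant connection $D$ on $(G/H,\pi)$ has exactly one associated bilinear map $\mathfrak b$, and $D\pi=0$ if and only if $$r(\mathfrak b(\eta,\xi),\varepsilon)+r(\xi,\mathfrak b(\eta,\varepsilon))=0\qquad\text{for all }\eta,\xi,\varepsilon\in\mathfrak m^*.$$ 2. There is exactly one $G$-invariant contravariant connection $D$ on $(G/H,\pi)$ whose associated bilinear map is $$\mathfrak b(\eta,\xi)=\tfrac13\big([\eta,\xi]_r-\xi\circ l_{\eta^\#}\big),$$ and this $D$ is a Fedosov contravariant connection. -/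

import Mathlib

open scoped Manifold ContDiff

noncomputable section

/-! ### Tangent and cotangent spaces, one-forms, bivector fields -/

namespace ContravariantGeometry

instance tangentSpace_t2Space {F : Type*} [NormedAddCommGroup F] [NormedSpace ℝ F]
    {M : Type*} [TopologicalSpace M] [ChartedSpace F M] (x : M) :
    T2Space (TangentSpace 𝓘(ℝ, F) x) :=
  inferInstanceAs (T2Space F)

instance tangentSpace_finiteDimensional {F : Type*} [NormedAddCommGroup F] [NormedSpace ℝ F]
    [FiniteDimensional ℝ F] {M : Type*} [TopologicalSpace M] [ChartedSpace F M] (x : M) :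
    FiniteDimensional ℝ (TangentSpace 𝓘(ℝ, F) x) :=
  inferInstanceAs (FiniteDimensional ℝ F)

/-- The cotangent space `T*ₓM` of a manifold `M` modelled on `F`. -/
abbrev CotangentSpace (F : Type*) [NormedAddCommGroup F] [NormedSpace ℝ F]
    {M : Type*} [TopologicalSpace M] [ChartedSpace F M] (x : M) : Type _ :=
  TangentSpace 𝓘(ℝ, F) x →L[ℝ] ℝ

/-- The space `Ω¹(M)` of smooth one-forms: smooth sections of the cotangent bundle. -/
abbrev OneForm (F : Type*) [NormedAddCommGroup F] [NormedSpace ℝ F]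
    (M : Type*) [TopologicalSpace M] [ChartedSpace F M] [IsManifold 𝓘(ℝ, F) ∞ M] : Type _ :=
  Cₛ^∞⟮𝓘(ℝ, F); F →L[ℝ] ℝ, (CotangentSpace F : M → Type _)⟯

/-- The space of smooth vector fields: smooth sections of the tangent bundle. -/
abbrev SmoothVectorField (F : Type*) [NormedAddCommGroup F] [NormedSpace ℝ F]
    (M : Type*) [TopologicalSpace M] [ChartedSpace F M] [IsManifold 𝓘(ℝ, F) ∞ M] : Type _ :=
  Cₛ^∞⟮𝓘(ℝ, F); F, (TangentSpace 𝓘(ℝ, F) : M → Type _)⟯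

/-- The differential of a real function at a point, as a covector. -/
def differential {F : Type*} [NormedAddCommGroup F] [NormedSpace ℝ F]
    {M : Type*} [TopologicalSpace M] [ChartedSpace F M] (f : M → ℝ) (x : M) :
    CotangentSpace F x :=
  (NormedSpace.fromTangentSpace (𝕜 := ℝ) (f x)).toContinuousLinearMap ∘L
    mfderiv 𝓘(ℝ, F) 𝓘(ℝ, ℝ) f x

/-- A smooth skew-symmetric bivector field `π`, given by its bundle map
`π_# : T*M → TM`, `α ↦ α^#`; as a bilinear form on covectors, `π(α, β) = β(α^#)`. -/
structure BivectorField (F : Type*) [NormedAddCommGroup F] [NormedSpace ℝ F]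
    (M : Type*) [TopologicalSpace M] [ChartedSpace F M] [IsManifold 𝓘(ℝ, F) ∞ M] where
  /-- the bundle map `α ↦ α^#` -/
  sharp : Cₛ^∞⟮𝓘(ℝ, F); (F →L[ℝ] ℝ) →L[ℝ] F,
    fun x : M => CotangentSpace F x →L[ℝ] TangentSpace 𝓘(ℝ, F) x⟯
  skew : ∀ (x : M) (α β : CotangentSpace F x), β (sharp x α) = -α (sharp x β)

section Manifold

variable {F : Type*} [NormedAddCommGroup F] [NormedSpace ℝ F]
  {M : Type*} [TopologicalSpace M] [ChartedSpace F M] [IsManifold 𝓘(ℝ, F) ∞ M]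

namespace BivectorField

/-- `π(α, β) = ⟨β, α^#⟩` for covectors `α`, `β` at `x`. -/
def pairing (π : BivectorField F M) (x : M) (α β : CotangentSpace F x) : ℝ :=
  β (π.sharp x α)

/-- The bracket `{f, g} = π(df, dg)` of functions. -/
def bracket (π : BivectorField F M) (f g : M → ℝ) : M → ℝ :=
  fun x => π.pairing x (differential f x) (differential g x)

/-- `π` is a Poisson tensor: its bracket of smooth functions satisfies the Jacobi identity
(that is, the Schouten bracket `[π, π]` vanishes). -/
def IsPoisson (π : BivectorField F M) : Prop :=
  ∀ f g h : C^∞⟮𝓘(ℝ, F), M; 𝓘(ℝ, ℝ), ℝ⟯, ∀ x : M,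
    π.bracket (π.bracket f g) h x + π.bracket (π.bracket g h) f x
      + π.bracket (π.bracket h f) g x = 0

end BivectorField

/-- The Lie derivative `L_Y β` of a one-form along a vector field, evaluated on the vector
field `X` at `x`: `(L_Y β)(X) = Y · β(X) - β([Y, X])`. -/
def lieDerivative (Y : (x : M) → TangentSpace 𝓘(ℝ, F) x) (β : OneForm F M)
    (X : SmoothVectorField F M) (x : M) : ℝ :=
  differential (fun y => β y (X y)) x (Y x)
    - β x (VectorField.mlieBracket 𝓘(ℝ, F) Y (fun y => X y) x)

/-- The Koszul bracket `[α, β]_π = L_{α^#} β - L_{β^#} α - d(π(α, β))` of one-forms, evaluated on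
the vector field `X` at `x`. -/
def koszulBracket (π : BivectorField F M) (α β : OneForm F M)
    (X : SmoothVectorField F M) (x : M) : ℝ :=
  lieDerivative (fun y => π.sharp y (α y)) β X x - lieDerivative (fun y => π.sharp y (β y)) α X x
    - differential (fun y => π.pairing y (α y) (β y)) x (X x)

/-- A contravariant connection on `(M, π)`: an `ℝ`-bilinear map `D : Ω¹(M) × Ω¹(M) → Ω¹(M)` with
`D_{fα} β = f D_α β` and `D_α (fβ) = (α^# · f) β + f D_α β` for smooth functions `f`. In the two
axioms `γ` is the one-form `f α`, respectively `f β`. -/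
structure ContravariantConnection (π : BivectorField F M) where
  /-- the underlying bilinear map `(α, β) ↦ D_α β` -/
  toBilin : OneForm F M →ₗ[ℝ] OneForm F M →ₗ[ℝ] OneForm F M
  smul_left : ∀ (f : C^∞⟮𝓘(ℝ, F), M; 𝓘(ℝ, ℝ), ℝ⟯) (α β γ : OneForm F M),
    (∀ x, γ x = f x • α x) → ∀ x, toBilin γ β x = f x • toBilin α β x
  leibniz : ∀ (f : C^∞⟮𝓘(ℝ, F), M; 𝓘(ℝ, ℝ), ℝ⟯) (α β γ : OneForm F M),
    (∀ x, γ x = f x • β x) → ∀ x, toBilin α γ x =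
      differential f x (π.sharp x (α x)) • β x + f x • toBilin α β x

namespace ContravariantConnection

variable {π : BivectorField F M}

/-- The torsion `T(α, β) = D_α β - D_β α - [α, β]_π`, evaluated on the vector field `X`
at `x`. -/
def torsion (D : ContravariantConnection π) (α β : OneForm F M)
    (X : SmoothVectorField F M) (x : M) : ℝ :=
  D.toBilin α β x (X x) - D.toBilin β α x (X x) - koszulBracket π α β X x

/-- `D` is torsionless. -/
def IsTorsionless (D : ContravariantConnection π) : Prop :=
  ∀ (α β : OneForm F M) (X : SmoothVectorField F M) (x : M), D.torsion α β X x = 0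

/-- `Dπ(α, β, γ) = α^# · π(β, γ) - π(D_α β, γ) - π(β, D_α γ)`. -/
def covDerivBivector (D : ContravariantConnection π) (α β γ : OneForm F M) (x : M) : ℝ :=
  differential (fun y => π.pairing y (β y) (γ y)) x (π.sharp x (α x))
    - π.pairing x (D.toBilin α β x) (γ x) - π.pairing x (β x) (D.toBilin α γ x)

/-- `D` is a Poisson connection: `Dπ = 0`. -/
def IsPoisson (D : ContravariantConnection π) : Prop :=
  ∀ (α β γ : OneForm F M) (x : M), D.covDerivBivector α β γ x = 0

/-- A Fedosov contravariant connection is a torsionless Poisson connection. -/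
def IsFedosov (D : ContravariantConnection π) : Prop :=
  D.IsTorsionless ∧ D.IsPoisson

end ContravariantConnection

end Manifold

/-! ### Group actions on manifolds and invariance -/

section Action

variable {F : Type*} [NormedAddCommGroup F] [NormedSpace ℝ F]
  {M : Type*} [TopologicalSpace M] [ChartedSpace F M] {G : Type*} [Group G] [MulAction G M]

variable (F) in
/-- The tangent map `T_x λ_g : T_x M → T_{g • x} M` of the translation `λ_g : y ↦ g • y`. -/
def translationDeriv (g : G) (x : M) :
    TangentSpace 𝓘(ℝ, F) x →L[ℝ] TangentSpace 𝓘(ℝ, F) (g • x) :=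
  mfderiv 𝓘(ℝ, F) 𝓘(ℝ, F) (fun y : M => g • y) x

variable [IsManifold 𝓘(ℝ, F) ∞ M]

/-- The pullback `λ_g^* β` at the point `x`. -/
def pullback (g : G) (β : OneForm F M) (x : M) : CotangentSpace F x :=
  β (g • x) ∘L translationDeriv F g x

variable (G) in
/-- `G`-invariance of a bivector field:
`π_#` at `g • x` equals `T_x λ_g ∘ π_# ∘ (T_x λ_g)^*`. -/
def BivectorField.IsInvariant (π : BivectorField F M) : Prop :=
  ∀ (g : G) (x : M) (α : CotangentSpace F (g • x)),
    π.sharp (g • x) α = translationDeriv F g x (π.sharp x (α ∘L translationDeriv F g x))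

variable (G) in
/-- `G`-invariance of a contravariant connection: `λ_g^* (D_α β) = D_{λ_g^* α} (λ_g^* β)` for all
`g`, `α`, `β`. Here `α'` and `β'` are the one-forms `λ_g^* α` and `λ_g^* β`. -/
def ContravariantConnection.IsInvariant {π : BivectorField F M}
    (D : ContravariantConnection π) : Prop :=
  ∀ (g : G) (α β α' β' : OneForm F M),
    (∀ x, α' x = pullback g α x) → (∀ x, β' x = pullback g β x) →
      ∀ x, D.toBilin α' β' x = pullback g (D.toBilin α β) x

end Action

/-! ### Reductive pairs -/

section LieGroup

variable {E : Type*} [NormedAddCommGroup E] [NormedSpace ℝ E]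
  {G : Type*} [TopologicalSpace G] [ChartedSpace E G] [Group G]

instance lieGroup_minSmoothness [LieGroup 𝓘(ℝ, E) ∞ G] :
    LieGroup 𝓘(ℝ, E) (minSmoothness ℝ 3) G :=
  LieGroup.of_le (n := ∞) (by simpa using ENat.LEInfty.out (m := (3 : WithTop ℕ∞)))

variable (E) in
/-- The adjoint action `Ad_a : 𝔤 → 𝔤`, the derivative at `1` of `g ↦ a g a⁻¹`. -/
def Ad (a : G) : GroupLieAlgebra 𝓘(ℝ, E) G →L[ℝ] GroupLieAlgebra 𝓘(ℝ, E) G :=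
  (mfderiv 𝓘(ℝ, E) 𝓘(ℝ, E) (fun g : G => a * g * a⁻¹) 1 :)

/-- `u ∈ 𝔤` is the velocity at `0` of a smooth curve through `1` lying in the subgroup `H`. -/
def IsVelocityIn (H : Subgroup G) (u : GroupLieAlgebra 𝓘(ℝ, E) G) : Prop :=
  ∃ γ : ℝ → G, ContMDiffAt 𝓘(ℝ, ℝ) 𝓘(ℝ, E) ∞ γ 0 ∧ γ 0 = 1 ∧ (∀ t, γ t ∈ H) ∧
    (mfderiv 𝓘(ℝ, ℝ) 𝓘(ℝ, E) γ 0 (1 : ℝ) : E) = u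

theorem mfderiv_mul_one_one [LieGroup 𝓘(ℝ, E) ∞ G] (a b : G) (ha : a = 1) (hb : b = 1) (v w : E) :
    (mfderiv (𝓘(ℝ, E).prod 𝓘(ℝ, E)) 𝓘(ℝ, E) (fun p : G × G => p.1 * p.2) (a, b) (v, w) : E)
      = v + w := by
  subst ha hb
  have h := mfderiv_prod_eq_add_apply (p := ((1 : G), (1 : G))) (v := (v, w))
    ((contMDiff_mul 𝓘(ℝ, E) ∞ (G := G)).mdifferentiable (by simp) (1, 1))
  have e₁ : (fun z : G => z * 1) = id := funext mul_one
  have e₂ : (fun z : G => 1 * z) = id := funext one_mul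
  have h₁ : mfderiv 𝓘(ℝ, E) 𝓘(ℝ, E) (fun z : G => z * 1) 1 =
      ContinuousLinearMap.id ℝ E := by rw [e₁]; exact mfderiv_id
  have h₂ : mfderiv 𝓘(ℝ, E) 𝓘(ℝ, E) (fun z : G => 1 * z) 1 =
      ContinuousLinearMap.id ℝ E := by rw [e₂]; exact mfderiv_id
  exact h.trans (congrArg₂ (· + ·) (congrArg (fun L : E →L[ℝ] E => L v) h₁)
    (congrArg (fun L : E →L[ℝ] E => L w) h₂))

theorem IsVelocityIn.add [LieGroup 𝓘(ℝ, E) ∞ G] {H : Subgroup G}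
    {u v : GroupLieAlgebra 𝓘(ℝ, E) G} (hu : IsVelocityIn H u) (hv : IsVelocityIn H v) :
    IsVelocityIn H (u + v) := by
  obtain ⟨γ, hγ, hγ0, hγH, rfl⟩ := hu
  obtain ⟨δ, hδ, hδ0, hδH, rfl⟩ := hv
  refine ⟨fun t => γ t * δ t, hγ.mul hδ, by simp [hγ0, hδ0],
    fun t => H.mul_mem (hγH t) (hδH t), ?_⟩
  have hd := hγ.mdifferentiableAt (by simp)
  have hd' := hδ.mdifferentiableAt (by simp)
  have hc := mfderiv_comp (I := 𝓘(ℝ, ℝ)) (I' := 𝓘(ℝ, E).prod 𝓘(ℝ, E)) (I'' := 𝓘(ℝ, E)) (0 : ℝ)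
    (g := fun p : G × G => p.1 * p.2) (f := fun t => (γ t, δ t))
    ((contMDiff_mul 𝓘(ℝ, E) ∞ (G := G)).mdifferentiable (by simp) _) (hd.prodMk hd')
  have hp := mfderiv_prodMk hd hd'
  have := congrArg (fun L => L (1 : ℝ)) hc
  refine this.trans ?_
  erw [ContinuousLinearMap.comp_apply, hp]
  exact mfderiv_mul_one_one _ _ hγ0 hδ0 _ _

theorem IsVelocityIn.smul {H : Subgroup G}
    {u : GroupLieAlgebra 𝓘(ℝ, E) G} (c : ℝ) (hu : IsVelocityIn H u) :
    IsVelocityIn H (c • u) := by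
  obtain ⟨γ, hγ, hγ0, hγH, rfl⟩ := hu
  have hm : ContMDiff 𝓘(ℝ, ℝ) 𝓘(ℝ, ℝ) ∞ (fun t : ℝ => c * t) :=
    (contDiff_const.mul contDiff_id).contMDiff
  have hγ' : ContMDiffAt 𝓘(ℝ, ℝ) 𝓘(ℝ, E) ∞ γ (c * 0) := by rwa [mul_zero]
  refine ⟨fun t => γ (c * t), hγ'.comp (0 : ℝ) hm.contMDiffAt, by simp [hγ0],
    fun t => hγH _, ?_⟩
  have hc := mfderiv_comp (I := 𝓘(ℝ, ℝ)) (I' := 𝓘(ℝ, ℝ)) (I'' := 𝓘(ℝ, E)) (0 : ℝ)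
    (g := γ) (f := fun t : ℝ => c * t)
    (hγ'.mdifferentiableAt (by simp)) (hm.mdifferentiableAt (by simp))
  have h₁ : (mfderiv 𝓘(ℝ, ℝ) 𝓘(ℝ, ℝ) (fun t : ℝ => c * t) 0 (1 : ℝ) : ℝ) = c := by
    rw [mfderiv_eq_fderiv]
    have := ((hasDerivAt_id (0 : ℝ)).const_mul c).hasFDerivAt.fderiv
    simp only [id] at this
    exact (congrArg (fun L : ℝ →L[ℝ] ℝ => L 1) this).trans (by simp)
  have h₂ : ∀ s : ℝ, s = 0 → ∀ a : ℝ, (mfderiv 𝓘(ℝ, ℝ) 𝓘(ℝ, E) γ s a : E) =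
      a • (mfderiv 𝓘(ℝ, ℝ) 𝓘(ℝ, E) γ 0 (1 : ℝ) : E) := by
    rintro s rfl a
    exact (congrArg (fun b : ℝ => (mfderiv 𝓘(ℝ, ℝ) 𝓘(ℝ, E) γ 0 b : E)) (mul_one a).symm).trans
      ((mfderiv 𝓘(ℝ, ℝ) 𝓘(ℝ, E) γ 0).map_smul a (1 : ℝ))
  exact (congrArg (fun L => L (1 : ℝ)) hc).trans ((h₂ (c * 0) (mul_zero c) _).trans
    (congrArg (fun a : ℝ => a • (mfderiv 𝓘(ℝ, ℝ) 𝓘(ℝ, E) γ 0 (1 : ℝ) : E)) h₁))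

theorem IsVelocityIn.zero (H : Subgroup G) :
    IsVelocityIn H (0 : GroupLieAlgebra 𝓘(ℝ, E) G) := by
  refine ⟨fun _ => 1, contMDiffAt_const, rfl, fun _ => H.one_mem, ?_⟩
  exact congrArg (fun L : ℝ →L[ℝ] E => L 1) (mfderiv_const (c := (1 : G)) (x := (0 : ℝ)))

variable (E) in
/-- The Lie algebra `𝔥 ⊆ 𝔤` of a closed subgroup `H`: the velocities of smooth curves in `H`
through `1`. -/
def subgroupLieAlgebra [LieGroup 𝓘(ℝ, E) ∞ G] (H : Subgroup G) :
    Submodule ℝ (GroupLieAlgebra 𝓘(ℝ, E) G) where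
  carrier := {u | IsVelocityIn H u}
  add_mem' := IsVelocityIn.add
  zero_mem' := IsVelocityIn.zero H
  smul_mem' c _ hu := IsVelocityIn.smul c hu

variable (E) in
/-- A reductive decomposition `𝔤 = 𝔥 ⊕ 𝔪` with `Ad_H(𝔪) = 𝔪`. -/
structure ReductiveComplement [LieGroup 𝓘(ℝ, E) ∞ G] (H : Subgroup G) where
  /-- the complement `𝔪` -/
  space : Submodule ℝ (GroupLieAlgebra 𝓘(ℝ, E) G)
  isCompl : IsCompl (subgroupLieAlgebra E H) space
  map_Ad : ∀ a ∈ H, space.map (Ad E a : GroupLieAlgebra 𝓘(ℝ, E) G →ₗ[ℝ] _) = space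

namespace ReductiveComplement

variable [LieGroup 𝓘(ℝ, E) ∞ G] {H : Subgroup G} (𝔪 : ReductiveComplement E H)

/-- The dual space `𝔪*`. -/
abbrev Dual : Type _ := Module.Dual ℝ 𝔪.space

/-- The projection `u ↦ u_𝔪` of `𝔤 = 𝔥 ⊕ 𝔪` onto `𝔪`. -/
def proj : GroupLieAlgebra 𝓘(ℝ, E) G →ₗ[ℝ] 𝔪.space :=
  Submodule.projectionOnto 𝔪.space (subgroupLieAlgebra E H) 𝔪.isCompl.symm

/-- The canonical extension `η̃ ∈ 𝔤*` of `η ∈ 𝔪*`, vanishing on `𝔥`. -/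
def extend (η : 𝔪.Dual) : Module.Dual ℝ (GroupLieAlgebra 𝓘(ℝ, E) G) :=
  η ∘ₗ 𝔪.proj

variable [FiniteDimensional ℝ E]

/-- The dual `ad_u^* η = η ∘ ad_u` of `ad_u = [u, ·]`, for `η ∈ 𝔤*`. -/
def adStar (u : GroupLieAlgebra 𝓘(ℝ, E) G) (η : Module.Dual ℝ (GroupLieAlgebra 𝓘(ℝ, E) G)) :
    Module.Dual ℝ (GroupLieAlgebra 𝓘(ℝ, E) G) :=
  haveI : CompleteSpace E := FiniteDimensional.complete ℝ E
  η ∘ₗ (LieAlgebra.ad ℝ (GroupLieAlgebra 𝓘(ℝ, E) G) u :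
    GroupLieAlgebra 𝓘(ℝ, E) G →ₗ[ℝ] GroupLieAlgebra 𝓘(ℝ, E) G)

/-- The map `l_u : 𝔪 → 𝔪`, `v ↦ [u, v]_𝔪`, for `u ∈ 𝔪`. -/
def leftMul (u : 𝔪.space) : 𝔪.space →ₗ[ℝ] 𝔪.space :=
  haveI : CompleteSpace E := FiniteDimensional.complete ℝ E
  𝔪.proj ∘ₗ (LieAlgebra.ad ℝ (GroupLieAlgebra 𝓘(ℝ, E) G) (u : GroupLieAlgebra 𝓘(ℝ, E) G) :
    GroupLieAlgebra 𝓘(ℝ, E) G →ₗ[ℝ] GroupLieAlgebra 𝓘(ℝ, E) G) ∘ₗ 𝔪.space.subtype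

/-! ### The homogeneous space `G ⧸ H` -/

variable {F : Type*} [NormedAddCommGroup F] [NormedSpace ℝ F] [FiniteDimensional ℝ F]
  [ChartedSpace F (G ⧸ H)]

variable (F) in
/-- The map `𝔪 → T_ē(G/H)`, `u ↦ T_e p(u)`, where `p : G → G/H` is the projection and
`ē = p(e)`; when `p` is a submersion its kernel on `𝔤` is `𝔥`, so this is an isomorphism and
`ContinuousLinearMap.inverse` below is its genuine inverse. -/
def toTangent : 𝔪.space →L[ℝ] TangentSpace 𝓘(ℝ, F) ((1 : G) : G ⧸ H) :=
  (mfderiv 𝓘(ℝ, E) 𝓘(ℝ, F) (QuotientGroup.mk : G → G ⧸ H) 1) ∘L 𝔪.space.subtypeL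

/-- The identification `T*_ē(G/H) → 𝔪*` dual to `𝔪 ≅ T_ē(G/H)`. -/
def ofCotangent (α : CotangentSpace F ((1 : G) : G ⧸ H)) : 𝔪.Dual :=
  (α ∘L 𝔪.toTangent F : 𝔪.space →L[ℝ] ℝ)

variable (F) in
/-- The inverse identification `𝔪* → T*_ē(G/H)`. -/
def toCotangent : 𝔪.Dual →ₗ[ℝ] CotangentSpace F ((1 : G) : G ⧸ H) where
  toFun η := LinearMap.toContinuousLinearMap
    (η ∘ₗ ((𝔪.toTangent F).inverse : TangentSpace 𝓘(ℝ, F) ((1 : G) : G ⧸ H) →ₗ[ℝ] 𝔪.space))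
  map_add' η ξ := by ext v; rfl
  map_smul' c η := by ext v; rfl

variable [IsManifold 𝓘(ℝ, F) ∞ (G ⧸ H)]

/-- The map `𝔪* → 𝔪`, `η ↦ η^#`, obtained from `π_#` at `ē`. -/
def sharp (π : BivectorField F (G ⧸ H)) : 𝔪.Dual →ₗ[ℝ] 𝔪.space :=
  ((𝔪.toTangent F).inverse : TangentSpace 𝓘(ℝ, F) ((1 : G) : G ⧸ H) →ₗ[ℝ] 𝔪.space) ∘ₗ
    (π.sharp ((1 : G) : G ⧸ H) :
      CotangentSpace F ((1 : G) : G ⧸ H) →ₗ[ℝ] TangentSpace 𝓘(ℝ, F) ((1 : G) : G ⧸ H)) ∘ₗ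
    𝔪.toCotangent F

/-- The bivector `r ∈ ∧²𝔪` of `π`: the value of `π` at `ē`, as a bilinear form on `𝔪*`. -/
def bivector (π : BivectorField F (G ⧸ H)) (η ξ : 𝔪.Dual) : ℝ :=
  π.pairing ((1 : G) : G ⧸ H) (𝔪.toCotangent F η) (𝔪.toCotangent F ξ)

/-- The bracket `[η, ξ]_r = (-ad^*_{η^#} ξ̃ + ad^*_{ξ^#} η̃)|_𝔪` on `𝔪*`. -/
def rBracket (π : BivectorField F (G ⧸ H)) (η ξ : 𝔪.Dual) : 𝔪.Dual :=
  (-adStar (𝔪.sharp π η : GroupLieAlgebra 𝓘(ℝ, E) G) (𝔪.extend ξ)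
    + adStar (𝔪.sharp π ξ : GroupLieAlgebra 𝓘(ℝ, E) G) (𝔪.extend η)) ∘ₗ 𝔪.space.subtype

/-- The bilinear map `(η, ξ) ↦ ⅓ ([η, ξ]_r - ξ ∘ l_{η^#})` on `𝔪*`. -/
def fedosovMap (π : BivectorField F (G ⧸ H)) : 𝔪.Dual →ₗ[ℝ] 𝔪.Dual →ₗ[ℝ] 𝔪.Dual :=
  LinearMap.mk₂ ℝ
    (fun η ξ => (1 / 3 : ℝ) • (𝔪.rBracket π η ξ - ξ ∘ₗ 𝔪.leftMul (𝔪.sharp π η)))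
    (by
      intro η η' ξ
      ext u
      simp [rBracket, adStar, extend, leftMul]
      ring)
    (by
      intro c η ξ
      ext u
      simp [rBracket, adStar, extend, leftMul]
      ring)
    (by
      intro η ξ ξ'
      ext u
      simp [rBracket, adStar, extend, leftMul]
      ring)
    (by
      intro c η ξ
      ext u
      simp [rBracket, adStar, extend, leftMul]
      ring)

/-- The function `F^β : G → 𝔪*`, `F^β(g) = (T_ē λ_g)^* β_{g ē}`. -/
def equivariantFun (β : OneForm F (G ⧸ H)) (g : G) : 𝔪.Dual :=
  𝔪.ofCotangent (pullback g β ((1 : G) : G ⧸ H))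

/-- `b : 𝔪* × 𝔪* → 𝔪*` is the bilinear map associated with `D`:
`(D_α β)(ē) = b(α_ē, β_ē) + (dF^β)_e (α_ē^#)` for all one-forms `α`, `β`, where covectors at `ē`
are identified with elements of `𝔪*`. -/
def IsAssociated {π : BivectorField F (G ⧸ H)} (D : ContravariantConnection π)
    (b : 𝔪.Dual →ₗ[ℝ] 𝔪.Dual →ₗ[ℝ] 𝔪.Dual) : Prop :=
  ∀ (α β : OneForm F (G ⧸ H)) (u : 𝔪.space),
    𝔪.ofCotangent (D.toBilin α β ((1 : G) : G ⧸ H)) u =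
      b (𝔪.ofCotangent (α ((1 : G) : G ⧸ H))) (𝔪.ofCotangent (β ((1 : G) : G ⧸ H))) u
        + differential (F := E) (fun g : G => 𝔪.equivariantFun β g u) 1
            (𝔪.sharp π (𝔪.ofCotangent (α ((1 : G) : G ⧸ H))) : GroupLieAlgebra 𝓘(ℝ, E) G)

end ReductiveComplement


end LieGroup

end ContravariantGeometry
end

/-! A one-form β on G/H amounts to a smooth map F^β : G → 𝔪* with F^β(gh) = F^β(g) ∘ Ad_h for h ∈ H.
Indeed F^β(g)(u) is β evaluated on the image under Tp of the left-invariant field of u at g, and as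
u runs over 𝔪 these images fill T_{gH}(G/H) bijectively. In this picture invariant objects become
constant. Pullback by λ_a is left translation, π(α,β) ∘ p is r(F^α, F^β), and α^#·f is the
derivative of f ∘ p along the left-invariant field of (F^α)^# (`equivariantFun_pullback`,
`sharp_oneForm`, `pairing_oneForm`).

The expression F^{D_α β}(e) − (dF^β)_e(α^#) is tensorial in α and β, so it depends only on their
values at ē and defines 𝔟 (`eq_zero_of_tensorial`, `exists_isAssociated`). Invariance then gives
F^{D_α β} = 𝔟(F^α, F^β) + (F^α)^#·F^β on all of G (`equivariantFun_connection`). In Dπ the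
derivative terms cancel because r is constant, leaving the algebraic condition
(`covDerivBivector_eq`).

Conversely, for an Ad_H-equivariant 𝔟 this formula defines an invariant connection
(`exists_connection`). The analytic point is that a smooth equivariant function on G descends to a
smooth form (`exists_oneForm_equivariantFun_eq`). The map of part 2 is equivariant because Ad_h
preserves the bracket, the projection to 𝔪, and r.

The Fedosov property is checked on exact forms. There F^{df}(g)(u) is the derivative of f ∘ p along
u, so commuting second derivatives produces F^{df}([u,v]_𝔪) (`dualDeriv_exteriorDerivative_sub`).
Since [df, dk]_π = d{f,k}, vanishing torsion becomes 𝔟(η,ξ) − 𝔟(ξ,η) = [η,ξ]_r, and the Jacobi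
identity becomes a cyclic identity for r (`cyclic_sum_leftMul_sharp`). For 𝔟 = a η∘l_{ξ^#} + c
ξ∘l_{η^#}, the first requirement holds if a − c = 1, and the Poisson condition follows from the
cyclic identity if c = −2a. This gives a = 1/3, c = −2/3, which is the stated map. -/

noncomputable section
namespace ContravariantGeometry

open Topology VectorField

/-! ### Global frames and tensoriality of function-linear maps -/

section Tensoriality

open Bundle

variable {F : Type*} [NormedAddCommGroup F] [NormedSpace ℝ F] [FiniteDimensional ℝ F]
  {M : Type*} [TopologicalSpace M] [ChartedSpace F M] [IsManifold 𝓘(ℝ, F) ∞ M] [T2Space M]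
  {W : Type*} [NormedAddCommGroup W] [NormedSpace ℝ W] [FiniteDimensional ℝ W]
  {V : M → Type*} [TopologicalSpace (TotalSpace W V)] [∀ x, AddCommGroup (V x)]
  [∀ x, Module ℝ (V x)] [∀ x, TopologicalSpace (V x)] [FiberBundle W V] [VectorBundle ℝ W V]
  [ContMDiffVectorBundle ∞ W V 𝓘(ℝ, F)]

/-- The product of a smooth function and a smooth section. -/
def smulSection (f : C^∞⟮𝓘(ℝ, F), M; 𝓘(ℝ, ℝ), ℝ⟯) (s : Cₛ^∞⟮𝓘(ℝ, F); W, V⟯) :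
    Cₛ^∞⟮𝓘(ℝ, F); W, V⟯ :=
  ⟨fun x => f x • s x, f.contMDiff.smul_section s.contMDiff⟩

theorem exists_bump_tsupport_subset (x : M) {u : Set M} (hu : u ∈ 𝓝 x) :
    ∃ ψ : C^∞⟮𝓘(ℝ, F), M; 𝓘(ℝ, ℝ), ℝ⟯, (ψ =ᶠ[𝓝 x] 1) ∧ tsupport ψ ⊆ u := by
  obtain ⟨ψ, -, h⟩ := (SmoothBumpFunction.nhds_basis_tsupport (I := 𝓘(ℝ, F)) x).mem_iff.1 hu
  exact ⟨⟨ψ, ψ.contMDiff⟩, ψ.eventuallyEq_one, h⟩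

/-- A section of a vector bundle multiplied by the square of a suitable bump function is a
combination of finitely many global sections. -/
theorem exists_global_frame (x : M) :
    ∃ (n : ℕ) (ε : Fin n → Cₛ^∞⟮𝓘(ℝ, F); W, V⟯) (ψ : C^∞⟮𝓘(ℝ, F), M; 𝓘(ℝ, ℝ), ℝ⟯), ψ x = 1 ∧
      ∀ s : Cₛ^∞⟮𝓘(ℝ, F); W, V⟯, ∃ c : Fin n → C^∞⟮𝓘(ℝ, F), M; 𝓘(ℝ, ℝ), ℝ⟯,
        (s x = 0 → ∀ i, c i x = 0) ∧
        smulSection ψ (smulSection ψ s) = ∑ i, smulSection (c i) (ε i) := by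
  let t := trivializationAt W V x
  have hx : x ∈ t.baseSet := FiberBundle.mem_baseSet_trivializationAt W V x
  let b := Module.finBasis ℝ W
  obtain ⟨ψ, hψ1, hψ⟩ := exists_bump_tsupport_subset (F := F) x (t.open_baseSet.mem_nhds hx)
  have : ContMDiffVectorBundle 1 W V 𝓘(ℝ, F) := ContMDiffVectorBundle.of_le (n := ∞) (by simp)
  -- One factor of ψ extends the local frame by zero and the other extends the coefficients, hence
  -- the square.
  refine ⟨_, fun i => ⟨fun y => ψ y • t.localFrame b i y,
    ContMDiffOn.smul_section_of_tsupport ψ.contMDiff.contMDiffOn t.open_baseSet hψ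
      (t.contMDiffOn_localFrame_baseSet ∞ b i)⟩, ψ, hψ1.self_of_nhds, fun s => ?_⟩
  have hc : ∀ i, ContMDiff 𝓘(ℝ, F) 𝓘(ℝ, ℝ) ∞
      (fun y => ψ y • (t.localFrameCoeff 𝓘(ℝ, F) b i y (s y))) := by
    intro i
    refine contMDiff_of_tsupport fun y hy => ?_
    have hy' : y ∈ t.baseSet := hψ (tsupport_smul_subset_left _ _ hy)
    exact ψ.contMDiff.contMDiffAt.smul
      (contMDiffAt_localFrameCoeff b hy' s.contMDiff.contMDiffAt i)
  refine ⟨fun i => ⟨_, hc i⟩, fun hs i => ?_, ?_⟩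
  · simp [hs]
  · ext y
    have e : (∑ i, smulSection (⟨_, hc i⟩ : C^∞⟮𝓘(ℝ, F), M; 𝓘(ℝ, ℝ), ℝ⟯)
        (⟨fun y => ψ y • t.localFrame b i y,
          ContMDiffOn.smul_section_of_tsupport ψ.contMDiff.contMDiffOn t.open_baseSet hψ
          (t.contMDiffOn_localFrame_baseSet ∞ b i)⟩ : Cₛ^∞⟮𝓘(ℝ, F); W, V⟯)) y =
        ∑ i, (ψ y • (t.localFrameCoeff 𝓘(ℝ, F) b i y (s y))) • ψ y • t.localFrame b i y := by
      have := map_sum (ContMDiffSection.coeAddHom 𝓘(ℝ, F) W ∞ V)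
        (fun i => smulSection (⟨_, hc i⟩ : C^∞⟮𝓘(ℝ, F), M; 𝓘(ℝ, ℝ), ℝ⟯)
        (⟨fun y => ψ y • t.localFrame b i y,
          ContMDiffOn.smul_section_of_tsupport ψ.contMDiff.contMDiffOn t.open_baseSet hψ
          (t.contMDiffOn_localFrame_baseSet ∞ b i)⟩ : Cₛ^∞⟮𝓘(ℝ, F); W, V⟯)) Finset.univ
      refine (congrFun this y).trans ?_
      rw [Finset.sum_apply]
      rfl
    refine Eq.trans ?_ e.symm
    change ψ y • ψ y • s y = _
    by_cases hy : y ∈ t.baseSet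
    · conv_lhs => rw [Trivialization.eq_sum_localFrameCoeff_smul (I := 𝓘(ℝ, F)) (b := b) hy (s := s)]
      rw [Finset.smul_sum, Finset.smul_sum]
      refine Finset.sum_congr rfl fun i _ => ?_
      simp only [smul_smul, smul_eq_mul]
      ring_nf
    · have : ψ y = 0 := image_eq_zero_of_notMem_tsupport fun h => hy (hψ h)
      simp [this]

/-- A linear map on sections which is homogeneous over smooth functions at `x` vanishes on the
sections vanishing at `x`. -/
theorem eq_zero_of_tensorial {A : Type*} [AddCommGroup A] [Module ℝ A]
    (Φ : Cₛ^∞⟮𝓘(ℝ, F); W, V⟯ →ₗ[ℝ] A) (x : M)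
    (hΦ : ∀ (f : C^∞⟮𝓘(ℝ, F), M; 𝓘(ℝ, ℝ), ℝ⟯) s, Φ (smulSection f s) = f x • Φ s)
    (s : Cₛ^∞⟮𝓘(ℝ, F); W, V⟯) (hs : s x = 0) : Φ s = 0 := by
  obtain ⟨n, ε, ψ, hψ, h⟩ := exists_global_frame (W := W) (V := V) (F := F) x
  obtain ⟨c, hc, e⟩ := h s
  -- Φ(s) = ψ(x)² Φ(s) = Σ cᵢ(x) Φ(εᵢ), and every cᵢ vanishes at x.
  have := congrArg Φ e
  rw [hΦ, hΦ, hψ, one_smul, one_smul, map_sum] at this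
  rw [this]
  exact Finset.sum_eq_zero fun i _ => by rw [hΦ, hc hs, zero_smul]

end Tensoriality

/-! ### Calculus of differentials of functions -/

section Calculus

variable {F : Type*} [NormedAddCommGroup F] [NormedSpace ℝ F]
  {M : Type*} [TopologicalSpace M] [ChartedSpace F M]

/-- Since W is finite-dimensional, φ is a finite sum of the vectors φ(bᵢ) tensored with the dual
basis. -/
theorem contMDiffAt_clm_of_apply {W W' : Type*} [NormedAddCommGroup W] [NormedSpace ℝ W]
    [FiniteDimensional ℝ W] [NormedAddCommGroup W'] [NormedSpace ℝ W'] {φ : M → W →L[ℝ] W'} {x : M}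
    (h : ∀ w, ContMDiffAt 𝓘(ℝ, F) 𝓘(ℝ, W') ∞ (fun y => φ y w) x) :
    ContMDiffAt 𝓘(ℝ, F) 𝓘(ℝ, W →L[ℝ] W') ∞ φ x := by
  let b := Module.finBasis ℝ W
  have e : φ = fun y => ∑ i, ContinuousLinearMap.smulRightL ℝ W W'
      (LinearMap.toContinuousLinearMap (b.coord i)) (φ y (b i)) := by
    ext y w
    conv_lhs => rw [← b.sum_repr w]
    simp only [map_sum, map_smul]
    simp
  rw [e]
  refine contMDiffAt_finsetSum fun i _ => ?_
  exact (ContinuousLinearMap.contMDiff _).contMDiffAt.comp x (h (b i))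

theorem differential_congr {f g : M → ℝ} {x : M} (h : f =ᶠ[𝓝 x] g) (v : TangentSpace 𝓘(ℝ, F) x) :
    differential f x v = differential g x v :=
  congrArg (fun L : F →L[ℝ] ℝ => L v) (h.mfderiv_eq (I := 𝓘(ℝ, F)) (I' := 𝓘(ℝ, ℝ)))

theorem differential_const (c : ℝ) (x : M) (v : TangentSpace 𝓘(ℝ, F) x) :
    differential (fun _ : M => c) x v = 0 :=
  congrArg (fun L : F →L[ℝ] ℝ => L v) (mvfderiv_const (I := 𝓘(ℝ, F)) (M := M) c (x := x))

theorem differential_add {f g : M → ℝ} {x : M} (hf : MDifferentiableAt 𝓘(ℝ, F) 𝓘(ℝ, ℝ) f x)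
    (hg : MDifferentiableAt 𝓘(ℝ, F) 𝓘(ℝ, ℝ) g x) (v : TangentSpace 𝓘(ℝ, F) x) :
    differential (fun y => f y + g y) x v = differential f x v + differential g x v :=
  congrArg (fun L : F →L[ℝ] ℝ => L v) (mvfderiv_add (I := 𝓘(ℝ, F)) hf hg)

theorem differential_mul {f g : M → ℝ} {x : M} (hf : MDifferentiableAt 𝓘(ℝ, F) 𝓘(ℝ, ℝ) f x)
    (hg : MDifferentiableAt 𝓘(ℝ, F) 𝓘(ℝ, ℝ) g x) (v : TangentSpace 𝓘(ℝ, F) x) :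
    differential (fun y => f y * g y) x v = f x * differential g x v + g x * differential f x v :=
  congrArg (fun L : F →L[ℝ] ℝ => L v) (mvfderiv_mul (I := 𝓘(ℝ, F)) hf hg)

theorem differential_const_mul (c : ℝ) {g : M → ℝ} {x : M}
    (hg : MDifferentiableAt 𝓘(ℝ, F) 𝓘(ℝ, ℝ) g x) (v : TangentSpace 𝓘(ℝ, F) x) :
    differential (fun y => c * g y) x v = c * differential g x v := by
  rw [differential_mul mdifferentiableAt_const hg, differential_const, mul_zero, add_zero]

theorem differential_comp {E : Type*} [NormedAddCommGroup E] [NormedSpace ℝ E]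
    {N : Type*} [TopologicalSpace N] [ChartedSpace E N] {f : M → ℝ} {p : N → M} (a : N)
    (hf : MDifferentiableAt 𝓘(ℝ, F) 𝓘(ℝ, ℝ) f (p a))
    (hp : MDifferentiableAt 𝓘(ℝ, E) 𝓘(ℝ, F) p a) (v : TangentSpace 𝓘(ℝ, E) a) :
    differential (fun y => f (p y)) a v = differential f (p a) (mfderiv 𝓘(ℝ, E) 𝓘(ℝ, F) p a v) :=
  congrArg (fun L : E →L[ℝ] ℝ => L v) (mvfderiv_comp a hf hp)

/-- The second-derivative terms of f cancel by symmetry; the derivatives of the two fields are what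
remains. -/
theorem lieBracket_apply_differential {f : F → ℝ} {V W : F → F} {z : F} (hf : ContDiffAt ℝ ∞ f z)
    (hV : DifferentiableAt ℝ V z) (hW : DifferentiableAt ℝ W z) :
    fderiv ℝ f z (lieBracket ℝ V W z) =
      fderiv ℝ (fun y => fderiv ℝ f y (W y)) z (V z)
        - fderiv ℝ (fun y => fderiv ℝ f y (V y)) z (W z) := by
  have hd : DifferentiableAt ℝ (fderiv ℝ f) z :=
    (hf.fderiv_right (m := 1) (by norm_cast)).differentiableAt (by simp)
  have hs : IsSymmSndFDerivAt ℝ f z := hf.isSymmSndFDerivAt (by simpa using ENat.LEInfty.out (m := (2 : WithTop ℕ∞)))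
  rw [(hd.hasFDerivAt.clm_apply hW.hasFDerivAt).fderiv, (hd.hasFDerivAt.clm_apply hV.hasFDerivAt).fderiv]
  simp only [lieBracket, map_sub, add_apply, ContinuousLinearMap.comp_apply,
    ContinuousLinearMap.flip_apply]
  rw [hs (V z) (W z)]
  ring

end Calculus

/-! ### Smooth forms, exact forms and the bracket of vector fields on a manifold -/

section Manifold

variable {F : Type*} [NormedAddCommGroup F] [NormedSpace ℝ F]
  {M : Type*} [TopologicalSpace M] [ChartedSpace F M] [IsManifold 𝓘(ℝ, F) ∞ M]

theorem contMDiff_differential_apply {E : Type*} [NormedAddCommGroup E] [NormedSpace ℝ E]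
    {N : Type*} [TopologicalSpace N] [ChartedSpace E N] {f : M → ℝ}
    (hf : ContMDiff 𝓘(ℝ, F) 𝓘(ℝ, ℝ) ∞ f) {p : N → M}
    {V : (n : N) → TangentSpace 𝓘(ℝ, F) (p n)} {n : N}
    (hV : ContMDiffAt 𝓘(ℝ, E) 𝓘(ℝ, F).tangent ∞
      (fun n => (⟨p n, V n⟩ : TangentBundle 𝓘(ℝ, F) M)) n) :
    ContMDiffAt 𝓘(ℝ, E) 𝓘(ℝ, ℝ) ∞ (fun n => differential f (p n) (V n)) n := by
  have h := (hf.contMDiff_tangentMap (m := ∞) (by simp)).contMDiffAt.comp n hV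
  exact (contMDiff_snd_tangentBundle_modelSpace ℝ 𝓘(ℝ, ℝ)).contMDiffAt.comp n h

theorem contMDiff_oneForm_apply {E : Type*} [NormedAddCommGroup E] [NormedSpace ℝ E]
    {N : Type*} [TopologicalSpace N] [ChartedSpace E N] (α : OneForm F M) {p : N → M}
    {V : (n : N) → TangentSpace 𝓘(ℝ, F) (p n)} {n : N}
    (hV : ContMDiffAt 𝓘(ℝ, E) 𝓘(ℝ, F).tangent ∞
      (fun n => (⟨p n, V n⟩ : TangentBundle 𝓘(ℝ, F) M)) n) :
    ContMDiffAt 𝓘(ℝ, E) 𝓘(ℝ, ℝ) ∞ (fun n => α (p n) (V n)) n := by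
  have hp : ContMDiffAt 𝓘(ℝ, E) 𝓘(ℝ, F) ∞ p n := (Bundle.contMDiffAt_totalSpace.1 hV).1
  have hα : ContMDiffAt 𝓘(ℝ, E) (𝓘(ℝ, F).prod 𝓘(ℝ, F →L[ℝ] ℝ)) ∞
    (fun n => (⟨p n, α (p n)⟩ : Bundle.TotalSpace (F →L[ℝ] ℝ) (CotangentSpace F : M → Type _))) n :=
    α.contMDiff.contMDiffAt.comp n hp
  have := ContMDiffAt.clm_bundle_apply (E₂ := Bundle.Trivial M ℝ) (F₂ := ℝ) hα hV
  exact (Bundle.contMDiffAt_totalSpace.1 this).2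

theorem contMDiff_sharp_apply (π : BivectorField F M) (α : OneForm F M) :
    ContMDiff 𝓘(ℝ, F) 𝓘(ℝ, F).tangent ∞
      (fun y => (⟨y, π.sharp y (α y)⟩ : TangentBundle 𝓘(ℝ, F) M)) :=
  ContMDiff.clm_bundle_apply π.sharp.contMDiff α.contMDiff

variable [FiniteDimensional ℝ F]

/-- It is enough to test on the fields that are constant in one trivialization of the tangent
bundle: these pairings are the coordinates of θ in the induced trivialization of the cotangent
bundle. -/
theorem contMDiff_cotangent_of_apply {θ : (x : M) → CotangentSpace F x}
    (h : ∀ (x : M) (V : (y : M) → TangentSpace 𝓘(ℝ, F) y),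
      ContMDiffAt 𝓘(ℝ, F) 𝓘(ℝ, F).tangent ∞
        (fun y => (⟨y, V y⟩ : TangentBundle 𝓘(ℝ, F) M)) x →
      ContMDiffAt 𝓘(ℝ, F) 𝓘(ℝ, ℝ) ∞ (fun y => θ y (V y)) x) :
    ContMDiff 𝓘(ℝ, F) (𝓘(ℝ, F).prod 𝓘(ℝ, F →L[ℝ] ℝ)) ∞
      (fun y => (⟨y, θ y⟩ : Bundle.TotalSpace (F →L[ℝ] ℝ) (CotangentSpace F : M → Type _))) := by
  intro x
  refine (contMDiffAt_hom_bundle (E₂ := Bundle.Trivial M ℝ) _).2 ⟨contMDiffAt_id, ?_⟩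
  refine contMDiffAt_clm_of_apply fun w => ?_
  let t := trivializationAt F (TangentSpace 𝓘(ℝ, F) : M → Type _) x
  have hx : x ∈ t.baseSet := FiberBundle.mem_baseSet_trivializationAt _ _ x
  refine (h x (fun y => t.symm y w) ?_).congr_of_eventuallyEq ?_
  · rw [t.contMDiffAt_section_iff hx]
    refine (contMDiffAt_const (c := w)).congr_of_eventuallyEq ?_
    filter_upwards [t.open_baseSet.mem_nhds hx] with y hy
    rw [t.mk_symm hy, t.apply_symm_apply' hy]
  · filter_upwards [t.open_baseSet.mem_nhds hx] with y hy
    rw [ContinuousLinearMap.inCoordinates_eq hy (Set.mem_univ _)]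
    simp [t]

/-- The exterior derivative of a smooth function, as a one-form. -/
def exteriorDerivative (f : C^∞⟮𝓘(ℝ, F), M; 𝓘(ℝ, ℝ), ℝ⟯) : OneForm F M :=
  ⟨fun x => differential f x, contMDiff_cotangent_of_apply fun _ _ hV =>
    contMDiff_differential_apply f.contMDiff hV⟩

/-- Take v composed with the chart at x, cut off by a bump function; the chart has identity
derivative at its centre. With this, tensorial statements can be checked on exact forms and tangent
vectors can be separated by functions. -/
theorem exists_differential_eq [T2Space M] (x : M) (v : CotangentSpace F x) :
    ∃ f : C^∞⟮𝓘(ℝ, F), M; 𝓘(ℝ, ℝ), ℝ⟯, differential f x = v := by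
  let ψ : SmoothBumpFunction 𝓘(ℝ, F) x := Classical.arbitrary _
  let v' : F →L[ℝ] ℝ := v
  let f₀ : M → ℝ := fun y => v' (extChartAt 𝓘(ℝ, F) x y)
  have h₀ : ContMDiffOn 𝓘(ℝ, F) 𝓘(ℝ, ℝ) ∞ f₀ (chartAt F x).source :=
    (ContinuousLinearMap.contMDiff v').comp_contMDiffOn contMDiffOn_extChartAt
  refine ⟨⟨fun y => ψ y • f₀ y, ψ.contMDiff_smul h₀⟩, ?_⟩
  ext w
  have e : (fun y => ψ y • f₀ y) =ᶠ[𝓝 x] f₀ := by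
    filter_upwards [ψ.eventuallyEq_one] with y hy
    simp [hy]
  refine (differential_congr e w).trans ?_
  refine (differential_comp (F := F) (M := F) (f := v') x
    ((ContinuousLinearMap.contMDiff v' (n := 1)).mdifferentiable one_ne_zero _)
    (mdifferentiableAt_extChartAt (mem_chart_source F x)) w).trans ?_
  rw [mfderiv_extChartAt_self]
  exact congrArg (fun L : F →L[ℝ] ℝ => L w) (v'.mfderiv_eq (x := extChartAt 𝓘(ℝ, F) x x))

omit [IsManifold 𝓘(ℝ, F) ∞ M] [FiniteDimensional ℝ F] in
theorem differential_eq_fderiv {k : M → ℝ} {x : M}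
    (hk : MDifferentiableAt 𝓘(ℝ, F) 𝓘(ℝ, ℝ) k x) (u : F) :
    differential k x u =
      fderiv ℝ (fun z => k ((extChartAt 𝓘(ℝ, F) x).symm z)) (extChartAt 𝓘(ℝ, F) x x) u := by
  change (mfderiv 𝓘(ℝ, F) 𝓘(ℝ, ℝ) k x : F →L[ℝ] ℝ) u = _
  rw [hk.mfderiv]
  simp only [modelWithCornersSelf_coe, Set.range_id, fderivWithin_univ]
  rfl

/-- The manifold bracket is by definition the vector-space bracket of the fields read in the chart
at x, so `lieBracket_apply_differential` applies there. -/
theorem mlieBracket_apply_differential {f : M → ℝ} (hf : ContMDiff 𝓘(ℝ, F) 𝓘(ℝ, ℝ) ∞ f)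
    {V W : (x : M) → TangentSpace 𝓘(ℝ, F) x} {x : M}
    (hV : ContMDiffAt 𝓘(ℝ, F) 𝓘(ℝ, F).tangent ∞
      (fun y => (⟨y, V y⟩ : TangentBundle 𝓘(ℝ, F) M)) x)
    (hW : ContMDiffAt 𝓘(ℝ, F) 𝓘(ℝ, F).tangent ∞
      (fun y => (⟨y, W y⟩ : TangentBundle 𝓘(ℝ, F) M)) x) :
    differential f x (mlieBracket 𝓘(ℝ, F) V W x) =
      differential (fun y => differential f y (W y)) x (V x)
        - differential (fun y => differential f y (V y)) x (W x) := by
  have : CompleteSpace F := FiniteDimensional.complete ℝ F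
  have : IsManifold 𝓘(ℝ, F) 2 M := IsManifold.of_le (n := ∞) (by simpa using ENat.LEInfty.out (m := (2 : WithTop ℕ∞)))
  let φ := extChartAt 𝓘(ℝ, F) x
  let f' : F → ℝ := fun z => f (φ.symm z)
  have htarget : φ.target ∈ 𝓝 (φ x) := extChartAt_target_mem_nhds x
  have hsymm : ∀ z ∈ φ.target, ContMDiffAt 𝓘(ℝ, F) 𝓘(ℝ, F) ∞ φ.symm z := fun z hz =>
    (contMDiffOn_extChartAt_symm x).contMDiffAt (extChartAt_target_mem_nhds' hz)
  have hf' : ∀ z ∈ φ.target, ContDiffAt ℝ ∞ f' z := fun z hz =>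
    contMDiffAt_iff_contDiffAt.1 (hf.contMDiffAt.comp z (hsymm z hz))
  have hid : ∀ L : F →L[ℝ] F, L = ContinuousLinearMap.id ℝ F → ∀ w, L.inverse w = w := by
    rintro _ rfl w
    rw [ContinuousLinearMap.inverse_id]
    rfl
  -- U' is U read in the chart. It agrees with U at the centre, where the chart derivative is the
  -- identity, and near the centre it turns the function df(U) into the derivative of f' along U'.
  have key : ∀ U : (x : M) → TangentSpace 𝓘(ℝ, F) x,
      ContMDiffAt 𝓘(ℝ, F) 𝓘(ℝ, F).tangent ∞
        (fun y => (⟨y, U y⟩ : TangentBundle 𝓘(ℝ, F) M)) x → ∃ U' : F → F,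
      U' = mpullbackWithin 𝓘(ℝ, F) 𝓘(ℝ, F) φ.symm U (Set.range 𝓘(ℝ, F)) ∧
      DifferentiableAt ℝ U' (φ x) ∧ U' (φ x) = U x ∧
      ∀ u : F, differential (fun y => differential f y (U y)) x u =
        fderiv ℝ (fun z => fderiv ℝ f' z (U' z)) (φ x) u := by
    intro U hU
    refine ⟨_, rfl, ?_, ?_, fun u => ?_⟩
    · have := ((hU.mdifferentiableAt (by simp)).mdifferentiableWithinAt
        (s := Set.univ)).differentiableWithinAt_mpullbackWithin_vectorField
      rw [show (extChartAt 𝓘(ℝ, F) x).symm ⁻¹' Set.univ ∩ Set.range 𝓘(ℝ, F) = Set.univ by simp]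
        at this
      exact differentiableWithinAt_univ.1 this
    · have e₁ : (mfderivWithin 𝓘(ℝ, F) 𝓘(ℝ, F) φ.symm (Set.range 𝓘(ℝ, F)) (φ x) : F →L[ℝ] F) =
        ContinuousLinearMap.id ℝ F := mfderivWithin_range_extChartAt_symm
      have e₂ : (U (φ.symm (φ x)) : F) = U x :=
        congrArg (fun y => (U y : F)) (extChartAt_to_inv (I := 𝓘(ℝ, F)) x)
      exact (hid _ e₁ _).trans e₂
    · refine (differential_eq_fderiv ((contMDiff_differential_apply hf hU).mdifferentiableAt
        (by simp)) u).trans ?_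
      congr 1
      refine Filter.EventuallyEq.fderiv_eq ?_
      filter_upwards [htarget] with z hz
      let D : F →L[ℝ] F := mfderivWithin 𝓘(ℝ, F) 𝓘(ℝ, F) φ.symm (Set.range 𝓘(ℝ, F)) z
      have hD : D.IsInvertible := isInvertible_mfderivWithin_extChartAt_symm hz
      have hD' : D = mfderiv 𝓘(ℝ, F) 𝓘(ℝ, F) φ.symm z := by
        simp only [D, modelWithCornersSelf_coe, Set.range_id, mfderivWithin_univ]
        rfl
      have := differential_comp (F := F) (E := F) (f := f) (p := φ.symm) z
        (hf.mdifferentiable (by simp) _) ((hsymm z hz).mdifferentiableAt (by simp))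
        (D.inverse (U (φ.symm z)))
      have e₁ : D (D.inverse (U (φ.symm z))) = U (φ.symm z) := hD.self_apply_inverse _
      have e₂ : (mfderiv 𝓘(ℝ, F) 𝓘(ℝ, F) φ.symm z : F →L[ℝ] F) (D.inverse (U (φ.symm z))) =
        U (φ.symm z) := hD' ▸ e₁
      have e₃ : fderiv ℝ f' z (D.inverse (U (φ.symm z))) =
          differential (F := F) f' z (D.inverse (U (φ.symm z))) :=
        congrArg (fun L : F →L[ℝ] ℝ => L (D.inverse (U (φ.symm z)))) mfderiv_eq_fderiv.symm
      exact ((e₃.trans this).trans (congrArg (differential f (φ.symm z)) e₂)).symm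
  obtain ⟨V', hV', hVd, hVx, hVf⟩ := key V hV
  obtain ⟨W', hW', hWd, hWx, hWf⟩ := key W hW
  refine Eq.trans ?_ (congrArg₂ (· - ·) (hWf (V x)) (hVf (W x))).symm
  have h1 : (mlieBracket 𝓘(ℝ, F) V W x : F) = lieBracket ℝ V' W' (φ x) := by
    have e₁ : (mfderiv 𝓘(ℝ, F) 𝓘(ℝ, F) φ x : F →L[ℝ] F) = ContinuousLinearMap.id ℝ F :=
      mfderiv_extChartAt_self
    have e₂ : φ.symm ⁻¹' Set.univ ∩ Set.range 𝓘(ℝ, F) = Set.univ := by simp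
    refine (hid _ e₁ (lieBracketWithin ℝ
      (mpullbackWithin 𝓘(ℝ, F) 𝓘(ℝ, F) φ.symm V (Set.range 𝓘(ℝ, F)))
      (mpullbackWithin 𝓘(ℝ, F) 𝓘(ℝ, F) φ.symm W (Set.range 𝓘(ℝ, F)))
      (φ.symm ⁻¹' Set.univ ∩ Set.range 𝓘(ℝ, F)) (φ x))).trans ?_
    rw [e₂]
    subst hV' hW'
    exact congrFun lieBracketWithin_univ _
  have h2 : ∀ u : F, differential f x u = fderiv ℝ f' (φ x) u :=
    differential_eq_fderiv (hf.mdifferentiable (by simp) x)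
  have := lieBracket_apply_differential (hf' _ (mem_extChartAt_target x)) hVd hWd
  rw [hVx, hWx] at this
  exact (h2 _).trans ((congrArg (fderiv ℝ f' (φ x)) h1).trans this)

end Manifold

/-! ### Left-invariant derivations and the adjoint action -/

section LeftInvariant

variable {E : Type*} [NormedAddCommGroup E] [NormedSpace ℝ E]
  {G : Type*} [TopologicalSpace G] [ChartedSpace E G] [Group G]

/-- The derivative of a function along the left-invariant vector field of `u`. -/
def leftDeriv (u : GroupLieAlgebra 𝓘(ℝ, E) G) (f : G → ℝ) (g : G) : ℝ :=
  differential f g (mulInvariantVectorField u g)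

theorem mulInvariantVectorField_one (u : GroupLieAlgebra 𝓘(ℝ, E) G) :
    mulInvariantVectorField u 1 = u := by
  have e : (fun x : G => 1 * x) = id := funext one_mul
  have h : ∀ f : G → G, f = id → ∀ y, y = f 1 →
    (mfderiv 𝓘(ℝ, E) 𝓘(ℝ, E) f 1 : E →L[ℝ] E) = ContinuousLinearMap.id ℝ E := by
    rintro _ rfl _ _
    exact mfderiv_id
  exact congrArg (fun L : E →L[ℝ] E => L u) (h _ e _ rfl)

theorem leftDeriv_one (u : GroupLieAlgebra 𝓘(ℝ, E) G) (f : G → ℝ) :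
    leftDeriv u f 1 = differential f 1 u := by
  rw [leftDeriv, mulInvariantVectorField_one]

theorem leftDeriv_add_left (u v : GroupLieAlgebra 𝓘(ℝ, E) G) (f : G → ℝ) (g : G) :
    leftDeriv (u + v) f g = leftDeriv u f g + leftDeriv v f g := by
  rw [leftDeriv, mulInvariantVectorField_add]
  exact map_add _ _ _

theorem leftDeriv_smul_left (c : ℝ) (u : GroupLieAlgebra 𝓘(ℝ, E) G) (f : G → ℝ) (g : G) :
    leftDeriv (c • u) f g = c * leftDeriv u f g := by
  rw [leftDeriv, mulInvariantVectorField_smul]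
  exact map_smul _ _ _

theorem leftDeriv_const (u : GroupLieAlgebra 𝓘(ℝ, E) G) (c : ℝ) (g : G) :
    leftDeriv u (fun _ => c) g = 0 :=
  differential_const _ _ _

variable {f f' : G → ℝ}

theorem leftDeriv_add (hf : ContMDiff 𝓘(ℝ, E) 𝓘(ℝ, ℝ) ∞ f) (hf' : ContMDiff 𝓘(ℝ, E) 𝓘(ℝ, ℝ) ∞ f')
    (u : GroupLieAlgebra 𝓘(ℝ, E) G) (g : G) :
    leftDeriv u (fun x => f x + f' x) g = leftDeriv u f g + leftDeriv u f' g :=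
  differential_add (hf.mdifferentiable (by simp) g) (hf'.mdifferentiable (by simp) g) _

theorem leftDeriv_mul (hf : ContMDiff 𝓘(ℝ, E) 𝓘(ℝ, ℝ) ∞ f) (hf' : ContMDiff 𝓘(ℝ, E) 𝓘(ℝ, ℝ) ∞ f')
    (u : GroupLieAlgebra 𝓘(ℝ, E) G) (g : G) :
    leftDeriv u (fun x => f x * f' x) g = f g * leftDeriv u f' g + f' g * leftDeriv u f g :=
  differential_mul (hf.mdifferentiable (by simp) g) (hf'.mdifferentiable (by simp) g) _

theorem leftDeriv_const_mul (c : ℝ) (hf : ContMDiff 𝓘(ℝ, E) 𝓘(ℝ, ℝ) ∞ f)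
    (u : GroupLieAlgebra 𝓘(ℝ, E) G) (g : G) :
    leftDeriv u (fun x => c * f x) g = c * leftDeriv u f g :=
  differential_const_mul c (hf.mdifferentiable (by simp) g) _

theorem leftDeriv_sum {ι : Type*} (s : Finset ι) {f : ι → G → ℝ}
    (hf : ∀ i, ContMDiff 𝓘(ℝ, E) 𝓘(ℝ, ℝ) ∞ (f i)) (u : GroupLieAlgebra 𝓘(ℝ, E) G) (g : G) :
    leftDeriv u (fun x => ∑ i ∈ s, f i x) g = ∑ i ∈ s, leftDeriv u (f i) g := by
  classical
  induction s using Finset.induction_on with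
  | empty => simpa using leftDeriv_const u 0 g
  | insert a s ha ih =>
    simp only [Finset.sum_insert ha]
    rw [leftDeriv_add (hf a) (contMDiff_finsetSum fun i _ => hf i), ih]

variable [LieGroup 𝓘(ℝ, E) ∞ G]

/-- The field is g ↦ T(mul)(0_g, u), a composition of smooth maps between tangent bundles. -/
theorem contMDiff_infty_mulInvariantVectorField (u : GroupLieAlgebra 𝓘(ℝ, E) G) :
    ContMDiff 𝓘(ℝ, E) 𝓘(ℝ, E).tangent ∞
      (fun g => (⟨g, mulInvariantVectorField u g⟩ : TangentBundle 𝓘(ℝ, E) G)) := by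
  let fg : G → TangentBundle 𝓘(ℝ, E) G := fun g => ⟨g, 0⟩
  have sfg : ContMDiff 𝓘(ℝ, E) 𝓘(ℝ, E).tangent ∞ fg := Bundle.contMDiff_zeroSection _ _
  let fv : G → TangentBundle 𝓘(ℝ, E) G := fun _ => ⟨1, u⟩
  have sfv : ContMDiff 𝓘(ℝ, E) 𝓘(ℝ, E).tangent ∞ fv := contMDiff_const
  have S₂ : ContMDiff _ _ ∞ (equivTangentBundleProd 𝓘(ℝ, E) G 𝓘(ℝ, E) G).symm :=
    contMDiff_equivTangentBundleProd_symm
  have S₃ := (contMDiff_mul 𝓘(ℝ, E) ∞ (G := G)).contMDiff_tangentMap (m := ∞) (by simp)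
  refine ((S₃.comp S₂).comp (sfg.prodMk sfv)).congr fun g => ?_
  have h : ∀ w : E, (mfderiv (𝓘(ℝ, E).prod 𝓘(ℝ, E)) 𝓘(ℝ, E) (fun p : G × G => p.1 * p.2) (g, 1) :
      E × E →L[ℝ] E) (0, w) = (mfderiv 𝓘(ℝ, E) 𝓘(ℝ, E) (fun x => g * x) (1 : G) : E →L[ℝ] E) w := by
    intro w
    refine (mfderiv_prod_eq_add_apply (p := (g, (1 : G))) (v := ((0 : E), w))
      ((contMDiff_mul 𝓘(ℝ, E) ∞ (G := G)).mdifferentiable (by simp) (g, 1))).trans ?_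
    exact (congrArg₂ (· + ·) (map_zero (mfderiv 𝓘(ℝ, E) 𝓘(ℝ, E) (fun z : G => z * 1) g :
      E →L[ℝ] E)) rfl).trans (zero_add _)
  have hb : ∀ (y : G) (w w' : E), g = y → w = w' →
      (⟨g, w⟩ : TangentBundle 𝓘(ℝ, E) G) = ⟨y, w'⟩ := by
    rintro _ _ _ rfl rfl; rfl
  exact hb _ _ _ (mul_one g).symm (h u).symm

theorem contMDiff_leftDeriv (hf : ContMDiff 𝓘(ℝ, E) 𝓘(ℝ, ℝ) ∞ f)
    (u : GroupLieAlgebra 𝓘(ℝ, E) G) : ContMDiff 𝓘(ℝ, E) 𝓘(ℝ, ℝ) ∞ (leftDeriv u f) := fun g =>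
  contMDiff_differential_apply hf (contMDiff_infty_mulInvariantVectorField u g)

theorem mfderiv_mul_left_mulInvariantVectorField (a g : G) (u : GroupLieAlgebra 𝓘(ℝ, E) G) :
    (mfderiv 𝓘(ℝ, E) 𝓘(ℝ, E) (fun x => a * x) g (mulInvariantVectorField u g) : E) =
      mulInvariantVectorField u (a * g) := by
  have hL : ∀ (b c : G), MDifferentiableAt 𝓘(ℝ, E) 𝓘(ℝ, E) (fun x => b * x) c := fun b c =>
    (contMDiff_mul_left (I := 𝓘(ℝ, E)) (n := ∞)).mdifferentiable (by simp) c
  have h := mfderiv_comp (I := 𝓘(ℝ, E)) (I' := 𝓘(ℝ, E)) (I'' := 𝓘(ℝ, E)) (1 : G)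
    (hL a (g * 1)) (hL g 1)
  have e : (fun x => a * x) ∘ (fun x => g * x) = fun x => a * g * x := by
    ext x
    simp [mul_assoc]
  rw [e] at h
  -- The points g and g * 1 are only propositionally equal, and they occur in the types of the
  -- derivatives. Quantifying over y lets the equality be substituted; the same device recurs below.
  have h' : ∀ y, y = g * 1 → (mfderiv 𝓘(ℝ, E) 𝓘(ℝ, E) (fun x => a * x) y : E →L[ℝ] E) =
    (mfderiv 𝓘(ℝ, E) 𝓘(ℝ, E) (fun x => a * x) (g * 1) : E →L[ℝ] E) := by
    rintro _ rfl; rfl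
  refine (congrArg (fun L : E →L[ℝ] E => L (mulInvariantVectorField u g)) (h' g (by simp))).trans ?_
  exact (congrArg (fun L : E →L[ℝ] E => L u) h).symm

theorem leftDeriv_comp_mul_left (hf : ContMDiff 𝓘(ℝ, E) 𝓘(ℝ, ℝ) ∞ f) (a : G)
    (u : GroupLieAlgebra 𝓘(ℝ, E) G) (g : G) :
    leftDeriv u (fun x => f (a * x)) g = leftDeriv u f (a * g) := by
  refine (differential_comp (E := E) (F := E) (p := fun x => a * x) g
    (hf.mdifferentiable (by simp) _)
    ((contMDiff_mul_left (I := 𝓘(ℝ, E)) (n := ∞)).mdifferentiable (by simp) g) _).trans ?_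
  exact congrArg (differential f (a * g) : E →L[ℝ] ℝ) (mfderiv_mul_left_mulInvariantVectorField a g u)

theorem contMDiff_conj (h : G) : ContMDiff 𝓘(ℝ, E) 𝓘(ℝ, E) ∞ (fun x : G => h * x * h⁻¹) :=
  (contMDiff_mul_right (I := 𝓘(ℝ, E)) (n := ∞) (a := h⁻¹)).comp
    (contMDiff_mul_left (I := 𝓘(ℝ, E)) (n := ∞) (a := h))

theorem differential_one_comp_conj (hf : ContMDiff 𝓘(ℝ, E) 𝓘(ℝ, ℝ) ∞ f) (h : G)
    (u : GroupLieAlgebra 𝓘(ℝ, E) G) :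
    leftDeriv u (fun x => f (h * x * h⁻¹)) 1 = leftDeriv (Ad E h u) f 1 := by
  rw [leftDeriv_one, leftDeriv_one]
  refine (differential_comp (E := E) (F := E) (p := fun x => h * x * h⁻¹) 1
    (hf.mdifferentiable (by simp) _) ((contMDiff_conj h).mdifferentiable (by simp) 1) _).trans ?_
  have : ∀ y : G, y = 1 → (differential f y : E →L[ℝ] ℝ) = (differential f 1 : E →L[ℝ] ℝ) := by
    rintro _ rfl; rfl
  exact congrArg (fun L : E →L[ℝ] ℝ => L (Ad E h u)) (this (h * 1 * h⁻¹) (by simp))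

theorem leftDeriv_eq_one (hf : ContMDiff 𝓘(ℝ, E) 𝓘(ℝ, ℝ) ∞ f) (u : GroupLieAlgebra 𝓘(ℝ, E) G)
    (g : G) : leftDeriv u f g = leftDeriv u (fun x => f (g * x)) 1 := by
  rw [leftDeriv_comp_mul_left hf, mul_one]

theorem contMDiff_comp_mul_left (hf : ContMDiff 𝓘(ℝ, E) 𝓘(ℝ, ℝ) ∞ f) (a : G) :
    ContMDiff 𝓘(ℝ, E) 𝓘(ℝ, ℝ) ∞ (fun x => f (a * x)) :=
  hf.comp (contMDiff_mul_left (I := 𝓘(ℝ, E)) (n := ∞) (a := a))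

theorem contMDiff_comp_mul_right (hf : ContMDiff 𝓘(ℝ, E) 𝓘(ℝ, ℝ) ∞ f) (a : G) :
    ContMDiff 𝓘(ℝ, E) 𝓘(ℝ, ℝ) ∞ (fun x => f (x * a)) :=
  hf.comp (contMDiff_mul_right (I := 𝓘(ℝ, E)) (n := ∞) (a := a))

/-- Right translation by h carries the left-invariant field of Ad_h u to that of u, because (g ·
hxh⁻¹) · h = gh · x. -/
theorem leftDeriv_comp_mul_right (hf : ContMDiff 𝓘(ℝ, E) 𝓘(ℝ, ℝ) ∞ f) (h : G)
    (u : GroupLieAlgebra 𝓘(ℝ, E) G) (g : G) :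
    leftDeriv (Ad E h u) (fun x => f (x * h)) g = leftDeriv u f (g * h) := by
  rw [leftDeriv_eq_one (contMDiff_comp_mul_right hf h), leftDeriv_eq_one hf,
    ← differential_one_comp_conj (contMDiff_comp_mul_left (contMDiff_comp_mul_right hf h) g)]
  congr 1
  ext x
  congr 1
  group

theorem leftDeriv_commutator [FiniteDimensional ℝ E] (hf : ContMDiff 𝓘(ℝ, E) 𝓘(ℝ, ℝ) ∞ f)
    (u v : GroupLieAlgebra 𝓘(ℝ, E) G) (g : G) :
    leftDeriv ⁅u, v⁆ f g = leftDeriv u (leftDeriv v f) g - leftDeriv v (leftDeriv u f) g := by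
  have : CompleteSpace E := FiniteDimensional.complete ℝ E
  rw [leftDeriv, GroupLieAlgebra.bracket_def, mulInvariantVector_mlieBracket]
  exact mlieBracket_apply_differential hf (contMDiff_infty_mulInvariantVectorField u g)
    (contMDiff_infty_mulInvariantVectorField v g)

theorem eq_of_leftDeriv_eq [FiniteDimensional ℝ E] [T2Space G] {u v : GroupLieAlgebra 𝓘(ℝ, E) G}
    (h : ∀ f : G → ℝ, ContMDiff 𝓘(ℝ, E) 𝓘(ℝ, ℝ) ∞ f → leftDeriv u f 1 = leftDeriv v f 1) :
    u = v := by
  let u' : E := u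
  let v' : E := v
  have : ∀ L : E →L[ℝ] ℝ, L u' = L v' := by
    intro L
    obtain ⟨f, hf⟩ := exists_differential_eq (F := E) (1 : G) L
    have := h f f.contMDiff
    rwa [leftDeriv_one, leftDeriv_one, hf] at this
  by_contra hne
  obtain ⟨L, hL⟩ := SeparatingDual.exists_separating_of_ne (R := ℝ) (x := u') (y := v') hne
  exact hL (this L)

/-- Tangent vectors at 1 are determined by their action on functions. There the bracket is a
commutator of derivations, and right translation by h intertwines the derivation along w with the
one along Ad_h w. -/
theorem Ad_lie [FiniteDimensional ℝ E] [T2Space G] (h : G) (u v : GroupLieAlgebra 𝓘(ℝ, E) G) :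
    Ad E h ⁅u, v⁆ = ⁅Ad E h u, Ad E h v⁆ := by
  refine eq_of_leftDeriv_eq fun f hf => ?_
  have hf' := contMDiff_comp_mul_right hf h⁻¹
  have key : ∀ (w : GroupLieAlgebra 𝓘(ℝ, E) G) {k : G → ℝ}, ContMDiff 𝓘(ℝ, E) 𝓘(ℝ, ℝ) ∞ k →
      leftDeriv (Ad E h w) k = fun g => leftDeriv w (fun x => k (x * h⁻¹)) (g * h) := by
    intro w k hk
    ext g
    rw [← leftDeriv_comp_mul_right (contMDiff_comp_mul_right hk h⁻¹)]
    simp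
  have key2 : ∀ (w : GroupLieAlgebra 𝓘(ℝ, E) G) {k : G → ℝ}, ContMDiff 𝓘(ℝ, E) 𝓘(ℝ, ℝ) ∞ k →
      leftDeriv w (fun x => k (x * h⁻¹)) = fun g => leftDeriv (Ad E h w) k (g * h⁻¹) := by
    intro w k hk
    rw [key w hk]
    simp
  rw [key _ hf]
  dsimp only
  rw [leftDeriv_commutator hf', leftDeriv_commutator hf, key2 u hf, key2 v hf,
    key2 u (contMDiff_leftDeriv hf _), key2 v (contMDiff_leftDeriv hf _)]
  simp

end LeftInvariant

/-! ### Local sections and fibres of submersions -/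

section Submersion

variable {E : Type*} [NormedAddCommGroup E] [NormedSpace ℝ E]
  {N : Type*} [TopologicalSpace N] [ChartedSpace E N]
  {F : Type*} [NormedAddCommGroup F] [NormedSpace ℝ F]
  {M : Type*} [TopologicalSpace M] [ChartedSpace F M]

/-- A submersion has smooth local sections through every point. -/
theorem exists_localSection {p : N → M}
    (hp : Manifold.IsSubmersion 𝓘(ℝ, E) 𝓘(ℝ, F) ∞ p) (g : N) :
    ∃ s : M → N, ContMDiffAt 𝓘(ℝ, F) 𝓘(ℝ, E) ∞ s (p g) ∧ s (p g) = g ∧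
      ∀ᶠ y in 𝓝 (p g), p (s y) = y := by
  obtain ⟨C, _, _, hC⟩ := hp
  obtain ⟨φ, ψ, hφg, hψg, hφ, hψ, hsub, e, he⟩ := hC g
  have he' : ∀ z ∈ φ.target, ψ (p (φ.symm z)) = (e z).1 := fun z hz => he (by simpa using hz)
  -- In charts where p is a linear projection, the base coordinate varies and the fibre coordinate
  -- is frozen at that of g.
  let z : M → E := fun y => e.symm (ψ y, (e (φ g)).2)
  have hψc : ContMDiffAt 𝓘(ℝ, F) 𝓘(ℝ, F) ∞ ψ (p g) :=
    contMDiffAt_of_mem_maximalAtlas hψ hψg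
  have hzg : z (p g) = φ g := by
    have := he' (φ g) (φ.map_source hφg)
    rw [φ.left_inv hφg] at this
    simp only [z, this]
    exact e.symm_apply_apply _
  have hz : ContMDiffAt 𝓘(ℝ, F) 𝓘(ℝ, E) ∞ z (p g) := by
    have h : ContDiff ℝ ∞ (fun w : F => e.symm (w, (e (φ g)).2)) := by fun_prop
    exact h.contMDiff.contMDiffAt.comp _ hψc
  have hzt : ∀ᶠ y in 𝓝 (p g), z y ∈ φ.target :=
    hz.continuousAt.eventually_mem (φ.open_target.mem_nhds (hzg ▸ φ.map_source hφg))
  refine ⟨fun y => φ.symm (z y), ?_, ?_, ?_⟩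
  · refine ContMDiffAt.comp (I' := 𝓘(ℝ, E)) (g := φ.symm) _ ?_ hz
    exact contMDiffAt_symm_of_mem_maximalAtlas hφ (hzg ▸ φ.map_source hφg)
  · simp only [hzg, φ.left_inv hφg]
  · filter_upwards [hzt, ψ.open_source.mem_nhds hψg] with y hy hy'
    refine ψ.injOn (hsub (φ.map_target hy)) hy' ?_
    rw [he' _ hy]
    simp [z]

/-- Differentiating p ∘ s = id for a local section s through g gives a right inverse. -/
theorem mfderiv_surjective_of_isSubmersion {p : N → M}
    (hp : Manifold.IsSubmersion 𝓘(ℝ, E) 𝓘(ℝ, F) ∞ p) (g : N) :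
    Function.Surjective (mfderiv 𝓘(ℝ, E) 𝓘(ℝ, F) p g) := by
  obtain ⟨s, hs, hsg, hps⟩ := exists_localSection hp g
  intro v
  have h1 := mfderiv_comp (I := 𝓘(ℝ, F)) (I' := 𝓘(ℝ, E)) (I'' := 𝓘(ℝ, F)) (p g)
    (hp.contMDiff.mdifferentiable (by simp) (s (p g))) (hs.mdifferentiableAt (by simp))
  have h2 : (mfderiv 𝓘(ℝ, F) 𝓘(ℝ, F) (p ∘ s) (p g) : F →L[ℝ] F) = ContinuousLinearMap.id ℝ F :=
    (Filter.EventuallyEq.mfderiv_eq (f₁ := id) (Filter.EventuallyEq.symm hps)).symm.trans mfderiv_id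
  have h3 : ∀ y, y = g → ∀ w : E, (mfderiv 𝓘(ℝ, E) 𝓘(ℝ, F) p y : E →L[ℝ] F) w =
      (mfderiv 𝓘(ℝ, E) 𝓘(ℝ, F) p g : E →L[ℝ] F) w := by rintro _ rfl _; rfl
  refine ⟨(mfderiv 𝓘(ℝ, F) 𝓘(ℝ, E) s (p g) : F →L[ℝ] E) v, ?_⟩
  refine (h3 _ hsg _).symm.trans ?_
  have := congrArg (fun L : F →L[ℝ] F => L v) (h1.symm.trans h2)
  exact this

/-- A map out of the target of a surjective submersion is smooth if its composition with the
submersion is. -/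
theorem contMDiff_of_comp_isSubmersion {W : Type*} [NormedAddCommGroup W] [NormedSpace ℝ W]
    {P : Type*} [TopologicalSpace P] [ChartedSpace W P] {p : N → M} {q : M → P}
    (hp : Manifold.IsSubmersion 𝓘(ℝ, E) 𝓘(ℝ, F) ∞ p) (hs : Function.Surjective p)
    (hq : ContMDiff 𝓘(ℝ, E) 𝓘(ℝ, W) ∞ (fun g => q (p g))) : ContMDiff 𝓘(ℝ, F) 𝓘(ℝ, W) ∞ q := by
  intro x
  obtain ⟨g, rfl⟩ := hs x
  obtain ⟨s, hs, -, hps⟩ := exists_localSection hp g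
  refine (hq.contMDiffAt.comp (p g) hs).congr_of_eventuallyEq ?_
  filter_upwards [hps] with y hy
  simp [hy]

/-- A tangent vector to the fibre of a submersion is the velocity of a curve in that fibre. -/
theorem exists_curve_of_mfderiv_eq_zero {p : N → M}
    (hp : Manifold.IsSubmersion 𝓘(ℝ, E) 𝓘(ℝ, F) ∞ p) (g : N) (w : E)
    (hw : (mfderiv 𝓘(ℝ, E) 𝓘(ℝ, F) p g : E →L[ℝ] F) w = 0) :
    ∃ γ : ℝ → N, ContMDiffAt 𝓘(ℝ, ℝ) 𝓘(ℝ, E) ∞ γ 0 ∧ γ 0 = g ∧ (∀ t, p (γ t) = p g) ∧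
      (mfderiv 𝓘(ℝ, ℝ) 𝓘(ℝ, E) γ 0 (1 : ℝ) : E) = w := by
  have hpd := hp.contMDiff.mdifferentiable (by simp) g
  obtain ⟨C, _, _, hC⟩ := hp
  obtain ⟨φ, ψ, hφg, hψg, hφ, hψ, hsub, e, he⟩ := hC g
  have he' : ∀ z ∈ φ.target, ψ (p (φ.symm z)) = (e z).1 := fun z hz => he (by simpa using hz)
  have hφd : MDifferentiableAt 𝓘(ℝ, E) 𝓘(ℝ, E) φ g :=
    (contMDiffAt_of_mem_maximalAtlas hφ hφg).mdifferentiableAt (by simp)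
  have hψd : MDifferentiableAt 𝓘(ℝ, F) 𝓘(ℝ, F) ψ (p g) :=
    (contMDiffAt_of_mem_maximalAtlas hψ hψg).mdifferentiableAt (by simp)
  have hφs : ContMDiffAt 𝓘(ℝ, E) 𝓘(ℝ, E) ∞ φ.symm (φ g) :=
    contMDiffAt_symm_of_mem_maximalAtlas hφ (φ.map_source hφg)
  let w' : E := (mfderiv 𝓘(ℝ, E) 𝓘(ℝ, E) φ g : E →L[ℝ] E) w
  have hw' : (e w').1 = 0 := by
    let q : E →L[ℝ] F := (ContinuousLinearMap.fst ℝ F C).comp (e : E →L[ℝ] F × C)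
    have h1 := mfderiv_comp (I := 𝓘(ℝ, E)) (I' := 𝓘(ℝ, F)) (I'' := 𝓘(ℝ, F)) g hψd hpd
    have h2 := mfderiv_comp (I := 𝓘(ℝ, E)) (I' := 𝓘(ℝ, E)) (I'' := 𝓘(ℝ, F)) g
      (q.mdifferentiableAt (x := φ g)) hφd
    have h3 : (ψ ∘ p) =ᶠ[𝓝 g] (q ∘ φ) := by
      filter_upwards [φ.open_source.mem_nhds hφg] with x hx
      have := he' (φ x) (φ.map_source hx)
      rwa [φ.left_inv hx] at this
    have h4 : (mfderiv 𝓘(ℝ, E) 𝓘(ℝ, F) (q ∘ φ) g : E →L[ℝ] F) w = q w' := by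
      refine (congrArg (fun L : E →L[ℝ] F => L w) h2).trans ?_
      exact congrArg (fun L : E →L[ℝ] F => L w') (q.mfderiv_eq (x := φ g))
    have h5 : (mfderiv 𝓘(ℝ, E) 𝓘(ℝ, F) (ψ ∘ p) g : E →L[ℝ] F) w = 0 := by
      refine (congrArg (fun L : E →L[ℝ] F => L w) h1).trans ?_
      exact (congrArg (mfderiv 𝓘(ℝ, F) 𝓘(ℝ, F) ψ (p g) : F →L[ℝ] F) hw).trans (map_zero _)
    exact h4.symm.trans ((congrArg (fun L : E →L[ℝ] F => L w) h3.mfderiv_eq).symm.trans h5)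
  have hw'' : (mfderiv 𝓘(ℝ, E) 𝓘(ℝ, E) φ.symm (φ g) : E →L[ℝ] E) w' = w := by
    have h1 := mfderiv_comp (I := 𝓘(ℝ, E)) (I' := 𝓘(ℝ, E)) (I'' := 𝓘(ℝ, E)) g
      (hφs.mdifferentiableAt (by simp)) hφd
    have h2 : (φ.symm ∘ φ) =ᶠ[𝓝 g] id := by
      filter_upwards [φ.open_source.mem_nhds hφg] with x hx
      exact φ.left_inv hx
    have h3 : (mfderiv 𝓘(ℝ, E) 𝓘(ℝ, E) (φ.symm ∘ φ) g : E →L[ℝ] E) =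
      ContinuousLinearMap.id ℝ E := h2.mfderiv_eq.trans mfderiv_id
    exact congrArg (fun L : E →L[ℝ] E => L w) (h1.symm.trans h3)
  -- A straight line in the chart; it stays in the fibre because w' has no base component.
  let c : ℝ → E := fun t => φ g + t • w'
  have hc : ContDiff ℝ ∞ c := by fun_prop
  have hc0 : c 0 = φ g := by simp [c]
  classical
  -- The curve has to lie in the fibre for all t, so it is set equal to g wherever the line leaves
  -- the chart; near 0 nothing changes.
  have hev : (fun t => if c t ∈ φ.target then φ.symm (c t) else g) =ᶠ[𝓝 0] fun t => φ.symm (c t) := by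
    have := hc.continuous.continuousAt.eventually_mem
      (φ.open_target.mem_nhds (hc0 ▸ φ.map_source hφg : c 0 ∈ φ.target))
    filter_upwards [this] with t ht
    simp [ht]
  have hφs' : ContMDiffAt 𝓘(ℝ, E) 𝓘(ℝ, E) ∞ φ.symm (c 0) := by rwa [hc0]
  refine ⟨fun t => if c t ∈ φ.target then φ.symm (c t) else g, ?_, ?_, ?_, ?_⟩
  · exact (ContMDiffAt.comp (I' := 𝓘(ℝ, E)) (0 : ℝ) hφs' hc.contMDiff.contMDiffAt).congr_of_eventuallyEq
      hev
  · simp [hc0, hφg, φ.left_inv hφg]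
  · intro t
    dsimp only
    split_ifs with ht
    · refine ψ.injOn (hsub (φ.map_target ht)) hψg ?_
      have h1 := he' (φ g) (φ.map_source hφg)
      rw [φ.left_inv hφg] at h1
      rw [he' _ ht, h1]
      simp [c, hw']
    · rfl
  · have h1 := mfderiv_comp (I := 𝓘(ℝ, ℝ)) (I' := 𝓘(ℝ, E)) (I'' := 𝓘(ℝ, E)) (0 : ℝ)
      (hφs'.mdifferentiableAt (by simp)) (hc.contMDiff.mdifferentiable (by simp) 0)
    have h2 : (mfderiv 𝓘(ℝ, ℝ) 𝓘(ℝ, E) c 0 (1 : ℝ) : E) = w' := by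
      have hd : HasDerivAt c w' 0 := by
        have := ((hasDerivAt_id (0 : ℝ)).smul_const w').const_add (φ g)
        rwa [one_smul] at this
      rw [mfderiv_eq_fderiv]
      exact (congrArg (fun L : ℝ →L[ℝ] E => L 1) hd.hasFDerivAt.fderiv).trans (by simp)
    have h3 : ∀ y, y = φ g → ∀ w : E, (mfderiv 𝓘(ℝ, E) 𝓘(ℝ, E) φ.symm y : E →L[ℝ] E) w =
      (mfderiv 𝓘(ℝ, E) 𝓘(ℝ, E) φ.symm (φ g) : E →L[ℝ] E) w := by rintro _ rfl _; rfl
    refine (congrArg (fun L : ℝ →L[ℝ] E => L 1) (hev.mfderiv_eq.trans h1)).trans ?_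
    refine (h3 (c 0) hc0 _).trans ?_
    exact (congrArg (mfderiv 𝓘(ℝ, E) 𝓘(ℝ, E) φ.symm (φ g) : E →L[ℝ] E) h2).trans hw''

end Submersion

/-! ### The homogeneous space G/H and its frames coming from left-invariant fields -/

section HomogeneousSpace

variable {E : Type*} [NormedAddCommGroup E] [NormedSpace ℝ E]
  {G : Type*} [TopologicalSpace G] [ChartedSpace E G] [Group G] {H : Subgroup G}
  {F : Type*} [NormedAddCommGroup F] [NormedSpace ℝ F] [ChartedSpace F (G ⧸ H)]

/-- The projection is an open quotient map, and its equivalence relation is the preimage of the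
closed set H under (a, b) ↦ a⁻¹b. -/
theorem t2Space_quotient [IsTopologicalGroup G] (hH : IsClosed (H : Set G)) : T2Space (G ⧸ H) := by
  rw [t2Space_iff_of_isOpenQuotientMap (QuotientGroup.isOpenQuotientMap_mk (N := H))]
  have : {q : G × G | (q.1 : G ⧸ H) = q.2} = (fun q : G × G => q.1⁻¹ * q.2) ⁻¹' H := by
    ext q
    simp [QuotientGroup.eq]
  rw [this]
  exact hH.preimage (by fun_prop)

variable (F H) in
/-- The image in `T_{gH}(G/H)` of the left-invariant vector field of `u` at `g`. -/
def projDeriv (g : G) : GroupLieAlgebra 𝓘(ℝ, E) G →ₗ[ℝ] F where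
  toFun u := (mfderiv 𝓘(ℝ, E) 𝓘(ℝ, F) (QuotientGroup.mk : G → G ⧸ H) g : E →L[ℝ] F)
    (mulInvariantVectorField u g)
  map_add' u v := by
    rw [mulInvariantVectorField_add]
    exact map_add (mfderiv 𝓘(ℝ, E) 𝓘(ℝ, F) (QuotientGroup.mk : G → G ⧸ H) g : E →L[ℝ] F) _ _
  map_smul' c u := by
    rw [mulInvariantVectorField_smul]
    exact map_smul (mfderiv 𝓘(ℝ, E) 𝓘(ℝ, F) (QuotientGroup.mk : G → G ⧸ H) g : E →L[ℝ] F) _ _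

variable (hp : Manifold.IsSubmersion 𝓘(ℝ, E) 𝓘(ℝ, F) ∞ (QuotientGroup.mk : G → G ⧸ H))

include hp

theorem projDeriv_eq_zero_of_isVelocityIn {u : GroupLieAlgebra 𝓘(ℝ, E) G} (hu : IsVelocityIn H u) :
    projDeriv H F 1 u = 0 := by
  obtain ⟨γ, hγ, hγ0, hγH, rfl⟩ := hu
  refine (congrArg (mfderiv 𝓘(ℝ, E) 𝓘(ℝ, F) (QuotientGroup.mk : G → G ⧸ H) 1 : E →L[ℝ] F)
    (mulInvariantVectorField_one _)).trans ?_
  have h1 := mfderiv_comp (I := 𝓘(ℝ, ℝ)) (I' := 𝓘(ℝ, E)) (I'' := 𝓘(ℝ, F)) (0 : ℝ)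
    (hp.contMDiff.mdifferentiable (by simp) (γ 0)) (hγ.mdifferentiableAt (by simp))
  have h2 : (QuotientGroup.mk : G → G ⧸ H) ∘ γ = fun _ => ((1 : G) : G ⧸ H) := by
    ext t
    simpa [QuotientGroup.eq] using hγH t
  have h3 : (mfderiv 𝓘(ℝ, ℝ) 𝓘(ℝ, F) ((QuotientGroup.mk : G → G ⧸ H) ∘ γ) 0 : ℝ →L[ℝ] F) = 0 := by
    rw [h2]
    exact mfderiv_const
  have h4 : ∀ y, y = (1 : G) → ∀ w : E,
      (mfderiv 𝓘(ℝ, E) 𝓘(ℝ, F) (QuotientGroup.mk : G → G ⧸ H) y : E →L[ℝ] F) w =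
        (mfderiv 𝓘(ℝ, E) 𝓘(ℝ, F) (QuotientGroup.mk : G → G ⧸ H) 1 : E →L[ℝ] F) w := by
    rintro _ rfl _; rfl
  refine (h4 _ hγ0 _).symm.trans ?_
  exact congrArg (fun L : ℝ →L[ℝ] F => L 1) (h1.symm.trans h3)

theorem differential_projDeriv {f : G ⧸ H → ℝ} (hf : ContMDiff 𝓘(ℝ, F) 𝓘(ℝ, ℝ) ∞ f) (g : G)
    (u : GroupLieAlgebra 𝓘(ℝ, E) G) :
    differential f (g : G ⧸ H) (projDeriv H F g u) = leftDeriv u (fun x => f x) g :=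
  (differential_comp (E := E) (F := F) (p := (QuotientGroup.mk : G → G ⧸ H)) g
    (hf.mdifferentiable (by simp) _) (hp.contMDiff.mdifferentiable (by simp) g) _).symm

variable [LieGroup 𝓘(ℝ, E) ∞ G]

theorem contMDiff_translation (a : G) :
    ContMDiff 𝓘(ℝ, F) 𝓘(ℝ, F) ∞ (fun x : G ⧸ H => a • x) :=
  contMDiff_of_comp_isSubmersion hp QuotientGroup.mk_surjective
    (hp.contMDiff.comp (contMDiff_mul_left (I := 𝓘(ℝ, E)) (n := ∞) (a := a)))

theorem translationDeriv_projDeriv (a g : G) (u : GroupLieAlgebra 𝓘(ℝ, E) G) :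
    (translationDeriv F a (g : G ⧸ H) : F →L[ℝ] F) (projDeriv H F g u) =
      projDeriv H F (a * g) u := by
  have h1 := mfderiv_comp (I := 𝓘(ℝ, E)) (I' := 𝓘(ℝ, F)) (I'' := 𝓘(ℝ, F)) g
    ((contMDiff_translation hp a).mdifferentiable (by simp) (g : G ⧸ H))
    (hp.contMDiff.mdifferentiable (by simp) g)
  have h2 := mfderiv_comp (I := 𝓘(ℝ, E)) (I' := 𝓘(ℝ, E)) (I'' := 𝓘(ℝ, F)) g
    (hp.contMDiff.mdifferentiable (by simp) (a * g))
    ((contMDiff_mul_left (I := 𝓘(ℝ, E)) (n := ∞) (a := a)).mdifferentiable (by simp) g)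
  refine (congrArg (fun L : E →L[ℝ] F => L (mulInvariantVectorField u g)) (h1.symm.trans h2)).trans ?_
  exact congrArg (mfderiv 𝓘(ℝ, E) 𝓘(ℝ, F) (QuotientGroup.mk : G → G ⧸ H) (a * g) : E →L[ℝ] F)
    (mfderiv_mul_left_mulInvariantVectorField a g u)

/-- Left translation reduces to g = 1. A vector killed by Tp there is the velocity of a curve in the
fibre over ē, and that fibre is H. -/
theorem projDeriv_eq_zero_iff (g : G) (u : GroupLieAlgebra 𝓘(ℝ, E) G) :
    projDeriv H F g u = 0 ↔ u ∈ subgroupLieAlgebra E H := by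
  have h1 : projDeriv H F g u = 0 ↔ projDeriv H F 1 u = 0 := by
    constructor
    · intro h
      have := translationDeriv_projDeriv hp g⁻¹ g u
      rw [h, inv_mul_cancel] at this
      exact this.symm.trans (map_zero (translationDeriv F g⁻¹ (g : G ⧸ H) : F →L[ℝ] F))
    · intro h
      have := translationDeriv_projDeriv hp g 1 u
      rw [h, mul_one] at this
      exact this.symm.trans (map_zero (translationDeriv F g ((1 : G) : G ⧸ H) : F →L[ℝ] F))
  rw [h1]
  refine ⟨fun h => ?_, projDeriv_eq_zero_of_isVelocityIn hp⟩
  have h' : (mfderiv 𝓘(ℝ, E) 𝓘(ℝ, F) (QuotientGroup.mk : G → G ⧸ H) 1 : E →L[ℝ] F) u = 0 := by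
    refine Eq.trans ?_ h
    exact congrArg (mfderiv 𝓘(ℝ, E) 𝓘(ℝ, F) (QuotientGroup.mk : G → G ⧸ H) 1 : E →L[ℝ] F)
      (mulInvariantVectorField_one u).symm
  obtain ⟨γ, hγ, hγ0, hγH, hγu⟩ := exists_curve_of_mfderiv_eq_zero hp 1 u h'
  refine ⟨γ, hγ, hγ0, fun t => ?_, hγu⟩
  simpa [QuotientGroup.eq] using (hγH t).symm

variable [FiniteDimensional ℝ E]

/-- Left translation by g has injective derivative, since translation by g⁻¹ undoes it. In finite
dimension it is therefore onto, and Tp is onto as well. -/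
theorem projDeriv_surjective (g : G) : Function.Surjective (projDeriv H F g (E := E)) := by
  let m' : E →L[ℝ] E := mfderiv 𝓘(ℝ, E) 𝓘(ℝ, E) (fun x => g * x) (1 : G)
  have hm : Function.Injective m' := by
    refine (injective_iff_map_eq_zero m').2 fun u hu => ?_
    have h1 := mfderiv_mul_left_mulInvariantVectorField g⁻¹ g u
    have h2 : (mfderiv 𝓘(ℝ, E) 𝓘(ℝ, E) (fun x => g⁻¹ * x) g : E →L[ℝ] E) (m' u) = 0 :=
      (congrArg (mfderiv 𝓘(ℝ, E) 𝓘(ℝ, E) (fun x => g⁻¹ * x) g : E →L[ℝ] E) hu).trans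
        (map_zero (mfderiv 𝓘(ℝ, E) 𝓘(ℝ, E) (fun x => g⁻¹ * x) g : E →L[ℝ] E))
    rw [inv_mul_cancel] at h1
    exact (mulInvariantVectorField_one u).symm.trans (h1.symm.trans h2)
  intro v
  obtain ⟨w, hw⟩ := mfderiv_surjective_of_isSubmersion hp g v
  obtain ⟨u, hu⟩ := (LinearMap.injective_iff_surjective (f := (m' : E →ₗ[ℝ] E))).1 hm w
  refine ⟨u, ?_⟩
  exact (congrArg (mfderiv 𝓘(ℝ, E) 𝓘(ℝ, F) (QuotientGroup.mk : G → G ⧸ H) g : E →L[ℝ] F) hu).trans hw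

variable [FiniteDimensional ℝ F] [IsManifold 𝓘(ℝ, F) ∞ (G ⧸ H)]

omit [FiniteDimensional ℝ E] in
-- For f on G/H the function f ∘ p is unchanged by right multiplication by h, so
-- `leftDeriv_comp_mul_right` equates the two derivatives of f. Differentials of functions separate
-- tangent vectors.
theorem projDeriv_mul_of_mem [T2Space (G ⧸ H)] (g : G) {h : G} (hh : h ∈ H)
    (u : GroupLieAlgebra 𝓘(ℝ, E) G) :
    projDeriv H F (g * h) u = projDeriv H F g (Ad E h u) := by
  by_contra hne
  obtain ⟨L, hL⟩ := SeparatingDual.exists_separating_of_ne (R := ℝ) hne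
  apply hL
  obtain ⟨f, hf⟩ := exists_differential_eq (F := F) (g : G ⧸ H) L
  have e : ((g * h : G) : G ⧸ H) = g := by simp [hh]
  have hf' : ∀ y : G ⧸ H, y = (g : G ⧸ H) → (differential f y : F →L[ℝ] ℝ) = L := by
    rintro _ rfl; exact hf
  have h1 := differential_projDeriv hp f.contMDiff (g * h) u
  have h2 := differential_projDeriv hp f.contMDiff g (Ad E h u)
  have hfc : ContMDiff 𝓘(ℝ, E) 𝓘(ℝ, ℝ) ∞ (fun x : G => f (x : G ⧸ H)) :=
    f.contMDiff.comp hp.contMDiff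
  have h3 := leftDeriv_comp_mul_right hfc h u g
  have h4 : (fun x : G => f ((x * h : G) : G ⧸ H)) = fun x : G => f (x : G ⧸ H) := by
    ext x
    congr 1
    simp [hh]
  rw [h4] at h3
  have h5 := h1.trans (h3.symm.trans h2.symm)
  exact ((congrArg (fun L : F →L[ℝ] ℝ => L (projDeriv H F (g * h) u)) (hf' _ e)).symm.trans h5).trans
    (congrArg (fun L : F →L[ℝ] ℝ => L (projDeriv H F g (Ad E h u))) (hf' _ rfl))

omit [FiniteDimensional ℝ E] in
theorem exists_pullback (a : G) (β : OneForm F (G ⧸ H)) :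
    ∃ β' : OneForm F (G ⧸ H), ∀ x, β' x = pullback a β x := by
  refine ⟨⟨fun x => pullback a β x, contMDiff_cotangent_of_apply fun x V hV => ?_⟩, fun _ => rfl⟩
  have := ((contMDiff_translation hp a).contMDiff_tangentMap (m := ∞) (by simp)).contMDiffAt.comp x hV
  exact contMDiff_oneForm_apply β this

end HomogeneousSpace

/-! ### One-forms as equivariant functions on G -/

namespace ReductiveComplement

variable {E : Type*} [NormedAddCommGroup E] [NormedSpace ℝ E]
  {G : Type*} [TopologicalSpace G] [ChartedSpace E G] [Group G] [LieGroup 𝓘(ℝ, E) ∞ G]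
  {H : Subgroup G}
  {F : Type*} [NormedAddCommGroup F] [NormedSpace ℝ F] [ChartedSpace F (G ⧸ H)]
  (𝔪 : ReductiveComplement E H)

theorem proj_coe (u : 𝔪.space) : 𝔪.proj u = u :=
  Submodule.projectionOnto_apply_left _ u

theorem sub_proj_mem (u : GroupLieAlgebra 𝓘(ℝ, E) G) :
    u - 𝔪.proj u ∈ subgroupLieAlgebra E H := by
  have : 𝔪.proj (u - 𝔪.proj u) = 0 := by rw [map_sub, proj_coe, sub_self]
  rwa [proj, Submodule.projectionOnto_apply_eq_zero_iff] at this

theorem Ad_mem {h : G} (hh : h ∈ H) (u : 𝔪.space) : Ad E h u ∈ 𝔪.space :=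
  (𝔪.map_Ad h hh).le (Submodule.mem_map_of_mem u.2)

/-- The restriction of `Ad_h`, `h ∈ H`, to `𝔪`, extended to all `h` by the projection on `𝔪`. -/
def AdRestrict (h : G) : 𝔪.space →ₗ[ℝ] 𝔪.space :=
  𝔪.proj ∘ₗ (Ad E h : GroupLieAlgebra 𝓘(ℝ, E) G →ₗ[ℝ] _) ∘ₗ 𝔪.space.subtype

theorem coe_AdRestrict {h : G} (hh : h ∈ H) (u : 𝔪.space) :
    (𝔪.AdRestrict h u : GroupLieAlgebra 𝓘(ℝ, E) G) = Ad E h u :=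
  congrArg Subtype.val (𝔪.proj_coe ⟨_, 𝔪.Ad_mem hh u⟩)

section Forms

variable (hp : Manifold.IsSubmersion 𝓘(ℝ, E) 𝓘(ℝ, F) ∞ (QuotientGroup.mk : G → G ⧸ H))

include hp

theorem projDeriv_proj (g : G) (u : GroupLieAlgebra 𝓘(ℝ, E) G) :
    projDeriv (E := E) H F g (𝔪.proj u) = projDeriv (E := E) H F g u := by
  have := (projDeriv_eq_zero_iff hp g _).2 (𝔪.sub_proj_mem u)
  rw [map_sub, sub_eq_zero] at this
  exact this.symm

variable [IsManifold 𝓘(ℝ, F) ∞ (G ⧸ H)]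

/-- Trades the pullback to ē for evaluation on the projected left-invariant frame at g, the form
used in all later computations. -/
theorem equivariantFun_apply (β : OneForm F (G ⧸ H)) (g : G) (u : 𝔪.space) :
    𝔪.equivariantFun β g u = β (g : G ⧸ H) (projDeriv (E := E) H F g u) := by
  have h1 : (mfderiv 𝓘(ℝ, E) 𝓘(ℝ, F) (QuotientGroup.mk : G → G ⧸ H) 1 : E →L[ℝ] F)
      (u : GroupLieAlgebra 𝓘(ℝ, E) G) = projDeriv (E := E) H F 1 u :=
    congrArg (mfderiv 𝓘(ℝ, E) 𝓘(ℝ, F) (QuotientGroup.mk : G → G ⧸ H) 1 : E →L[ℝ] F)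
      (mulInvariantVectorField_one (u : GroupLieAlgebra 𝓘(ℝ, E) G)).symm
  have h2 : ∀ y : G, y = g → (β (y : G ⧸ H) : F →L[ℝ] ℝ) (projDeriv (E := E) H F y u) =
      (β (g : G ⧸ H) : F →L[ℝ] ℝ) (projDeriv (E := E) H F g u) := by rintro _ rfl; rfl
  refine Eq.trans ?_ (h2 (g * 1) (mul_one g))
  refine congrArg (β ((g * 1 : G) : G ⧸ H) : F →L[ℝ] ℝ) ?_
  exact (congrArg (translationDeriv F g ((1 : G) : G ⧸ H) : F →L[ℝ] F) h1).trans
    (translationDeriv_projDeriv hp g 1 u)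

theorem oneForm_projDeriv (β : OneForm F (G ⧸ H)) (g : G) (u : GroupLieAlgebra 𝓘(ℝ, E) G) :
    β (g : G ⧸ H) (projDeriv (E := E) H F g u) = 𝔪.equivariantFun β g (𝔪.proj u) := by
  rw [𝔪.equivariantFun_apply hp, 𝔪.projDeriv_proj hp]

theorem contMDiff_equivariantFun (β : OneForm F (G ⧸ H)) (u : 𝔪.space) :
    ContMDiff 𝓘(ℝ, E) 𝓘(ℝ, ℝ) ∞ (fun g => 𝔪.equivariantFun β g u) := by
  simp only [𝔪.equivariantFun_apply hp]
  intro g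
  have := ((hp.contMDiff.contMDiff_tangentMap (m := ∞) (by simp)).comp
    (contMDiff_infty_mulInvariantVectorField (u : GroupLieAlgebra 𝓘(ℝ, E) G))) g
  exact contMDiff_oneForm_apply β this

theorem equivariantFun_pullback {a : G} {β β' : OneForm F (G ⧸ H)}
    (h : ∀ x, β' x = pullback a β x) (g : G) :
    𝔪.equivariantFun β' g = 𝔪.equivariantFun β (a * g) := by
  ext u
  rw [𝔪.equivariantFun_apply hp, 𝔪.equivariantFun_apply hp, h]
  exact congrArg (β ((a * g : G) : G ⧸ H) : F →L[ℝ] ℝ) (translationDeriv_projDeriv hp a g u)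

theorem oneForm_eq_of_equivariantFun_eq [FiniteDimensional ℝ E] {β β' : OneForm F (G ⧸ H)} {g : G}
    (h : 𝔪.equivariantFun β g = 𝔪.equivariantFun β' g) :
    β (g : G ⧸ H) = β' (g : G ⧸ H) := by
  ext v
  obtain ⟨u, rfl⟩ := projDeriv_surjective hp g v
  rw [𝔪.oneForm_projDeriv hp, 𝔪.oneForm_projDeriv hp, h]

theorem equivariantFun_injective [FiniteDimensional ℝ E] :
    Function.Injective (𝔪.equivariantFun : OneForm F (G ⧸ H) → G → 𝔪.Dual) := by
  intro β β' h
  ext x : 1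
  obtain ⟨g, rfl⟩ := QuotientGroup.mk_surjective x
  exact 𝔪.oneForm_eq_of_equivariantFun_eq hp (congrFun h g)

theorem equivariantFun_add (α β : OneForm F (G ⧸ H)) (g : G) :
    𝔪.equivariantFun (α + β) g = 𝔪.equivariantFun α g + 𝔪.equivariantFun β g := by
  ext u
  rw [LinearMap.add_apply]
  simp only [𝔪.equivariantFun_apply hp]
  rfl

theorem equivariantFun_smul (c : ℝ) (β : OneForm F (G ⧸ H)) (g : G) :
    𝔪.equivariantFun (c • β) g = c • 𝔪.equivariantFun β g := by
  ext u
  rw [LinearMap.smul_apply]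
  simp only [𝔪.equivariantFun_apply hp]
  rfl

theorem equivariantFun_of_eq_smul {α γ : OneForm F (G ⧸ H)} {f : G ⧸ H → ℝ}
    (h : ∀ x, γ x = f x • α x) (g : G) :
    𝔪.equivariantFun γ g = f g • 𝔪.equivariantFun α g := by
  ext u
  rw [LinearMap.smul_apply]
  simp only [𝔪.equivariantFun_apply hp, h]
  rfl

theorem equivariantFun_of_eq_add {α β γ : OneForm F (G ⧸ H)} {c d : ℝ} {g : G}
    (h : γ (g : G ⧸ H) = c • α (g : G ⧸ H) + d • β (g : G ⧸ H)) :
    𝔪.equivariantFun γ g = c • 𝔪.equivariantFun α g + d • 𝔪.equivariantFun β g := by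
  ext u
  rw [LinearMap.add_apply, LinearMap.smul_apply, LinearMap.smul_apply]
  simp only [𝔪.equivariantFun_apply hp, h]
  rfl

variable [FiniteDimensional ℝ F]

theorem equivariantFun_exteriorDerivative (f : C^∞⟮𝓘(ℝ, F), G ⧸ H; 𝓘(ℝ, ℝ), ℝ⟯) (g : G)
    (u : 𝔪.space) :
    𝔪.equivariantFun (exteriorDerivative f) g u =
      leftDeriv (u : GroupLieAlgebra 𝓘(ℝ, E) G) (fun x : G => f (x : G ⧸ H)) g := by
  rw [𝔪.equivariantFun_apply hp]
  exact differential_projDeriv hp f.contMDiff g u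

theorem leftDeriv_proj [T2Space (G ⧸ H)] (f : C^∞⟮𝓘(ℝ, F), G ⧸ H; 𝓘(ℝ, ℝ), ℝ⟯) (g : G)
    (u : GroupLieAlgebra 𝓘(ℝ, E) G) :
    leftDeriv u (fun x : G => f (x : G ⧸ H)) g =
      𝔪.equivariantFun (exteriorDerivative f) g (𝔪.proj u) := by
  rw [← differential_projDeriv hp f.contMDiff g u]
  exact 𝔪.oneForm_projDeriv hp (exteriorDerivative f) g u

variable [T2Space (G ⧸ H)]

/-- The elements g and gh represent the same point, and their frames there differ by Ad_h. -/
theorem equivariantFun_mul_of_mem (β : OneForm F (G ⧸ H)) (g : G) {h : G} (hh : h ∈ H) :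
    𝔪.equivariantFun β (g * h) = 𝔪.equivariantFun β g ∘ₗ 𝔪.AdRestrict h := by
  ext u
  have e : ((g * h : G) : G ⧸ H) = g := by simp [hh]
  rw [LinearMap.comp_apply, 𝔪.equivariantFun_apply hp, 𝔪.equivariantFun_apply hp,
    projDeriv_mul_of_mem hp g hh, 𝔪.coe_AdRestrict hh]
  have : ∀ y : G ⧸ H, y = g → ∀ w : F, (β y : F →L[ℝ] ℝ) w = (β g : F →L[ℝ] ℝ) w := by
    rintro _ rfl _; rfl
  exact this _ e _

/-- Ad_h preserves 𝔪 by hypothesis. It also preserves 𝔥, the kernel of Tp, because the kernels of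
the frame maps at 1 and at h coincide; hence it commutes with the projection. -/
theorem proj_Ad [FiniteDimensional ℝ E] {h : G} (hh : h ∈ H) (u : GroupLieAlgebra 𝓘(ℝ, E) G) :
    𝔪.proj (Ad E h u) = 𝔪.AdRestrict h (𝔪.proj u) := by
  have h1 : projDeriv (E := E) H F 1 (Ad E h (u - 𝔪.proj u)) = 0 := by
    rw [← projDeriv_mul_of_mem hp 1 hh]
    exact (projDeriv_eq_zero_iff hp _ _).2 (𝔪.sub_proj_mem u)
  have h2 := (projDeriv_eq_zero_iff hp _ _).1 h1
  rw [← Submodule.projectionOnto_apply_eq_zero_iff 𝔪.isCompl.symm] at h2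
  have h3 : 𝔪.proj (Ad E h (u - 𝔪.proj u)) = 0 := h2
  have h4 : Ad E h (u - 𝔪.proj u) = Ad E h u - Ad E h (𝔪.proj u : GroupLieAlgebra 𝓘(ℝ, E) G) :=
    map_sub (Ad E h) _ _
  rw [h4, map_sub, sub_eq_zero] at h3
  exact h3

end Forms

end ReductiveComplement

/-! ### The identification of 𝔪 with the tangent space, and the bivector in equivariant form -/

namespace ReductiveComplement

variable {E : Type*} [NormedAddCommGroup E] [NormedSpace ℝ E]
  {G : Type*} [TopologicalSpace G] [ChartedSpace E G] [Group G] [LieGroup 𝓘(ℝ, E) ∞ G]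
  {H : Subgroup G}
  {F : Type*} [NormedAddCommGroup F] [NormedSpace ℝ F] [ChartedSpace F (G ⧸ H)]
  (𝔪 : ReductiveComplement E H)
  (hp : Manifold.IsSubmersion 𝓘(ℝ, E) 𝓘(ℝ, F) ∞ (QuotientGroup.mk : G → G ⧸ H))

variable (F) in
/-- The restriction of `projDeriv` to `𝔪`. -/
def tangentMap (g : G) : 𝔪.space →ₗ[ℝ] F := projDeriv H F g ∘ₗ 𝔪.space.subtype

include hp

theorem tangentMap_injective (g : G) : Function.Injective (𝔪.tangentMap F g) := by
  refine (injective_iff_map_eq_zero _).2 fun u hu => ?_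
  have h1 := (projDeriv_eq_zero_iff hp g _).1 hu
  have := 𝔪.isCompl.inf_eq_bot.le ⟨h1, u.2⟩
  exact Subtype.ext this

theorem tangentMap_surjective [FiniteDimensional ℝ E] (g : G) :
    Function.Surjective (𝔪.tangentMap F g) := by
  intro v
  obtain ⟨u, rfl⟩ := projDeriv_surjective hp g v
  exact ⟨𝔪.proj u, 𝔪.projDeriv_proj hp g u⟩

omit hp in
theorem toTangent_apply (u : 𝔪.space) : (𝔪.toTangent F u : F) = 𝔪.tangentMap F 1 u :=
  congrArg (mfderiv 𝓘(ℝ, E) 𝓘(ℝ, F) (QuotientGroup.mk : G → G ⧸ H) 1 : E →L[ℝ] F)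
      (mulInvariantVectorField_one (u : GroupLieAlgebra 𝓘(ℝ, E) G)).symm

/-- Ensures that `ContinuousLinearMap.inverse` in the definitions is a genuine inverse and not the
default value 0. -/
theorem exists_toTangent_eq [FiniteDimensional ℝ E] [FiniteDimensional ℝ F] :
    ∃ e : 𝔪.space ≃L[ℝ] TangentSpace 𝓘(ℝ, F) ((1 : G) : G ⧸ H), 𝔪.toTangent F = e := by
  have hb : Function.Bijective (𝔪.toTangent F) :=
    ⟨fun u v h => 𝔪.tangentMap_injective hp 1
      ((𝔪.toTangent_apply u).symm.trans (Eq.trans h (𝔪.toTangent_apply v))), fun v => by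
      obtain ⟨u, hu⟩ := 𝔪.tangentMap_surjective hp 1 v
      exact ⟨u, (𝔪.toTangent_apply u).trans hu⟩⟩
  refine ⟨(LinearEquiv.ofBijective (𝔪.toTangent F : 𝔪.space →ₗ[ℝ] _) hb).toContinuousLinearEquiv,
    ?_⟩
  ext u
  rfl

section

variable [FiniteDimensional ℝ E] [FiniteDimensional ℝ F]

theorem toTangent_inverse (v : TangentSpace 𝓘(ℝ, F) ((1 : G) : G ⧸ H)) :
    𝔪.toTangent F ((𝔪.toTangent F).inverse v) = v := by
  obtain ⟨e, he⟩ := 𝔪.exists_toTangent_eq hp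
  rw [he, ContinuousLinearMap.inverse_equiv]
  exact e.apply_symm_apply v

theorem toCotangent_ofCotangent (α : CotangentSpace F ((1 : G) : G ⧸ H)) :
    𝔪.toCotangent F (𝔪.ofCotangent α) = α := by
  ext v
  exact congrArg α (𝔪.toTangent_inverse hp v)

end

variable [IsManifold 𝓘(ℝ, F) ∞ (G ⧸ H)]

theorem equivariantFun_one (β : OneForm F (G ⧸ H)) :
    𝔪.equivariantFun β 1 = 𝔪.ofCotangent (β ((1 : G) : G ⧸ H)) := by
  ext u
  rw [𝔪.equivariantFun_apply hp]
  exact congrArg (β ((1 : G) : G ⧸ H) : F →L[ℝ] ℝ) (𝔪.toTangent_apply u).symm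

variable [FiniteDimensional ℝ E] [FiniteDimensional ℝ F]

/-- Every covector at every g comes from an exact form, so identities on 𝔪* can be proved with
functions. -/
theorem exists_equivariantFun_eq [T2Space (G ⧸ H)] (g : G) (η : 𝔪.Dual) :
    ∃ f : C^∞⟮𝓘(ℝ, F), G ⧸ H; 𝓘(ℝ, ℝ), ℝ⟯, 𝔪.equivariantFun (exteriorDerivative f) g = η := by
  let e := LinearEquiv.ofBijective (𝔪.tangentMap F g)
    ⟨𝔪.tangentMap_injective hp g, 𝔪.tangentMap_surjective hp g⟩
  obtain ⟨f, hf⟩ := exists_differential_eq (F := F) (g : G ⧸ H)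
    (LinearMap.toContinuousLinearMap (η ∘ₗ (e.symm : F →ₗ[ℝ] 𝔪.space)) : F →L[ℝ] ℝ)
  refine ⟨f, ?_⟩
  ext u
  rw [𝔪.equivariantFun_apply hp]
  refine (congrArg (fun L : F →L[ℝ] ℝ => L (𝔪.tangentMap F g u)) hf).trans ?_
  exact congrArg η (e.symm_apply_apply u)

variable (π : BivectorField F (G ⧸ H))

omit hp [FiniteDimensional ℝ E] in
theorem bivector_eq (η ξ : 𝔪.Dual) : 𝔪.bivector π η ξ = ξ (𝔪.sharp π η) := rfl

omit hp [FiniteDimensional ℝ E] in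
theorem bivector_skew (η ξ : 𝔪.Dual) : 𝔪.bivector π η ξ = -𝔪.bivector π ξ η :=
  π.skew _ _ _

theorem tangentMap_one_sharp (η : 𝔪.Dual) :
    𝔪.tangentMap F 1 (𝔪.sharp π η) = π.sharp ((1 : G) : G ⧸ H) (𝔪.toCotangent F η) :=
  (𝔪.toTangent_apply _).symm.trans (𝔪.toTangent_inverse hp _)

variable {π} (hπG : π.IsInvariant G)
include hπG

/-- Invariance of π moves the computation from gH to ē, so in the frame at g the bundle map is the
fixed linear map given by r. -/
theorem sharp_oneForm (β : OneForm F (G ⧸ H)) (g : G) :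
    π.sharp (g : G ⧸ H) (β g) = 𝔪.tangentMap F g (𝔪.sharp π (𝔪.equivariantFun β g)) := by
  have h : ∀ y, y = g → (π.sharp (y : G ⧸ H) (β y) : F) =
        𝔪.tangentMap F y (𝔪.sharp π (𝔪.equivariantFun β g)) →
      (π.sharp (g : G ⧸ H) (β g) : F) =
        𝔪.tangentMap F g (𝔪.sharp π (𝔪.equivariantFun β g)) := by
    rintro _ rfl h; exact h
  refine h (g * 1) (mul_one g) ?_
  refine (hπG g ((1 : G) : G ⧸ H) (β ((g * 1 : G) : G ⧸ H))).trans ?_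
  have h2 : (π.sharp ((1 : G) : G ⧸ H) (pullback g β ((1 : G) : G ⧸ H)) : F) =
      𝔪.tangentMap F 1 (𝔪.sharp π (𝔪.equivariantFun β g)) := by
    rw [𝔪.tangentMap_one_sharp hp, equivariantFun, 𝔪.toCotangent_ofCotangent hp]
  exact (congrArg (translationDeriv F g ((1 : G) : G ⧸ H) : F →L[ℝ] F) h2).trans
    (translationDeriv_projDeriv hp g 1 _)

theorem pairing_oneForm (α β : OneForm F (G ⧸ H)) (g : G) :
    π.pairing (g : G ⧸ H) (α g) (β g) =
      𝔪.bivector π (𝔪.equivariantFun α g) (𝔪.equivariantFun β g) := by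
  rw [bivector_eq, 𝔪.equivariantFun_apply hp]
  exact congrArg (β (g : G ⧸ H) : F →L[ℝ] ℝ) (𝔪.sharp_oneForm hp hπG α g)

theorem differential_sharp_oneForm {k : G ⧸ H → ℝ} (hk : ContMDiff 𝓘(ℝ, F) 𝓘(ℝ, ℝ) ∞ k)
    (α : OneForm F (G ⧸ H)) (g : G) :
    differential k (g : G ⧸ H) (π.sharp (g : G ⧸ H) (α g)) =
      leftDeriv (𝔪.sharp π (𝔪.equivariantFun α g) : GroupLieAlgebra 𝓘(ℝ, E) G)
        (fun x : G => k (x : G ⧸ H)) g :=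
  (congrArg (differential k (g : G ⧸ H) : F →L[ℝ] ℝ) (𝔪.sharp_oneForm hp hπG α g)).trans
    (differential_projDeriv hp hk g _)

variable [T2Space (G ⧸ H)]

/-- The point ē is represented by both 1 and h. Comparing `sharp_oneForm` at the two representatives
gives the Ad_H-invariance of r. -/
theorem AdRestrict_sharp {h : G} (hh : h ∈ H) (η : 𝔪.Dual) :
    𝔪.AdRestrict h (𝔪.sharp π (η ∘ₗ 𝔪.AdRestrict h)) = 𝔪.sharp π η := by
  obtain ⟨f, rfl⟩ := 𝔪.exists_equivariantFun_eq hp 1 η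
  apply 𝔪.tangentMap_injective hp 1
  rw [← 𝔪.equivariantFun_mul_of_mem hp _ 1 hh]
  have h1 := 𝔪.sharp_oneForm hp hπG (exteriorDerivative f) 1
  have h2 := 𝔪.sharp_oneForm hp hπG (exteriorDerivative f) (1 * h)
  have e : ((1 * h : G) : G ⧸ H) = (1 : G) := QuotientGroup.mk_mul_of_mem 1 hh
  have h3 : ∀ y : G ⧸ H, y = (1 : G) → (π.sharp y (exteriorDerivative f y) : F) =
      π.sharp ((1 : G) : G ⧸ H) (exteriorDerivative f ((1 : G) : G ⧸ H)) := by rintro _ rfl; rfl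
  refine Eq.trans ?_ (h2.symm.trans ((h3 _ e).trans h1))
  refine Eq.trans ?_ (projDeriv_mul_of_mem hp 1 hh _).symm
  exact congrArg (projDeriv H F 1) (𝔪.coe_AdRestrict hh _)

end ReductiveComplement

/-! ### Smoothness and Leibniz rules for functions with values in a dual space -/

section DualValued

variable {E : Type*} [NormedAddCommGroup E] [NormedSpace ℝ E]
  {G : Type*} [TopologicalSpace G] [ChartedSpace E G]
  {W : Type*} [AddCommGroup W] [Module ℝ W] [FiniteDimensional ℝ W]

theorem dual_eq_sum (η : Module.Dual ℝ W) :
    η = ∑ i, η (Module.finBasis ℝ W i) • (Module.finBasis ℝ W).coord i := by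
  ext u
  conv_lhs => rw [← (Module.finBasis ℝ W).sum_repr u]
  simp only [map_sum, map_smul, LinearMap.sum_apply, LinearMap.smul_apply, smul_eq_mul,
    Module.Basis.coord_apply]
  exact Finset.sum_congr rfl fun i _ => mul_comm _ _

theorem bilin_dual_eq_sum (B : Module.Dual ℝ W →ₗ[ℝ] Module.Dual ℝ W →ₗ[ℝ] ℝ)
    (η ξ : Module.Dual ℝ W) :
    B η ξ = ∑ i, ∑ j, B ((Module.finBasis ℝ W).coord i) ((Module.finBasis ℝ W).coord j) *
      (η (Module.finBasis ℝ W i) * ξ (Module.finBasis ℝ W j)) := by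
  conv_lhs => rw [dual_eq_sum η, dual_eq_sum ξ]
  simp only [map_sum, map_smul, LinearMap.sum_apply, LinearMap.smul_apply, smul_eq_mul,
    Finset.mul_sum]
  rw [Finset.sum_comm]
  refine Finset.sum_congr rfl fun i _ => Finset.sum_congr rfl fun j _ => ?_
  ring

variable {Φ Ψ : G → Module.Dual ℝ W}
  (hΦ : ∀ u, ContMDiff 𝓘(ℝ, E) 𝓘(ℝ, ℝ) ∞ (fun g => Φ g u))
  (hΨ : ∀ u, ContMDiff 𝓘(ℝ, E) 𝓘(ℝ, ℝ) ∞ (fun g => Ψ g u))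

include hΦ hΨ

theorem contMDiff_bilin_dual (B : Module.Dual ℝ W →ₗ[ℝ] Module.Dual ℝ W →ₗ[ℝ] ℝ) :
    ContMDiff 𝓘(ℝ, E) 𝓘(ℝ, ℝ) ∞ (fun g => B (Φ g) (Ψ g)) := by
  rw [funext fun g => bilin_dual_eq_sum B (Φ g) (Ψ g)]
  exact contMDiff_finsetSum fun i _ => contMDiff_finsetSum fun j _ =>
    contMDiff_const.mul ((hΦ _).mul (hΨ _))

variable [Group G]

theorem leftDeriv_bilin_dual (B : Module.Dual ℝ W →ₗ[ℝ] Module.Dual ℝ W →ₗ[ℝ] ℝ)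
    {v : GroupLieAlgebra 𝓘(ℝ, E) G} {g : G} {Φ' Ψ' : Module.Dual ℝ W}
    (hΦ' : ∀ u, Φ' u = leftDeriv v (fun x => Φ x u) g)
    (hΨ' : ∀ u, Ψ' u = leftDeriv v (fun x => Ψ x u) g) :
    leftDeriv v (fun x => B (Φ x) (Ψ x)) g = B Φ' (Ψ g) + B (Φ g) Ψ' := by
  rw [funext fun x => bilin_dual_eq_sum B (Φ x) (Ψ x), bilin_dual_eq_sum B Φ',
    bilin_dual_eq_sum B _ Ψ']
  have hm : ∀ i j, ContMDiff 𝓘(ℝ, E) 𝓘(ℝ, ℝ) ∞ (fun x =>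
      Φ x (Module.finBasis ℝ W i) * Ψ x (Module.finBasis ℝ W j)) := fun i j => (hΦ _).mul (hΨ _)
  have hc : ∀ i j, ContMDiff 𝓘(ℝ, E) 𝓘(ℝ, ℝ) ∞ (fun x =>
      B ((Module.finBasis ℝ W).coord i) ((Module.finBasis ℝ W).coord j) *
        (Φ x (Module.finBasis ℝ W i) * Ψ x (Module.finBasis ℝ W j))) := fun i j =>
    contMDiff_const.mul (hm i j)
  rw [leftDeriv_sum _ fun i => contMDiff_finsetSum fun j _ => hc i j, ← Finset.sum_add_distrib]
  refine Finset.sum_congr rfl fun i _ => ?_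
  rw [leftDeriv_sum _ fun j => hc i j, ← Finset.sum_add_distrib]
  refine Finset.sum_congr rfl fun j _ => ?_
  rw [leftDeriv_const_mul _ (hm i j), leftDeriv_mul (hΦ _) (hΨ _), hΦ', hΨ']
  ring

omit hΨ in
-- The direction of differentiation varies with g. Expanding it in a basis leaves smooth
-- coefficients times derivatives along fixed left-invariant fields.
theorem contMDiff_leftDeriv_dual [LieGroup 𝓘(ℝ, E) ∞ G] {f : G → ℝ} (hf : ContMDiff 𝓘(ℝ, E) 𝓘(ℝ, ℝ) ∞ f)
    (A : Module.Dual ℝ W →ₗ[ℝ] GroupLieAlgebra 𝓘(ℝ, E) G) :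
    ContMDiff 𝓘(ℝ, E) 𝓘(ℝ, ℝ) ∞ (fun g => leftDeriv (A (Φ g)) f g) := by
  have e : ∀ g, leftDeriv (A (Φ g)) f g = ∑ i, Φ g (Module.finBasis ℝ W i) *
      leftDeriv (A ((Module.finBasis ℝ W).coord i)) f g := by
    intro g
    let L : GroupLieAlgebra 𝓘(ℝ, E) G →ₗ[ℝ] ℝ :=
      { toFun := fun v => leftDeriv v f g
        map_add' := fun u v => leftDeriv_add_left u v f g
        map_smul' := fun c u => leftDeriv_smul_left c u f g }
    change L (A (Φ g)) = ∑ i, _ * L (A _)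
    conv_lhs => rw [dual_eq_sum (Φ g)]
    simp only [map_sum, map_smul, smul_eq_mul]
  simp only [e]
  exact contMDiff_finsetSum fun i _ => (hΦ _).mul (contMDiff_leftDeriv hf _)

end DualValued

/-! ### Descent of equivariant functions to one-forms -/

namespace ReductiveComplement

variable {E : Type*} [NormedAddCommGroup E] [NormedSpace ℝ E] [FiniteDimensional ℝ E]
  {G : Type*} [TopologicalSpace G] [ChartedSpace E G] [Group G] [LieGroup 𝓘(ℝ, E) ∞ G]
  {H : Subgroup G}
  {F : Type*} [NormedAddCommGroup F] [NormedSpace ℝ F] [ChartedSpace F (G ⧸ H)]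
  [FiniteDimensional ℝ F] [IsManifold 𝓘(ℝ, F) ∞ (G ⧸ H)] [T2Space (G ⧸ H)]
  (𝔪 : ReductiveComplement E H)
  (hp : Manifold.IsSubmersion 𝓘(ℝ, E) 𝓘(ℝ, F) ∞ (QuotientGroup.mk : G → G ⧸ H))
  {Φ : G → 𝔪.Dual} (hΦ : ∀ u, ContMDiff 𝓘(ℝ, E) 𝓘(ℝ, ℝ) ∞ (fun g => Φ g u))
  (hΦH : ∀ g, ∀ h ∈ H, Φ (g * h) = Φ g ∘ₗ 𝔪.AdRestrict h)

include hp hΦ hΦH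

omit hΦ in
-- The covector is defined through a chosen representative of the coset; equivariance of Φ
-- compensates the Ad_h by which the frame changes with the representative.
theorem exists_covectorField : ∃ θ : (x : G ⧸ H) → CotangentSpace F x,
    ∀ (g : G) (u : 𝔪.space), (θ g : F →L[ℝ] ℝ) (𝔪.tangentMap F g u) = Φ g u := by
  let e := fun g : G => LinearEquiv.ofBijective (𝔪.tangentMap F g)
    ⟨𝔪.tangentMap_injective hp g, 𝔪.tangentMap_surjective hp g⟩
  refine ⟨fun y => (LinearMap.toContinuousLinearMap
    (Φ y.out ∘ₗ ((e y.out).symm : F →ₗ[ℝ] 𝔪.space)) : F →L[ℝ] ℝ), fun g u => ?_⟩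
  obtain ⟨h, hh⟩ := QuotientGroup.mk_out_eq_mul H g
  change Φ (Quotient.out (g : G ⧸ H)) ((e (Quotient.out (g : G ⧸ H))).symm (𝔪.tangentMap F g u)) =
    Φ g u
  rw [hh, hΦH g h h.2, LinearMap.comp_apply]
  congr 1
  apply 𝔪.tangentMap_injective hp g
  refine Eq.trans ?_ ((e (g * h)).apply_symm_apply (𝔪.tangentMap F g u))
  refine Eq.trans ?_ (projDeriv_mul_of_mem hp g h.2 _).symm
  exact congrArg (projDeriv H F g) (𝔪.coe_AdRestrict h.2 _)

/-- Smoothness is the issue. Choose functions fᵢ whose differentials at g are dual to a basis bⱼ of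
𝔪; the matrix A of the F^{dfᵢ}(bⱼ) is the identity at g, hence invertible nearby. Along a local
section s, a smooth field V has frame coordinates A⁻¹(dfᵢ(V)), which are smooth, and θ(V) is the sum
of these coordinates times Φ(s y)(bᵢ). -/
theorem exists_oneForm_equivariantFun_eq :
    ∃ β : OneForm F (G ⧸ H), 𝔪.equivariantFun β = Φ := by
  obtain ⟨θ, hθ⟩ := 𝔪.exists_covectorField hp hΦH
  suffices hs : ContMDiff 𝓘(ℝ, F) (𝓘(ℝ, F).prod 𝓘(ℝ, F →L[ℝ] ℝ)) ∞ (fun y => (⟨y, θ y⟩ :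
      Bundle.TotalSpace (F →L[ℝ] ℝ) (CotangentSpace F : G ⧸ H → Type _))) by
    refine ⟨⟨θ, hs⟩, ?_⟩
    ext g u
    rw [𝔪.equivariantFun_apply hp]
    exact hθ g u
  refine contMDiff_cotangent_of_apply fun x V hV => ?_
  obtain ⟨g, rfl⟩ := QuotientGroup.mk_surjective x
  obtain ⟨s, hs, hsg, hps⟩ := exists_localSection hp g
  let b := Module.finBasis ℝ 𝔪.space
  choose f hf using fun i => 𝔪.exists_equivariantFun_eq hp g (b.coord i)
  let A : G → ((Fin (Module.finrank ℝ 𝔪.space) → ℝ) →L[ℝ] (Fin (Module.finrank ℝ 𝔪.space) → ℝ)) :=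
    fun a => LinearMap.toContinuousLinearMap (LinearMap.pi fun i =>
      𝔪.equivariantFun (exteriorDerivative (f i)) a ∘ₗ
        (b.equivFun.symm : (Fin (Module.finrank ℝ 𝔪.space) → ℝ) →ₗ[ℝ] 𝔪.space))
  have hA1 : A g = ContinuousLinearEquiv.refl ℝ (Fin (Module.finrank ℝ 𝔪.space) → ℝ) := by
    ext c i
    change 𝔪.equivariantFun (exteriorDerivative (f i)) g (b.equivFun.symm c) = c i
    rw [hf]
    exact congrFun (b.equivFun.apply_symm_apply c) i
  have hAs : ContMDiffAt 𝓘(ℝ, E) 𝓘(ℝ, (Fin (Module.finrank ℝ 𝔪.space) → ℝ) →L[ℝ]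
      (Fin (Module.finrank ℝ 𝔪.space) → ℝ)) ∞ A g := by
    refine contMDiffAt_clm_of_apply fun w => contMDiffAt_pi_space.2 fun i => ?_
    exact 𝔪.contMDiff_equivariantFun hp (exteriorDerivative (f i)) (b.equivFun.symm w) g
  let d : G ⧸ H → (Fin (Module.finrank ℝ 𝔪.space) → ℝ) := fun y i => differential (f i) y (V y)
  have hd : ContMDiffAt 𝓘(ℝ, F) 𝓘(ℝ, Fin (Module.finrank ℝ 𝔪.space) → ℝ) ∞ d (g : G ⧸ H) :=
    contMDiffAt_pi_space.2 fun i => contMDiff_differential_apply (f i).contMDiff hV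
  have hAs' := (hsg.symm ▸ hAs : ContMDiffAt 𝓘(ℝ, E) _ ∞ A (s (g : G ⧸ H))).comp _ hs
  have hinv : ContMDiffAt 𝓘(ℝ, F) 𝓘(ℝ, (Fin (Module.finrank ℝ 𝔪.space) → ℝ) →L[ℝ]
      (Fin (Module.finrank ℝ 𝔪.space) → ℝ)) ∞ (fun y => (A (s y)).inverse) (g : G ⧸ H) := by
    refine ContMDiffAt.comp (g := ContinuousLinearMap.inverse) (f := A ∘ s) (g : G ⧸ H) ?_ hAs'
    rw [Function.comp_apply, hsg, hA1]
    exact (contDiffAt_map_inverse _).contMDiffAt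
  have hunit : ∀ᶠ y in 𝓝 (g : G ⧸ H), A (s y) ∈ Set.range
      ((↑) : ((Fin (Module.finrank ℝ 𝔪.space) → ℝ) ≃L[ℝ] (Fin (Module.finrank ℝ 𝔪.space) → ℝ)) →
        ((Fin (Module.finrank ℝ 𝔪.space) → ℝ) →L[ℝ] (Fin (Module.finrank ℝ 𝔪.space) → ℝ))) := by
    refine hAs'.continuousAt.eventually_mem ?_
    rw [Function.comp_apply, hsg, hA1]
    exact ContinuousLinearEquiv.nhds _
  have hw : ContMDiffAt 𝓘(ℝ, F) 𝓘(ℝ, Fin (Module.finrank ℝ 𝔪.space) → ℝ) ∞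
      (fun y => (A (s y)).inverse (d y)) (g : G ⧸ H) := hinv.clm_apply hd
  have key : (fun y => θ y (V y)) =ᶠ[𝓝 (g : G ⧸ H)]
      fun y => ∑ i, (A (s y)).inverse (d y) i * Φ (s y) (b i) := by
    filter_upwards [hps, hunit] with y hy hu
    have h1 : ∀ z : G ⧸ H, z = y → ∃ w : 𝔪.space, (V y : F) = 𝔪.tangentMap F (s y) w ∧
        (θ y : F →L[ℝ] ℝ) (V y) = (θ z : F →L[ℝ] ℝ) (𝔪.tangentMap F (s y) w) ∧
        ∀ i, (differential (f i) y : F →L[ℝ] ℝ) (V y) =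
          (differential (f i) z : F →L[ℝ] ℝ) (𝔪.tangentMap F (s y) w) := by
      rintro _ rfl
      obtain ⟨w, hw⟩ := 𝔪.tangentMap_surjective hp (s _) (V _)
      exact ⟨w, hw.symm, by rw [hw], fun i => by rw [hw]⟩
    obtain ⟨w, -, hw2, hw3⟩ := h1 _ hy
    refine hw2.trans ((hθ (s y) w).trans ?_)
    have h2 : A (s y) (b.equivFun w) = d y := by
      ext i
      change 𝔪.equivariantFun (exteriorDerivative (f i)) (s y) (b.equivFun.symm (b.equivFun w)) = _
      rw [LinearEquiv.symm_apply_apply, 𝔪.equivariantFun_apply hp]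
      exact (hw3 i).symm
    obtain ⟨e, he⟩ := hu
    rw [← h2, ← he, ContinuousLinearMap.inverse_equiv]
    simp only [ContinuousLinearEquiv.coe_coe, ContinuousLinearEquiv.symm_apply_apply]
    conv_lhs => rw [← b.sum_equivFun w]
    simp only [map_sum, map_smul, smul_eq_mul]
  refine ContMDiffAt.congr_of_eventuallyEq ?_ key
  refine contMDiffAt_finsetSum fun i _ => (contMDiffAt_pi_space.1 hw i).mul ?_
  exact (hΦ (b i) (s (g : G ⧸ H))).comp _ hs

end ReductiveComplement

theorem contMDiff_pairing {F : Type*} [NormedAddCommGroup F] [NormedSpace ℝ F]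
    {M : Type*} [TopologicalSpace M] [ChartedSpace F M] [IsManifold 𝓘(ℝ, F) ∞ M]
    (π : BivectorField F M) (α β : OneForm F M) :
    ContMDiff 𝓘(ℝ, F) 𝓘(ℝ, ℝ) ∞ (fun y => π.pairing y (α y) (β y)) := fun y =>
  contMDiff_oneForm_apply β (contMDiff_sharp_apply π α y)

/-! ### The associated bilinear map and the Poisson condition -/

namespace ReductiveComplement

variable {E : Type*} [NormedAddCommGroup E] [NormedSpace ℝ E]
  {G : Type*} [TopologicalSpace G] [ChartedSpace E G] [Group G] [LieGroup 𝓘(ℝ, E) ∞ G]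
  {H : Subgroup G}
  {F : Type*} [NormedAddCommGroup F] [NormedSpace ℝ F] [ChartedSpace F (G ⧸ H)]
  [IsManifold 𝓘(ℝ, F) ∞ (G ⧸ H)]
  (𝔪 : ReductiveComplement E H)
  (hp : Manifold.IsSubmersion 𝓘(ℝ, E) 𝓘(ℝ, F) ∞ (QuotientGroup.mk : G → G ⧸ H))

/-- The derivative `u ↦ v · F^β(·)(u)` of `F^β` at `g` along the left-invariant field of `v`. -/
def dualDeriv (β : OneForm F (G ⧸ H)) (v : GroupLieAlgebra 𝓘(ℝ, E) G) (g : G) : 𝔪.Dual where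
  toFun u := leftDeriv v (fun x => 𝔪.equivariantFun β x u) g
  map_add' u u' := by
    rw [← leftDeriv_add (𝔪.contMDiff_equivariantFun hp β u) (𝔪.contMDiff_equivariantFun hp β u')]
    simp only [map_add]
  map_smul' c u := by
    rw [RingHom.id_apply, smul_eq_mul,
      ← leftDeriv_const_mul c (𝔪.contMDiff_equivariantFun hp β u)]
    simp only [map_smul, smul_eq_mul]

theorem dualDeriv_add_left (β : OneForm F (G ⧸ H)) (v w : GroupLieAlgebra 𝓘(ℝ, E) G) (g : G) :
    𝔪.dualDeriv hp β (v + w) g = 𝔪.dualDeriv hp β v g + 𝔪.dualDeriv hp β w g := by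
  ext u
  exact leftDeriv_add_left _ _ _ _

theorem dualDeriv_smul_left (β : OneForm F (G ⧸ H)) (c : ℝ) (v : GroupLieAlgebra 𝓘(ℝ, E) G)
    (g : G) : 𝔪.dualDeriv hp β (c • v) g = c • 𝔪.dualDeriv hp β v g := by
  ext u
  exact leftDeriv_smul_left _ _ _ _

theorem dualDeriv_add (β β' : OneForm F (G ⧸ H)) (v : GroupLieAlgebra 𝓘(ℝ, E) G) (g : G) :
    𝔪.dualDeriv hp (β + β') v g = 𝔪.dualDeriv hp β v g + 𝔪.dualDeriv hp β' v g := by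
  ext u
  refine Eq.trans ?_ (leftDeriv_add (𝔪.contMDiff_equivariantFun hp β u)
    (𝔪.contMDiff_equivariantFun hp β' u) v g)
  change leftDeriv v _ g = _
  simp only [𝔪.equivariantFun_add hp, LinearMap.add_apply]

theorem dualDeriv_smul (c : ℝ) (β : OneForm F (G ⧸ H)) (v : GroupLieAlgebra 𝓘(ℝ, E) G) (g : G) :
    𝔪.dualDeriv hp (c • β) v g = c • 𝔪.dualDeriv hp β v g := by
  ext u
  refine Eq.trans ?_ (leftDeriv_const_mul c (𝔪.contMDiff_equivariantFun hp β u) v g)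
  change leftDeriv v _ g = _
  simp only [𝔪.equivariantFun_smul hp, LinearMap.smul_apply, smul_eq_mul]

theorem dualDeriv_of_eq_smul {β γ : OneForm F (G ⧸ H)} (f : C^∞⟮𝓘(ℝ, F), G ⧸ H; 𝓘(ℝ, ℝ), ℝ⟯)
    (h : ∀ x, γ x = f x • β x) (v : GroupLieAlgebra 𝓘(ℝ, E) G) (g : G) :
    𝔪.dualDeriv hp γ v g = f (g : G ⧸ H) • 𝔪.dualDeriv hp β v g +
      leftDeriv v (fun x : G => f (x : G ⧸ H)) g • 𝔪.equivariantFun β g := by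
  ext u
  have h1 := leftDeriv_mul (f.contMDiff.comp hp.contMDiff) (𝔪.contMDiff_equivariantFun hp β u) v g
  refine Eq.trans ?_ (h1.trans ?_)
  · change leftDeriv v _ g = _
    simp only [𝔪.equivariantFun_of_eq_smul hp h, LinearMap.smul_apply, smul_eq_mul]
    rfl
  · rw [LinearMap.add_apply, LinearMap.smul_apply, LinearMap.smul_apply, smul_eq_mul, smul_eq_mul,
      mul_comm (leftDeriv _ _ _)]
    rfl

theorem dualDeriv_pullback {a : G} {β β' : OneForm F (G ⧸ H)}
    (h : ∀ x, β' x = pullback a β x) (v : GroupLieAlgebra 𝓘(ℝ, E) G) (g : G) :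
    𝔪.dualDeriv hp β' v g = 𝔪.dualDeriv hp β v (a * g) := by
  ext u
  refine Eq.trans ?_ (leftDeriv_comp_mul_left (𝔪.contMDiff_equivariantFun hp β u) a v g)
  change leftDeriv v _ g = _
  simp only [𝔪.equivariantFun_pullback hp h]

variable [FiniteDimensional ℝ F] (π : BivectorField F (G ⧸ H))

/-- The bivector `r` as a bilinear map on `𝔪*`. -/
def bivectorForm : 𝔪.Dual →ₗ[ℝ] 𝔪.Dual →ₗ[ℝ] ℝ :=
  (LinearMap.id (M := 𝔪.Dual)).flip ∘ₗ 𝔪.sharp π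

theorem bivectorForm_apply (η ξ : 𝔪.Dual) : 𝔪.bivectorForm π η ξ = 𝔪.bivector π η ξ := rfl

/-- The value at `g` of the equivariant function of `D_α β`, for the invariant contravariant
connection `D` with associated bilinear map `b`. -/
def connectionFun (b : 𝔪.Dual →ₗ[ℝ] 𝔪.Dual →ₗ[ℝ] 𝔪.Dual) (α β : OneForm F (G ⧸ H)) (g : G) :
    𝔪.Dual :=
  b (𝔪.equivariantFun α g) (𝔪.equivariantFun β g) +
    𝔪.dualDeriv hp β (𝔪.sharp π (𝔪.equivariantFun α g) : GroupLieAlgebra 𝓘(ℝ, E) G) g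

variable {π} {D : ContravariantConnection π} {b : 𝔪.Dual →ₗ[ℝ] 𝔪.Dual →ₗ[ℝ] 𝔪.Dual}

/-- At the identity the left-invariant field of v is v itself, so the differential in the definition
is `dualDeriv` at 1. -/
theorem isAssociated_iff : 𝔪.IsAssociated D b ↔ ∀ α β : OneForm F (G ⧸ H),
    𝔪.equivariantFun (D.toBilin α β) 1 = 𝔪.connectionFun hp π b α β 1 := by
  refine forall_congr' fun α => forall_congr' fun β => ?_
  rw [LinearMap.ext_iff]
  refine forall_congr' fun u => ?_
  rw [connectionFun, LinearMap.add_apply, ← 𝔪.equivariantFun_one hp, ← 𝔪.equivariantFun_one hp,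
    ← 𝔪.equivariantFun_one hp]
  change _ ↔ _ = _ + leftDeriv _ _ 1
  rw [leftDeriv_one]

/-- Apply the formula at ē to λ_g^*α and λ_g^*β. Their functions are left translates by g, so the
values at 1 become values at g. -/
theorem equivariantFun_connection [FiniteDimensional ℝ E] (hD : D.IsInvariant G)
    (hb : 𝔪.IsAssociated D b) (α β : OneForm F (G ⧸ H)) (g : G) :
    𝔪.equivariantFun (D.toBilin α β) g = 𝔪.connectionFun hp π b α β g := by
  obtain ⟨α', hα⟩ := exists_pullback hp g α
  obtain ⟨β', hβ⟩ := exists_pullback hp g β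
  have h1 := (𝔪.isAssociated_iff hp).1 hb α' β'
  rw [𝔪.equivariantFun_pullback hp (hD g α β α' β' hα hβ), connectionFun,
    𝔪.equivariantFun_pullback hp hα, 𝔪.equivariantFun_pullback hp hβ,
    𝔪.dualDeriv_pullback hp hβ, mul_one] at h1
  exact h1

variable [FiniteDimensional ℝ E] (hπG : π.IsInvariant G)

include hπG in
theorem leftDeriv_bivector (β γ : OneForm F (G ⧸ H)) (v : GroupLieAlgebra 𝓘(ℝ, E) G) (g : G) :
    leftDeriv v (fun x : G => π.pairing (x : G ⧸ H) (β x) (γ x)) g =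
      𝔪.bivector π (𝔪.dualDeriv hp β v g) (𝔪.equivariantFun γ g) +
        𝔪.bivector π (𝔪.equivariantFun β g) (𝔪.dualDeriv hp γ v g) := by
  rw [funext fun x : G => 𝔪.pairing_oneForm hp hπG β γ x]
  exact leftDeriv_bilin_dual (𝔪.contMDiff_equivariantFun hp β) (𝔪.contMDiff_equivariantFun hp γ)
    (𝔪.bivectorForm π) (fun _ => rfl) (fun _ => rfl)

include hp hπG in
-- Since r is constant, the derivative parts of D_α β and D_α γ are exactly the Leibniz expansion of
-- α^#·π(β,γ); only the algebraic parts survive.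
theorem covDerivBivector_eq (hD : D.IsInvariant G) (hb : 𝔪.IsAssociated D b)
    (α β γ : OneForm F (G ⧸ H)) (g : G) :
    D.covDerivBivector α β γ (g : G ⧸ H) =
      -(𝔪.bivector π (b (𝔪.equivariantFun α g) (𝔪.equivariantFun β g)) (𝔪.equivariantFun γ g) +
        𝔪.bivector π (𝔪.equivariantFun β g)
          (b (𝔪.equivariantFun α g) (𝔪.equivariantFun γ g))) := by
  rw [ContravariantConnection.covDerivBivector,
    𝔪.differential_sharp_oneForm hp hπG (contMDiff_pairing π β γ),
    𝔪.leftDeriv_bivector hp hπG, 𝔪.pairing_oneForm hp hπG, 𝔪.pairing_oneForm hp hπG,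
    𝔪.equivariantFun_connection hp hD hb, 𝔪.equivariantFun_connection hp hD hb,
    connectionFun, connectionFun]
  simp only [← bivectorForm_apply, map_add, LinearMap.add_apply]
  ring

variable [T2Space (G ⧸ H)]

include hp hπG in
theorem isPoisson_iff (hD : D.IsInvariant G) (hb : 𝔪.IsAssociated D b) :
    D.IsPoisson ↔ ∀ η ξ ε : 𝔪.Dual, 𝔪.bivector π (b η ξ) ε + 𝔪.bivector π ξ (b η ε) = 0 := by
  constructor
  · intro h η ξ ε
    obtain ⟨f, rfl⟩ := 𝔪.exists_equivariantFun_eq hp 1 η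
    obtain ⟨f', rfl⟩ := 𝔪.exists_equivariantFun_eq hp 1 ξ
    obtain ⟨f'', rfl⟩ := 𝔪.exists_equivariantFun_eq hp 1 ε
    rw [← neg_eq_zero, ← 𝔪.covDerivBivector_eq hp hπG hD hb]
    exact h _ _ _ _
  · intro h α β γ x
    obtain ⟨g, rfl⟩ := QuotientGroup.mk_surjective x
    rw [𝔪.covDerivBivector_eq hp hπG hD hb, h, neg_zero]

/-- The equivariant function of `D_α β` at `1`, corrected by the derivative of that of `β`. -/
def associatedBilin (D : ContravariantConnection π) :
    OneForm F (G ⧸ H) →ₗ[ℝ] OneForm F (G ⧸ H) →ₗ[ℝ] 𝔪.Dual :=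
  LinearMap.mk₂ ℝ (fun α β => 𝔪.equivariantFun (D.toBilin α β) 1 -
      𝔪.dualDeriv hp β (𝔪.sharp π (𝔪.equivariantFun α 1) : GroupLieAlgebra 𝓘(ℝ, E) G) 1)
    (fun α α' β => by
      rw [map_add, LinearMap.add_apply, 𝔪.equivariantFun_add hp, 𝔪.equivariantFun_add hp, map_add,
        Submodule.coe_add, dualDeriv_add_left]
      abel)
    (fun c α β => by
      rw [map_smul, LinearMap.smul_apply, 𝔪.equivariantFun_smul hp, 𝔪.equivariantFun_smul hp,
        map_smul, Submodule.coe_smul, dualDeriv_smul_left, smul_sub])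
    (fun α β β' => by
      rw [map_add, 𝔪.equivariantFun_add hp, dualDeriv_add]
      abel)
    (fun c α β => by
      rw [map_smul, 𝔪.equivariantFun_smul hp, dualDeriv_smul, smul_sub])

include hπG in
-- The term (α^#·f)β from the Leibniz rule of D is matched by the one from differentiating f F^β, so
-- their difference is tensorial in β.
theorem associatedBilin_eq_zero_right (α β : OneForm F (G ⧸ H))
    (hβ : β ((1 : G) : G ⧸ H) = 0) : 𝔪.associatedBilin hp D α β = 0 := by
  refine eq_zero_of_tensorial (𝔪.associatedBilin hp D α) ((1 : G) : G ⧸ H) (fun f s => ?_) β hβ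
  change 𝔪.equivariantFun _ 1 - 𝔪.dualDeriv hp _ _ 1 =
    _ • (𝔪.equivariantFun _ 1 - 𝔪.dualDeriv hp _ _ 1)
  rw [𝔪.dualDeriv_of_eq_smul hp f (β := s) (fun _ => rfl)]
  have h1 := D.leibniz f α s (smulSection f s) (fun _ => rfl) ((1 : G) : G ⧸ H)
  rw [𝔪.differential_sharp_oneForm hp hπG f.contMDiff] at h1
  rw [𝔪.equivariantFun_of_eq_add hp h1]
  module

omit [FiniteDimensional ℝ E] in
theorem associatedBilin_eq_zero_left (α β : OneForm F (G ⧸ H))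
    (hα : α ((1 : G) : G ⧸ H) = 0) : 𝔪.associatedBilin hp D α β = 0 := by
  refine eq_zero_of_tensorial ((𝔪.associatedBilin hp D).flip β) ((1 : G) : G ⧸ H) (fun f s => ?_)
    α hα
  change 𝔪.equivariantFun _ 1 - 𝔪.dualDeriv hp _ _ 1 =
    _ • (𝔪.equivariantFun _ 1 - 𝔪.dualDeriv hp _ _ 1)
  rw [𝔪.equivariantFun_of_eq_smul hp (D.smul_left f s β (smulSection f s) fun _ => rfl),
    𝔪.equivariantFun_of_eq_smul hp (γ := smulSection f s) (α := s) (f := f)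
      fun _ => rfl, map_smul, Submodule.coe_smul,
    dualDeriv_smul_left, smul_sub]

include hp hπG in
theorem exists_isAssociated (D : ContravariantConnection π) : ∃ b, 𝔪.IsAssociated D b := by
  let ev : OneForm F (G ⧸ H) →ₗ[ℝ] 𝔪.Dual :=
    { toFun := fun β => 𝔪.equivariantFun β 1
      map_add' := fun α β => 𝔪.equivariantFun_add hp α β 1
      map_smul' := fun c β => 𝔪.equivariantFun_smul hp c β 1 }
  have hev : LinearMap.range ev = ⊤ := LinearMap.range_eq_top.2 fun η => by
    obtain ⟨f, hf⟩ := 𝔪.exists_equivariantFun_eq hp 1 η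
    exact ⟨_, hf⟩
  -- An arbitrary linear choice of forms with prescribed value at ē; by tensoriality the resulting
  -- map does not depend on it.
  obtain ⟨σ, hσ⟩ := LinearMap.exists_rightInverse_of_surjective ev hev
  refine ⟨(𝔪.associatedBilin hp D).compl₁₂ σ σ, (𝔪.isAssociated_iff hp).2 fun α β => ?_⟩
  have h0 : ∀ γ : OneForm F (G ⧸ H), (γ - σ (ev γ)) ((1 : G) : G ⧸ H) = 0 := fun γ =>
    sub_eq_zero.2 (𝔪.oneForm_eq_of_equivariantFun_eq hp (g := 1)
      (LinearMap.congr_fun hσ (ev γ)).symm)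
  have h1 := 𝔪.associatedBilin_eq_zero_left hp (D := D) _ β (h0 α)
  have h2 := 𝔪.associatedBilin_eq_zero_right hp hπG (D := D) (σ (ev α)) _ (h0 β)
  rw [map_sub, LinearMap.sub_apply, sub_eq_zero] at h1
  rw [map_sub, sub_eq_zero] at h2
  exact sub_eq_iff_eq_add.1 (h1.trans h2)

include hp in
theorem isAssociated_unique {b' : 𝔪.Dual →ₗ[ℝ] 𝔪.Dual →ₗ[ℝ] 𝔪.Dual} (hb : 𝔪.IsAssociated D b)
    (hb' : 𝔪.IsAssociated D b') : b' = b := by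
  ext η ξ : 2
  obtain ⟨f, rfl⟩ := 𝔪.exists_equivariantFun_eq hp 1 η
  obtain ⟨f', rfl⟩ := 𝔪.exists_equivariantFun_eq hp 1 ξ
  have h1 := (𝔪.isAssociated_iff hp).1 hb (exteriorDerivative f) (exteriorDerivative f')
  have h2 := (𝔪.isAssociated_iff hp).1 hb' (exteriorDerivative f) (exteriorDerivative f')
  exact add_right_cancel (h2.symm.trans h1)

end ReductiveComplement

/-! ### The Koszul bracket and tensoriality of the torsion -/

section Torsion

variable {F : Type*} [NormedAddCommGroup F] [NormedSpace ℝ F]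
  {M : Type*} [TopologicalSpace M] [ChartedSpace F M] [IsManifold 𝓘(ℝ, F) ∞ M]

theorem contMDiff_oneForm_vectorField (α : OneForm F M) (X : SmoothVectorField F M) :
    ContMDiff 𝓘(ℝ, F) 𝓘(ℝ, ℝ) ∞ (fun y => α y (X y)) := fun y =>
  contMDiff_oneForm_apply α (X.contMDiff y)

section LieDerivative

variable {Y Y' : (x : M) → TangentSpace 𝓘(ℝ, F) x}
  (hY : ContMDiff 𝓘(ℝ, F) 𝓘(ℝ, F).tangent ∞ (fun y => (⟨y, Y y⟩ : TangentBundle 𝓘(ℝ, F) M)))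
  (hY' : ContMDiff 𝓘(ℝ, F) 𝓘(ℝ, F).tangent ∞ (fun y => (⟨y, Y' y⟩ : TangentBundle 𝓘(ℝ, F) M)))
  (α β : OneForm F M) (X : SmoothVectorField F M) (x : M)

theorem lieDerivative_add_right :
    lieDerivative Y (α + β) X x = lieDerivative Y α X x + lieDerivative Y β X x := by
  have h := differential_add ((contMDiff_oneForm_vectorField α X).mdifferentiable (by simp) x)
    ((contMDiff_oneForm_vectorField β X).mdifferentiable (by simp) x) (Y x)
  change differential (fun y => α y (X y) + β y (X y)) x (Y x) -
    (α x (mlieBracket 𝓘(ℝ, F) Y (fun y => X y) x) +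
      β x (mlieBracket 𝓘(ℝ, F) Y (fun y => X y) x)) = _
  rw [h, lieDerivative, lieDerivative]
  ring

theorem lieDerivative_smul_right (f : C^∞⟮𝓘(ℝ, F), M; 𝓘(ℝ, ℝ), ℝ⟯) :
    lieDerivative Y (smulSection f α) X x =
      f x * lieDerivative Y α X x + differential f x (Y x) * α x (X x) := by
  have h := differential_mul (f.contMDiff.mdifferentiable (by simp) x)
    ((contMDiff_oneForm_vectorField α X).mdifferentiable (by simp) x) (Y x)
  change differential (fun y => f y * α y (X y)) x (Y x) -
    f x * α x (mlieBracket 𝓘(ℝ, F) Y (fun y => X y) x) = _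
  rw [h, lieDerivative]
  ring

variable [FiniteDimensional ℝ F]

include hY hY' in
theorem lieDerivative_add_left :
    lieDerivative (Y + Y') β X x = lieDerivative Y β X x + lieDerivative Y' β X x := by
  have : CompleteSpace F := FiniteDimensional.complete ℝ F
  have h := mlieBracket_add_left (W := fun y => X y) (hY.mdifferentiable (by simp) x)
    (hY'.mdifferentiable (by simp) x)
  have h1 : (β x : F →L[ℝ] ℝ) (mlieBracket 𝓘(ℝ, F) (Y + Y') (fun y => X y) x) =
      β x (mlieBracket 𝓘(ℝ, F) Y (fun y => X y) x) +
        β x (mlieBracket 𝓘(ℝ, F) Y' (fun y => X y) x) :=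
    (congrArg (β x : F →L[ℝ] ℝ) h).trans (map_add (β x : F →L[ℝ] ℝ) _ _)
  have h2 : (differential (fun y => β y (X y)) x : F →L[ℝ] ℝ) ((Y + Y') x) =
      differential (fun y => β y (X y)) x (Y x) + differential (fun y => β y (X y)) x (Y' x) :=
    map_add (differential (fun y => β y (X y)) x : F →L[ℝ] ℝ) _ _
  refine (congrArg₂ (· - ·) h2 h1).trans ?_
  rw [lieDerivative, lieDerivative]
  ring

include hY in
theorem lieDerivative_smul_left (f : C^∞⟮𝓘(ℝ, F), M; 𝓘(ℝ, ℝ), ℝ⟯) :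
    lieDerivative (fun y => f y • Y y) β X x =
      f x * lieDerivative Y β X x + differential f x (X x) * β x (Y x) := by
  have : CompleteSpace F := FiniteDimensional.complete ℝ F
  have h := mlieBracket_smul_left (W := fun y => X y) (f.contMDiff.mdifferentiable (by simp) x)
    (hY.mdifferentiable (by simp) x)
  have h1 : (β x : F →L[ℝ] ℝ) (mlieBracket 𝓘(ℝ, F) (fun y => f y • Y y) (fun y => X y) x) =
      -differential f x (X x) * β x (Y x) +
        f x * β x (mlieBracket 𝓘(ℝ, F) Y (fun y => X y) x) := by
    refine (congrArg (β x : F →L[ℝ] ℝ) h).trans ((map_add (β x : F →L[ℝ] ℝ) _ _).trans ?_)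
    exact congrArg₂ (· + ·) (map_smul (β x : F →L[ℝ] ℝ) _ _) (map_smul (β x : F →L[ℝ] ℝ) _ _)
  have h2 : (differential (fun y => β y (X y)) x : F →L[ℝ] ℝ) (f x • Y x) =
      f x * differential (fun y => β y (X y)) x (Y x) :=
    map_smul (differential (fun y => β y (X y)) x : F →L[ℝ] ℝ) _ _
  refine (congrArg₂ (· - ·) h2 h1).trans ?_
  rw [lieDerivative]
  ring

include hY in
-- This is L_Y df = d(Y·f): the bracket term cancels Y·(X·f) and leaves X·(Y·f).
theorem lieDerivative_exteriorDerivative (f : C^∞⟮𝓘(ℝ, F), M; 𝓘(ℝ, ℝ), ℝ⟯) :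
    lieDerivative Y (exteriorDerivative f) X x =
      differential (fun y => differential f y (Y y)) x (X x) := by
  have h := mlieBracket_apply_differential f.contMDiff (hY x) (X.contMDiff x)
  refine (congrArg (differential (fun y => differential f y (X y)) x (Y x) - ·) h).trans ?_
  exact sub_sub_cancel _ _

end LieDerivative

variable (π : BivectorField F M) (α α' β : OneForm F M) (X : SmoothVectorField F M) (x : M)

theorem koszulBracket_skew : koszulBracket π α β X x = -koszulBracket π β α X x := by
  have h := differential_const_mul (-1) ((contMDiff_pairing π β α).mdifferentiable (by simp) x)
    (X x)
  have e : (fun y => π.pairing y (α y) (β y)) = fun y => -1 * π.pairing y (β y) (α y) := by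
    ext y
    rw [neg_one_mul]
    exact π.skew y _ _
  rw [koszulBracket, koszulBracket, e, h]
  ring

variable [FiniteDimensional ℝ F]

theorem koszulBracket_add_left :
    koszulBracket π (α + α') β X x = koszulBracket π α β X x + koszulBracket π α' β X x := by
  have h1 := lieDerivative_add_left (contMDiff_sharp_apply π α) (contMDiff_sharp_apply π α') β X x
  have e1 : (fun y => π.sharp y ((α + α') y)) =
      (fun y => π.sharp y (α y)) + fun y => π.sharp y (α' y) :=
    funext fun y => map_add (π.sharp y) (α y) (α' y)
  have h2 := differential_add ((contMDiff_pairing π α β).mdifferentiable (by simp) x)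
    ((contMDiff_pairing π α' β).mdifferentiable (by simp) x) (X x)
  have e2 : (fun y => π.pairing y ((α + α') y) (β y)) =
      fun y => π.pairing y (α y) (β y) + π.pairing y (α' y) (β y) :=
    funext fun y => (congrArg (β y) (map_add (π.sharp y) (α y) (α' y))).trans (map_add (β y) _ _)
  rw [koszulBracket, e1, h1, e2, h2, lieDerivative_add_right, koszulBracket, koszulBracket]
  ring

/-- The terms df(X) π(α,β) coming from L_{fα^#}β and from d(π(fα,β)) cancel, so only the derivative
of f along β^# remains. -/
theorem koszulBracket_smul_left (f : C^∞⟮𝓘(ℝ, F), M; 𝓘(ℝ, ℝ), ℝ⟯) :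
    koszulBracket π (smulSection f α) β X x =
      f x * koszulBracket π α β X x - differential f x (π.sharp x (β x)) * α x (X x) := by
  have h1 := lieDerivative_smul_left (contMDiff_sharp_apply π α) β X x f
  have e1 : (fun y => π.sharp y (smulSection f α y)) = fun y => f y • π.sharp y (α y) :=
    funext fun y => map_smul (π.sharp y) (f y) (α y)
  have h2 := differential_mul (f.contMDiff.mdifferentiable (by simp) x)
    ((contMDiff_pairing π α β).mdifferentiable (by simp) x) (X x)
  have e2 : (fun y => π.pairing y (smulSection f α y) (β y)) =
      fun y => f y * π.pairing y (α y) (β y) :=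
    funext fun y => (congrArg (β y) (map_smul (π.sharp y) (f y) (α y))).trans (map_smul (β y) _ _)
  rw [koszulBracket, e1, h1, e2, h2, lieDerivative_smul_right, koszulBracket,
    BivectorField.pairing]
  ring

/-- Each of the two Lie derivative terms contributes d{f,g}, the second through skew-symmetry, and
the last term removes one copy. -/
theorem koszulBracket_exteriorDerivative (f g : C^∞⟮𝓘(ℝ, F), M; 𝓘(ℝ, ℝ), ℝ⟯) :
    koszulBracket π (exteriorDerivative f) (exteriorDerivative g) X x =
      differential (π.bracket f g) x (X x) := by
  have h := differential_const_mul (-1)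
    ((contMDiff_pairing π (exteriorDerivative f) (exteriorDerivative g)).mdifferentiable
      (by simp) x) (X x)
  have e : (fun y => differential f y (π.sharp y (exteriorDerivative g y))) =
      fun y => -1 * π.pairing y (exteriorDerivative f y) (exteriorDerivative g y) := by
    ext y
    rw [neg_one_mul]
    exact π.skew y _ _
  rw [koszulBracket, lieDerivative_exteriorDerivative (contMDiff_sharp_apply π _),
    lieDerivative_exteriorDerivative (contMDiff_sharp_apply π _), e, h]
  change differential (π.bracket f g) x (X x) - -1 * differential (π.bracket f g) x (X x) -
    differential (π.bracket f g) x (X x) = _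
  ring

namespace ContravariantConnection

variable {π} (D : ContravariantConnection π)

omit [FiniteDimensional ℝ F] in
theorem torsion_skew : D.torsion α β X x = -D.torsion β α X x := by
  rw [torsion, torsion, koszulBracket_skew]
  ring

theorem torsion_add_left :
    D.torsion (α + α') β X x = D.torsion α β X x + D.torsion α' β X x := by
  have h1 : D.toBilin (α + α') β x (X x) = D.toBilin α β x (X x) + D.toBilin α' β x (X x) := by
    rw [map_add]
    rfl
  have h2 : D.toBilin β (α + α') x (X x) = D.toBilin β α x (X x) + D.toBilin β α' x (X x) := by
    rw [map_add]
    rfl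
  rw [torsion, torsion, torsion, koszulBracket_add_left, h1, h2]
  ring

/-- The derivative of f along β^# occurs in D_β(fα) and in the Koszul bracket, with opposite
effects. -/
theorem torsion_smulSection_left (f : C^∞⟮𝓘(ℝ, F), M; 𝓘(ℝ, ℝ), ℝ⟯) :
    D.torsion (smulSection f α) β X x = f x * D.torsion α β X x := by
  have h1 : D.toBilin (smulSection f α) β x (X x) = f x * D.toBilin α β x (X x) :=
    congrArg (fun L : F →L[ℝ] ℝ => L (X x)) (D.smul_left f α β (smulSection f α) (fun _ => rfl) x)
  have h2 : D.toBilin β (smulSection f α) x (X x) =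
      differential f x (π.sharp x (β x)) * α x (X x) + f x * D.toBilin β α x (X x) :=
    congrArg (fun L : F →L[ℝ] ℝ => L (X x)) (D.leibniz f β α (smulSection f α) (fun _ => rfl) x)
  rw [torsion, torsion, koszulBracket_smul_left, h1, h2]
  ring

/-- The torsion as a linear map in its first argument. -/
def torsionLeft : OneForm F M →ₗ[ℝ] ℝ where
  toFun α := D.torsion α β X x
  map_add' α α' := D.torsion_add_left α α' β X x
  map_smul' c α := D.torsion_smulSection_left α β X x (ContMDiffMap.const c)

theorem torsion_congr_left [T2Space M] (h : α x = α' x) :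
    D.torsion α β X x = D.torsion α' β X x := by
  have := eq_zero_of_tensorial (D.torsionLeft β X x) x
    (fun f s => D.torsion_smulSection_left s β X x f) (α - α') (sub_eq_zero.2 h)
  rwa [map_sub, sub_eq_zero] at this

/-- The torsion is tensorial in its first slot, hence by skew-symmetry in both, and every covector
is the differential of a function. -/
theorem isTorsionless_of_exteriorDerivative [T2Space M]
    (h : ∀ (f g : C^∞⟮𝓘(ℝ, F), M; 𝓘(ℝ, ℝ), ℝ⟯) (X : SmoothVectorField F M) (x : M),
      D.torsion (exteriorDerivative f) (exteriorDerivative g) X x = 0) : D.IsTorsionless := by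
  intro α β X x
  obtain ⟨f, hf⟩ := exists_differential_eq x (α x)
  obtain ⟨g, hg⟩ := exists_differential_eq x (β x)
  rw [D.torsion_congr_left α (exteriorDerivative f) β X x hf.symm, torsion_skew,
    D.torsion_congr_left β (exteriorDerivative g) _ X x hg.symm, h, neg_zero]

end ContravariantConnection

end Torsion

/-! ### Construction and uniqueness of the invariant connection with given bilinear map -/

namespace ReductiveComplement

variable {E : Type*} [NormedAddCommGroup E] [NormedSpace ℝ E] [FiniteDimensional ℝ E]
  {G : Type*} [TopologicalSpace G] [ChartedSpace E G] [Group G] [LieGroup 𝓘(ℝ, E) ∞ G]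
  {H : Subgroup G}
  {F : Type*} [NormedAddCommGroup F] [NormedSpace ℝ F] [FiniteDimensional ℝ F]
  [ChartedSpace F (G ⧸ H)] [IsManifold 𝓘(ℝ, F) ∞ (G ⧸ H)]
  (𝔪 : ReductiveComplement E H)
  (hp : Manifold.IsSubmersion 𝓘(ℝ, E) 𝓘(ℝ, F) ∞ (QuotientGroup.mk : G → G ⧸ H))
  {π : BivectorField F (G ⧸ H)}

include hp in
omit [FiniteDimensional ℝ F] in
theorem oneForm_eq_of_equivariantFun_eq_add {α β γ : OneForm F (G ⧸ H)} {c d : ℝ} {g : G}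
    (h : 𝔪.equivariantFun γ g = c • 𝔪.equivariantFun α g + d • 𝔪.equivariantFun β g) :
    γ (g : G ⧸ H) = c • α (g : G ⧸ H) + d • β (g : G ⧸ H) := by
  ext v
  obtain ⟨u, rfl⟩ := 𝔪.tangentMap_surjective hp g v
  have := LinearMap.congr_fun h u
  rw [LinearMap.add_apply, LinearMap.smul_apply, LinearMap.smul_apply,
    𝔪.equivariantFun_apply hp, 𝔪.equivariantFun_apply hp, 𝔪.equivariantFun_apply hp] at this
  exact this

variable (b : 𝔪.Dual →ₗ[ℝ] 𝔪.Dual →ₗ[ℝ] 𝔪.Dual)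

omit [FiniteDimensional ℝ E]

theorem contMDiff_connectionFun [FiniteDimensional ℝ E] (α β : OneForm F (G ⧸ H)) (u : 𝔪.space) :
    ContMDiff 𝓘(ℝ, E) 𝓘(ℝ, ℝ) ∞ (fun g => 𝔪.connectionFun hp π b α β g u) :=
  (contMDiff_bilin_dual (𝔪.contMDiff_equivariantFun hp α) (𝔪.contMDiff_equivariantFun hp β)
    (b.compr₂ (LinearMap.applyₗ u))).add
    (contMDiff_leftDeriv_dual (𝔪.contMDiff_equivariantFun hp α) (𝔪.contMDiff_equivariantFun hp β u)
      (𝔪.space.subtype ∘ₗ 𝔪.sharp π))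

theorem dualDeriv_mul_of_mem [T2Space (G ⧸ H)] (β : OneForm F (G ⧸ H))
    (v : GroupLieAlgebra 𝓘(ℝ, E) G) (g : G) {h : G} (hh : h ∈ H) :
    𝔪.dualDeriv hp β v (g * h) = 𝔪.dualDeriv hp β (Ad E h v) g ∘ₗ 𝔪.AdRestrict h := by
  ext u
  refine (leftDeriv_comp_mul_right (𝔪.contMDiff_equivariantFun hp β u) h v g).symm.trans ?_
  simp only [𝔪.equivariantFun_mul_of_mem hp β _ hh]
  rfl

/-- Passing from g to gh replaces the direction of differentiation by its Ad_h-image. By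
`AdRestrict_sharp`, the image of (η ∘ Ad_h)^# is η^#, so the direction at g is the right one. -/
theorem connectionFun_mul_of_mem [FiniteDimensional ℝ E] [T2Space (G ⧸ H)] (hπG : π.IsInvariant G)
    (hb : ∀ h ∈ H, ∀ η ξ, b (η ∘ₗ 𝔪.AdRestrict h) (ξ ∘ₗ 𝔪.AdRestrict h) =
      b η ξ ∘ₗ 𝔪.AdRestrict h) (α β : OneForm F (G ⧸ H)) (g : G) {h : G} (hh : h ∈ H) :
    𝔪.connectionFun hp π b α β (g * h) = 𝔪.connectionFun hp π b α β g ∘ₗ 𝔪.AdRestrict h := by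
  rw [connectionFun, dualDeriv_mul_of_mem 𝔪 hp β _ g hh, 𝔪.equivariantFun_mul_of_mem hp α g hh,
    𝔪.equivariantFun_mul_of_mem hp β g hh, hb h hh, ← 𝔪.coe_AdRestrict hh,
    𝔪.AdRestrict_sharp hp hπG hh]
  rfl

theorem connectionFun_add_left (α α' β : OneForm F (G ⧸ H)) (g : G) :
    𝔪.connectionFun hp π b (α + α') β g =
      𝔪.connectionFun hp π b α β g + 𝔪.connectionFun hp π b α' β g := by
  simp only [connectionFun, 𝔪.equivariantFun_add hp, map_add, LinearMap.add_apply,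
    Submodule.coe_add, dualDeriv_add_left]
  abel

theorem connectionFun_add_right (α β β' : OneForm F (G ⧸ H)) (g : G) :
    𝔪.connectionFun hp π b α (β + β') g =
      𝔪.connectionFun hp π b α β g + 𝔪.connectionFun hp π b α β' g := by
  simp only [connectionFun, 𝔪.equivariantFun_add hp, map_add, dualDeriv_add]
  abel

theorem connectionFun_smul_right (c : ℝ) (α β : OneForm F (G ⧸ H)) (g : G) :
    𝔪.connectionFun hp π b α (c • β) g = c • 𝔪.connectionFun hp π b α β g := by
  simp only [connectionFun, 𝔪.equivariantFun_smul hp, map_smul, dualDeriv_smul, smul_add]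

theorem connectionFun_of_eq_smul_left {f : G ⧸ H → ℝ} {α γ : OneForm F (G ⧸ H)}
    (h : ∀ x, γ x = f x • α x) (β : OneForm F (G ⧸ H)) (g : G) :
    𝔪.connectionFun hp π b γ β g = f g • 𝔪.connectionFun hp π b α β g := by
  simp only [connectionFun, 𝔪.equivariantFun_of_eq_smul hp h, map_smul, LinearMap.smul_apply,
    Submodule.coe_smul, dualDeriv_smul_left, smul_add]

theorem connectionFun_of_eq_smul_right (f : C^∞⟮𝓘(ℝ, F), G ⧸ H; 𝓘(ℝ, ℝ), ℝ⟯)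
    {β γ : OneForm F (G ⧸ H)} (h : ∀ x, γ x = f x • β x) (α : OneForm F (G ⧸ H)) (g : G) :
    𝔪.connectionFun hp π b α γ g =
      leftDeriv (𝔪.sharp π (𝔪.equivariantFun α g) : GroupLieAlgebra 𝓘(ℝ, E) G)
        (fun x : G => f (x : G ⧸ H)) g • 𝔪.equivariantFun β g +
        f (g : G ⧸ H) • 𝔪.connectionFun hp π b α β g := by
  simp only [connectionFun, 𝔪.equivariantFun_of_eq_smul hp h, map_smul,
    𝔪.dualDeriv_of_eq_smul hp f h]
  module

variable [FiniteDimensional ℝ E] [T2Space (G ⧸ H)] (hπG : π.IsInvariant G)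
  (hb : ∀ h ∈ H, ∀ η ξ, b (η ∘ₗ 𝔪.AdRestrict h) (ξ ∘ₗ 𝔪.AdRestrict h) = b η ξ ∘ₗ 𝔪.AdRestrict h)

include hπG hb in
-- The equivariant functions descend to forms. Since forms are determined by their functions, the
-- axioms of a connection can be checked on G.
theorem exists_connection : ∃ D : ContravariantConnection π, ∀ (α β : OneForm F (G ⧸ H)) (g : G),
    𝔪.equivariantFun (D.toBilin α β) g = 𝔪.connectionFun hp π b α β g := by
  choose d hd using fun α β : OneForm F (G ⧸ H) => 𝔪.exists_oneForm_equivariantFun_eq hp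
    (𝔪.contMDiff_connectionFun hp (π := π) b α β)
    (fun g _ hh => 𝔪.connectionFun_mul_of_mem hp b hπG hb α β g hh)
  have hd' : ∀ α β g, 𝔪.equivariantFun (d α β) g = 𝔪.connectionFun hp π b α β g := fun α β g =>
    congrFun (hd α β) g
  let B : OneForm F (G ⧸ H) →ₗ[ℝ] OneForm F (G ⧸ H) →ₗ[ℝ] OneForm F (G ⧸ H) :=
    LinearMap.mk₂ ℝ d
      (fun α α' β => 𝔪.equivariantFun_injective hp (funext fun g => by
        rw [𝔪.equivariantFun_add hp, hd', hd', hd', connectionFun_add_left]))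
      (fun c α β => 𝔪.equivariantFun_injective hp (funext fun g => by
        rw [𝔪.equivariantFun_smul hp, hd', hd',
          𝔪.connectionFun_of_eq_smul_left hp b (f := fun _ => c) fun _ => rfl]))
      (fun α β β' => 𝔪.equivariantFun_injective hp (funext fun g => by
        rw [𝔪.equivariantFun_add hp, hd', hd', hd', connectionFun_add_right]))
      (fun c α β => 𝔪.equivariantFun_injective hp (funext fun g => by
        rw [𝔪.equivariantFun_smul hp, hd', hd', connectionFun_smul_right]))
  refine ⟨⟨B, fun f α β γ h x => ?_, fun f α β γ h x => ?_⟩, hd'⟩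
  · have e : d γ β = smulSection f (d α β) := 𝔪.equivariantFun_injective hp (funext fun g => by
      rw [𝔪.equivariantFun_of_eq_smul hp (γ := smulSection f (d α β)) (α := d α β) (f := f)
        fun _ => rfl, hd', hd', 𝔪.connectionFun_of_eq_smul_left hp b h])
    exact congrArg (fun s : OneForm F (G ⧸ H) => s x) e
  · obtain ⟨g, rfl⟩ := QuotientGroup.mk_surjective x
    refine 𝔪.oneForm_eq_of_equivariantFun_eq_add hp ?_
    change 𝔪.equivariantFun (d α γ) g = _ + _ • 𝔪.equivariantFun (d α β) g
    rw [hd', hd', 𝔪.connectionFun_of_eq_smul_right hp b f h,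
      𝔪.differential_sharp_oneForm hp hπG f.contMDiff]

variable {D : ContravariantConnection π}
  (hD : ∀ (α β : OneForm F (G ⧸ H)) (g : G),
    𝔪.equivariantFun (D.toBilin α β) g = 𝔪.connectionFun hp π b α β g)

include hD in
omit [T2Space (G ⧸ H)] in
theorem isInvariant_of_equivariantFun_eq : D.IsInvariant G := by
  intro a α β α' β' hα hβ x
  obtain ⟨δ, hδ⟩ := exists_pullback hp a (D.toBilin α β)
  rw [← hδ]
  have e : D.toBilin α' β' = δ := 𝔪.equivariantFun_injective hp (funext fun g => by
    rw [𝔪.equivariantFun_pullback hp hδ, hD, hD, connectionFun, 𝔪.equivariantFun_pullback hp hα,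
      𝔪.equivariantFun_pullback hp hβ, 𝔪.dualDeriv_pullback hp hβ]
    rfl)
  rw [e]

include hp in
omit [T2Space (G ⧸ H)] in
theorem connection_unique {D D' : ContravariantConnection π} (hD : D.IsInvariant G)
    (hD' : D'.IsInvariant G) (h : 𝔪.IsAssociated D b) (h' : 𝔪.IsAssociated D' b) : D' = D := by
  have e : D'.toBilin = D.toBilin := by
    ext α β : 2
    refine 𝔪.equivariantFun_injective hp (funext fun g => ?_)
    rw [𝔪.equivariantFun_connection hp hD h, 𝔪.equivariantFun_connection hp hD' h']
  cases D
  cases D'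
  congr

end ReductiveComplement

/-! ### The Fedosov property -/

namespace ReductiveComplement

variable {E : Type*} [NormedAddCommGroup E] [NormedSpace ℝ E] [FiniteDimensional ℝ E]
  {G : Type*} [TopologicalSpace G] [ChartedSpace E G] [Group G] [LieGroup 𝓘(ℝ, E) ∞ G]
  {H : Subgroup G}
  {F : Type*} [NormedAddCommGroup F] [NormedSpace ℝ F] [FiniteDimensional ℝ F]
  [ChartedSpace F (G ⧸ H)] [IsManifold 𝓘(ℝ, F) ∞ (G ⧸ H)]
  (𝔪 : ReductiveComplement E H)
  (hp : Manifold.IsSubmersion 𝓘(ℝ, E) 𝓘(ℝ, F) ∞ (QuotientGroup.mk : G → G ⧸ H))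

omit [FiniteDimensional ℝ F] [IsManifold 𝓘(ℝ, F) ∞ (G ⧸ H)] [ChartedSpace F (G ⧸ H)]
  [NormedAddCommGroup F] [NormedSpace ℝ F] in
theorem leftMul_apply (u v : 𝔪.space) :
    𝔪.leftMul u v = 𝔪.proj ⁅(u : GroupLieAlgebra 𝓘(ℝ, E) G), (v : GroupLieAlgebra 𝓘(ℝ, E) G)⁆ :=
  rfl

theorem leftMul_skew (u v : 𝔪.space) : 𝔪.leftMul u v = -𝔪.leftMul v u := by
  have : CompleteSpace E := FiniteDimensional.complete ℝ E
  rw [leftMul_apply, leftMul_apply, ← lie_skew, map_neg]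

/-- Collects the two occurrences of ξ ∘ l_{η^#}, exhibiting the weights 1/3 and −2/3. Their
difference 1 yields vanishing torsion, and their ratio −2 the Poisson condition. -/
theorem fedosovMap_apply (π : BivectorField F (G ⧸ H)) (η ξ : 𝔪.Dual) (u : 𝔪.space) :
    𝔪.fedosovMap π η ξ u = (1 / 3) * (η (𝔪.leftMul (𝔪.sharp π ξ) u) -
      2 * ξ (𝔪.leftMul (𝔪.sharp π η) u)) := by
  change (1 / 3) * ((-ξ (𝔪.leftMul (𝔪.sharp π η) u) + η (𝔪.leftMul (𝔪.sharp π ξ) u)) -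
    ξ (𝔪.leftMul (𝔪.sharp π η) u)) = _
  ring

variable [T2Space (G ⧸ H)] {π : BivectorField F (G ⧸ H)}

include hp in
theorem AdRestrict_leftMul [T2Space G] {h : G} (hh : h ∈ H) (u v : 𝔪.space) :
    𝔪.AdRestrict h (𝔪.leftMul u v) = 𝔪.leftMul (𝔪.AdRestrict h u) (𝔪.AdRestrict h v) := by
  have : CompleteSpace E := FiniteDimensional.complete ℝ E
  rw [leftMul_apply, leftMul_apply, ← 𝔪.proj_Ad hp hh, 𝔪.coe_AdRestrict hh, 𝔪.coe_AdRestrict hh,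
    Ad_lie]

include hp in
theorem fedosovMap_comp_AdRestrict [T2Space G] (hπG : π.IsInvariant G) {h : G} (hh : h ∈ H)
    (η ξ : 𝔪.Dual) :
    𝔪.fedosovMap π (η ∘ₗ 𝔪.AdRestrict h) (ξ ∘ₗ 𝔪.AdRestrict h) =
      𝔪.fedosovMap π η ξ ∘ₗ 𝔪.AdRestrict h := by
  ext u
  simp only [fedosovMap_apply, LinearMap.comp_apply, 𝔪.AdRestrict_leftMul hp hh,
    𝔪.AdRestrict_sharp hp hπG hh]

omit [FiniteDimensional ℝ E] [T2Space (G ⧸ H)] in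
theorem dualDeriv_exteriorDerivative (f : C^∞⟮𝓘(ℝ, F), G ⧸ H; 𝓘(ℝ, ℝ), ℝ⟯)
    (v : GroupLieAlgebra 𝓘(ℝ, E) G) (g : G) (u : 𝔪.space) :
    𝔪.dualDeriv hp (exteriorDerivative f) v g u =
      leftDeriv v (leftDeriv (u : GroupLieAlgebra 𝓘(ℝ, E) G) (fun x : G => f (x : G ⧸ H))) g := by
  change leftDeriv v _ g = _
  simp only [𝔪.equivariantFun_exteriorDerivative hp]

/-- Both terms are second derivatives of f ∘ p along left-invariant fields, so their difference is
the derivative along [u, v]. Its 𝔥-component acts trivially on functions lifted from G/H. -/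
theorem dualDeriv_exteriorDerivative_sub (f : C^∞⟮𝓘(ℝ, F), G ⧸ H; 𝓘(ℝ, ℝ), ℝ⟯)
    (u v : 𝔪.space) (g : G) :
    𝔪.dualDeriv hp (exteriorDerivative f) (u : GroupLieAlgebra 𝓘(ℝ, E) G) g v -
        𝔪.dualDeriv hp (exteriorDerivative f) (v : GroupLieAlgebra 𝓘(ℝ, E) G) g u =
      𝔪.equivariantFun (exteriorDerivative f) g (𝔪.leftMul u v) := by
  rw [𝔪.dualDeriv_exteriorDerivative hp, 𝔪.dualDeriv_exteriorDerivative hp,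
    ← leftDeriv_commutator (f := fun x : G => f (x : G ⧸ H)) (f.contMDiff.comp hp.contMDiff), leftMul_apply,
    ← 𝔪.leftDeriv_proj hp]

section

variable (hπG : π.IsInvariant G)
include hπG

omit [T2Space (G ⧸ H)] in
theorem leftDeriv_bracket (f k : C^∞⟮𝓘(ℝ, F), G ⧸ H; 𝓘(ℝ, ℝ), ℝ⟯)
    (v : GroupLieAlgebra 𝓘(ℝ, E) G) (g : G) :
    leftDeriv v (fun x : G => π.bracket f k (x : G ⧸ H)) g =
      𝔪.dualDeriv hp (exteriorDerivative k) v g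
          (𝔪.sharp π (𝔪.equivariantFun (exteriorDerivative f) g)) -
        𝔪.dualDeriv hp (exteriorDerivative f) v g
          (𝔪.sharp π (𝔪.equivariantFun (exteriorDerivative k) g)) := by
  refine (𝔪.leftDeriv_bivector hp hπG (exteriorDerivative f) (exteriorDerivative k) v g).trans ?_
  rw [𝔪.bivector_skew π (𝔪.dualDeriv hp _ v g), bivector_eq, bivector_eq]
  ring

omit [T2Space (G ⧸ H)] in
-- By skew-symmetry {{f,k},l} is minus the derivative of {f,k} along the field of dl, which
-- `leftDeriv_bracket` expands.
theorem bracket_bracket (f k l : C^∞⟮𝓘(ℝ, F), G ⧸ H; 𝓘(ℝ, ℝ), ℝ⟯) (g : G) :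
    π.bracket (π.bracket f k) l (g : G ⧸ H) =
      𝔪.dualDeriv hp (exteriorDerivative f)
          (𝔪.sharp π (𝔪.equivariantFun (exteriorDerivative l) g) : GroupLieAlgebra 𝓘(ℝ, E) G) g
          (𝔪.sharp π (𝔪.equivariantFun (exteriorDerivative k) g)) -
        𝔪.dualDeriv hp (exteriorDerivative k)
          (𝔪.sharp π (𝔪.equivariantFun (exteriorDerivative l) g) : GroupLieAlgebra 𝓘(ℝ, E) G) g
          (𝔪.sharp π (𝔪.equivariantFun (exteriorDerivative f) g)) := by
  have h1 := 𝔪.differential_sharp_oneForm hp hπG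
    (contMDiff_pairing π (exteriorDerivative f) (exteriorDerivative k)) (exteriorDerivative l) g
  refine (π.skew _ _ _).trans ((congrArg Neg.neg h1).trans ?_)
  have h2 := 𝔪.leftDeriv_bracket hp hπG f k
    (𝔪.sharp π (𝔪.equivariantFun (exteriorDerivative l) g) : GroupLieAlgebra 𝓘(ℝ, E) G) g
  refine (congrArg Neg.neg h2).trans ?_
  ring

include hp in
-- The Jacobi identity for f, k, l with differentials η, ξ, ε at ē. In the sum of the three double
-- brackets each function contributes two second derivatives with the directions interchanged and
-- opposite signs, and their difference is a bracket in 𝔪.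
theorem cyclic_sum_leftMul_sharp (hπ : π.IsPoisson) (η ξ ε : 𝔪.Dual) :
    η (𝔪.leftMul (𝔪.sharp π ε) (𝔪.sharp π ξ)) + ξ (𝔪.leftMul (𝔪.sharp π η) (𝔪.sharp π ε)) +
      ε (𝔪.leftMul (𝔪.sharp π ξ) (𝔪.sharp π η)) = 0 := by
  obtain ⟨f, rfl⟩ := 𝔪.exists_equivariantFun_eq hp 1 η
  obtain ⟨k, rfl⟩ := 𝔪.exists_equivariantFun_eq hp 1 ξ
  obtain ⟨l, rfl⟩ := 𝔪.exists_equivariantFun_eq hp 1 ε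
  have h := hπ f k l ((1 : G) : G ⧸ H)
  rw [𝔪.bracket_bracket hp hπG, 𝔪.bracket_bracket hp hπG, 𝔪.bracket_bracket hp hπG] at h
  rw [← 𝔪.dualDeriv_exteriorDerivative_sub hp, ← 𝔪.dualDeriv_exteriorDerivative_sub hp,
    ← 𝔪.dualDeriv_exteriorDerivative_sub hp]
  linarith

include hp in
-- With the weights 1/3 and −2/3 the left side is 2/3 times the cyclic sum of
-- `cyclic_sum_leftMul_sharp`.
theorem bivector_fedosovMap (hπ : π.IsPoisson) (η ξ ε : 𝔪.Dual) :
    𝔪.bivector π (𝔪.fedosovMap π η ξ) ε + 𝔪.bivector π ξ (𝔪.fedosovMap π η ε) = 0 := by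
  have h := 𝔪.cyclic_sum_leftMul_sharp hp hπG hπ η ξ ε
  rw [𝔪.bivector_skew π (𝔪.fedosovMap π η ξ), bivector_eq, bivector_eq, fedosovMap_apply,
    fedosovMap_apply, 𝔪.leftMul_skew (𝔪.sharp π ξ) (𝔪.sharp π ε),
    𝔪.leftMul_skew (𝔪.sharp π η) (𝔪.sharp π ξ), map_neg, map_neg]
  linarith

/-- On exact forms the algebraic part contributes [η,ξ]_r, which is a difference of second
derivatives in the two possible orders. Together with the derivative part it equals the derivative
of {f,k}, which is the Koszul bracket of df and dk. -/
theorem isTorsionless_of_equivariantFun_eq {D : ContravariantConnection π}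
    (hD : ∀ (α β : OneForm F (G ⧸ H)) (g : G), 𝔪.equivariantFun (D.toBilin α β) g =
      𝔪.connectionFun hp π (𝔪.fedosovMap π) α β g) : D.IsTorsionless := by
  refine D.isTorsionless_of_exteriorDerivative fun f k X x => ?_
  obtain ⟨g, rfl⟩ := QuotientGroup.mk_surjective x
  obtain ⟨u, hu⟩ := 𝔪.tangentMap_surjective hp g (X (g : G ⧸ H))
  have h1 : ∀ β : OneForm F (G ⧸ H), β (g : G ⧸ H) (X (g : G ⧸ H)) = 𝔪.equivariantFun β g u :=
    fun β => (congrArg (β (g : G ⧸ H) : F →L[ℝ] ℝ) hu.symm).trans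
      (𝔪.equivariantFun_apply hp β g u).symm
  have h2 : differential (π.bracket f k) (g : G ⧸ H) (X (g : G ⧸ H)) =
      leftDeriv (u : GroupLieAlgebra 𝓘(ℝ, E) G) (fun x : G => π.bracket f k (x : G ⧸ H)) g :=
    (congrArg (differential (π.bracket f k) (g : G ⧸ H) : F →L[ℝ] ℝ) hu.symm).trans
      (differential_projDeriv hp
        (contMDiff_pairing π (exteriorDerivative f) (exteriorDerivative k)) g u)
  rw [ContravariantConnection.torsion, koszulBracket_exteriorDerivative, h1, h1, h2, hD, hD,
    𝔪.leftDeriv_bracket hp hπG, connectionFun, connectionFun, LinearMap.add_apply,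
    LinearMap.add_apply, fedosovMap_apply, fedosovMap_apply,
    ← 𝔪.dualDeriv_exteriorDerivative_sub hp, ← 𝔪.dualDeriv_exteriorDerivative_sub hp]
  ring

end

end ReductiveComplement
end ContravariantGeometry
end

/-! ### The theorem -/

open ContravariantGeometry in
theorem mainTheorem11
    {E : Type*} [NormedAddCommGroup E] [NormedSpace ℝ E] [FiniteDimensional ℝ E]
    {G : Type*} [TopologicalSpace G] [ChartedSpace E G] [Group G] [LieGroup 𝓘(ℝ, E) ∞ G]
    [T2Space G] [SecondCountableTopology G] [ConnectedSpace G]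
    (H : Subgroup G) (hH : IsClosed (H : Set G))
    {F : Type*} [NormedAddCommGroup F] [NormedSpace ℝ F] [FiniteDimensional ℝ F]
    [ChartedSpace F (G ⧸ H)] [IsManifold 𝓘(ℝ, F) ∞ (G ⧸ H)]
    (hp : Manifold.IsSubmersion 𝓘(ℝ, E) 𝓘(ℝ, F) ∞ (QuotientGroup.mk : G → G ⧸ H))
    (𝔪 : ReductiveComplement E H)
    (π : BivectorField F (G ⧸ H)) (hπ : π.IsPoisson) (hπG : π.IsInvariant G) :
    (∀ D : ContravariantConnection π, D.IsInvariant G →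
      ∃ b : 𝔪.Dual →ₗ[ℝ] 𝔪.Dual →ₗ[ℝ] 𝔪.Dual,
        𝔪.IsAssociated D b ∧ (∀ b', 𝔪.IsAssociated D b' → b' = b) ∧
        (D.IsPoisson ↔
          ∀ η ξ ε : 𝔪.Dual, 𝔪.bivector π (b η ξ) ε + 𝔪.bivector π ξ (b η ε) = 0)) ∧
    (∃ D : ContravariantConnection π,
      D.IsInvariant G ∧ 𝔪.IsAssociated D (𝔪.fedosovMap π) ∧ D.IsFedosov ∧
      ∀ D' : ContravariantConnection π,
        D'.IsInvariant G → 𝔪.IsAssociated D' (𝔪.fedosovMap π) → D' = D) := by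
  have : IsTopologicalGroup G := topologicalGroup_of_lieGroup 𝓘(ℝ, E) ∞
  have : T2Space (G ⧸ H) := t2Space_quotient hH
  constructor
  · intro D hD
    obtain ⟨b, hb⟩ := 𝔪.exists_isAssociated hp hπG D
    exact ⟨b, hb, fun b' hb' => 𝔪.isAssociated_unique hp hb hb', 𝔪.isPoisson_iff hp hπG hD hb⟩
  · obtain ⟨D, hD⟩ := 𝔪.exists_connection hp (𝔪.fedosovMap π) hπG
      fun h hh η ξ => 𝔪.fedosovMap_comp_AdRestrict hp hπG hh η ξ
    have hinv := 𝔪.isInvariant_of_equivariantFun_eq hp _ hD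
    have hass : 𝔪.IsAssociated D (𝔪.fedosovMap π) :=
      (𝔪.isAssociated_iff hp).2 fun α β => hD α β 1
    exact ⟨D, hinv, hass, ⟨𝔪.isTorsionless_of_equivariantFun_eq hp hπG hD,
      (𝔪.isPoisson_iff hp hπG hinv hass).2 (𝔪.bivector_fedosovMap hp hπG hπ)⟩,
      fun D' hD' h' => 𝔪.connection_unique hp _ hinv hD' hass h'⟩
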